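/- **Setting.** Time dependence $e^{\mathrm i\omega t}$, $\omega>0$. A dielectric circular cylinder of radius $\rho_{\rm cyl}>0$ (region $R_2$, parameters $\varepsilon_2,\mu_2>0$) lies in a medium $R_1$ (parameters $\varepsilon_1,\mu_1>0$); $k_j=\omega\sqrt{\varepsilon_j\mu_j}$, $Z_j=\sqrt{\mu_j/\varepsilon_j}$. A $z$-directed electric line source of amplitude $I\in\mathbb C$ lies at polar coordinates $(\rho_{\rm fil},0)$, with $\rho_{\rm fil}>\rho_{\rm cyl}$ (external excitation, $e=1$) or $0\le\rho_{\rm fil}<\rho_{\rm cyl}$ (internal excitation, $e=2$). Let $0<\rho^{(1)}_{\rm aux}<\rho_{\rm cyl}<\rho^{(2)}_{\rm aux}$, and assume the non-resonance condition $J_n(k_1\rho^{(1)}_{\rm aux})\ne0$ for all $n\in\mathbb Z$. Write $H_n=H^{(2)}_n=J_n-\mathrm iY_n$, $\sigma_1=1$, $\sigma_2=-1$, $D(a,b,\theta)=\sqrt{a^2+b^2-2ab\cos\theta}$, and, for $j=1,2$, $$\mathcal E_j(\rho,\theta)=H_0\big(k_jD(\rho_{\rm cyl},\rho,\theta)\big),\qquad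 \mathcal M_j(\rho,\theta)=\frac{\rho_{\rm cyl}-\rho\cos\theta}{D(\rho_{\rm cyl},\rho,\theta)}H_1\big(k_jD(\rho_{\rm cyl},\rho,\theta)\big).$$ The incident field is $E^{\rm inc}_{j}(\rho,\phi)=-\frac{k_jZ_j}{4}I\,H_0(k_jD(\rho,\rho_{\rm fil},\phi))$ if $j=e$, and $0$ otherwise. Densities $J,M$ on $\rho=\rho_{\rm cyl}$ generate, in the equivalent problem of region $j$, the total field $$E_j[J,M](\rho,\phi)=E_j^{\rm inc}(\rho,\phi)+\sigma_j\Big(-\tfrac{k_jZ_j\rho_{\rm cyl}}4\int_{-\pi}^{\pi}J(\phi')\mathcal E_j(\rho,\phi'-\phi)\,d\phi'+\tfrac{k_j\rho_{\rm cyl}}{4\mathrm i}\int_{-\pi}^{\pi}M(\phi')\mathcal M_j(\rho,\phi'-\phi)\,d\phi'\Big),$$ and $N$ discrete currents $I_l,K_l$ at angles $2\pi l/N$ generate $$E_j^{N}(\rho,\phi)=E_j^{\rm inc}(\rho,\phi)+\sigma_j\Big(-\tfrac{k_jZ_j}4\sum_{l=0}^{N-1}I_l\,\mathcal E_j(\rho,\tfrac{2\pi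 l}N-\phi)+\tfrac{k_j}{4\mathrm i}\sum_{l=0}^{N-1}K_l\,\mathcal M_j(\rho,\tfrac{2\pi l}N-\phi)\Big).$$ The discrete NFM-SEP system ($2N$ equations: $j=1,2$, $p=0,\dots,N-1$) is $$Z_j\sum_{l}I_l\,\mathcal E_j(\rho^{(j)}_{\rm aux},\tfrac{2\pi(p-l)}N)+\mathrm i\sum_{l}K_l\,\mathcal M_j(\rho^{(j)}_{\rm aux},\tfrac{2\pi(p-l)}N)=\begin{cases}-\sigma_jI Z_jH_0\big(k_jD(\rho^{(j)}_{\rm aux},\rho_{\rm fil},\tfrac{2\pi p}N)\big)&j=e,\\0&j\neq e,\end{cases}$$ i.e. $E^N_j=0$ at the collocation points $(\rho^{(j)}_{\rm aux},2\pi p/N)$. With $$\Delta_n=Z_1H_n(k_1\rho_{\rm cyl})J_n'(k_2\rho_{\rm cyl})-Z_2J_n(k_2\rho_{\rm cyl})H_n'(k_1\rho_{\rm cyl}),$$ the continuous densities $J_z^s=\sum_{n\in\mathbb Z}I^s_ne^{\mathrm in\phi}$, $M_\phi^s=\sum_{n\in\mathbb Z}M^s_ne^{\mathrm in\phi}$ are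 given by $$I_n^s=-\tfrac{I}{2\pi\rho_{\rm cyl}}\tfrac{Z_1H_n(k_1\rho_{\rm fil})J_n'(k_2\rho_{\rm cyl})}{\Delta_n},\quad M_n^s=\tfrac{I}{2\pi\rho_{\rm cyl}}\tfrac{\mathrm iZ_1Z_2H_n(k_1\rho_{\rm fil})J_n(k_2\rho_{\rm cyl})}{\Delta_n}\quad(e=1),$$ $$I_n^s=-\tfrac{I}{2\pi\rho_{\rm cyl}}\tfrac{Z_2J_n(k_2\rho_{\rm fil})H_n'(k_1\rho_{\rm cyl})}{\Delta_n},\quad M_n^s=\tfrac{I}{2\pi\rho_{\rm cyl}}\tfrac{\mathrm iZ_1Z_2J_n(k_2\rho_{\rm fil})H_n(k_1\rho_{\rm cyl})}{\Delta_n}\quad(e=2).$$ The exact fields are $E_z^{(j)}=E_j^{\rm inc}+\sum_{n\in\mathbb Z}t_n^{(j)}e^{\mathrm in\phi}$ with, for $e=1$, $$t^{(1)}_n=\tfrac{k_1Z_1I}4H_n(k_1\rho)H_n(k_1\rho_{\rm fil})\tfrac{Z_1J_n'(k_2\rho_{\rm cyl})J_n(k_1\rho_{\rm cyl})-Z_2J_n(k_2\rho_{\rm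 cyl})J_n'(k_1\rho_{\rm cyl})}{\Delta_n},\quad t_n^{(2)}=-\tfrac{I}{2\pi\rho_{\rm cyl}}J_n(k_2\rho)H_n(k_1\rho_{\rm fil})\tfrac{\mathrm iZ_1Z_2}{\Delta_n},$$ and, for $e=2$, $$t^{(1)}_n=-\tfrac{I}{2\pi\rho_{\rm cyl}}H_n(k_1\rho)J_n(k_2\rho_{\rm fil})\tfrac{\mathrm iZ_1Z_2}{\Delta_n},\quad t_n^{(2)}=\tfrac{k_2Z_2I}4J_n(k_2\rho)J_n(k_2\rho_{\rm fil})\tfrac{Z_1H_n(k_1\rho_{\rm cyl})H_n'(k_2\rho_{\rm cyl})-Z_2H_n'(k_1\rho_{\rm cyl})H_n(k_2\rho_{\rm cyl})}{\Delta_n}.$$ Finally, for $0\le m<N$, let $B_1^{(m)},B_2^{(m)},B_3^{(m)},B_4^{(m)}$ be the discrete Fourier coefficients $\frac1N\sum_{p=0}^{N-1}f(\frac{2\pi p}N)e^{-2\pi\mathrm imp/N}$ of $f=\mathcal E_1(\rho^{(1)}_{\rm aux},\cdot),\ \mathcal M_1(\rho^{(1)}_{\rm aux},\cdot),\ \mathcal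 E_2(\rho^{(2)}_{\rm aux},\cdot),\ \mathcal M_2(\rho^{(2)}_{\rm aux},\cdot)$, let $D^{(m)}$ be minus that of $\theta\mapsto H_0(k_eD(\rho^{(e)}_{\rm aux},\rho_{\rm fil},\theta))$, and let $\Delta^{(m)}=Z_1B_1^{(m)}B_4^{(m)}-Z_2B_2^{(m)}B_3^{(m)}$. **Theorem.** For external as well as for internal excitation: 1. Only finitely many radii $\rho^{(1)}_{\rm aux}\in(0,\rho_{\rm cyl})$ violate the non-resonance condition. 2. For every $N\ge1$ the four $N\times N$ blocks of the system matrix are circulant; the matrix is invertible if and only if $\Delta^{(m)}\neq0$ for all $0\le m<N$, and then the unique solution is $I_l=\sum_{m=0}^{N-1}I^{(m)}e^{2\pi\mathrm ilm/N}$, $K_l=\sum_{m=0}^{N-1}K^{(m)}e^{2\pi\mathrm ilm/N}$, where $$I^{(m)}=\tfrac IN\tfrac{Z_1D^{(m)}B_4^{(m)}}{\Delta^{(m)}},\ K^{(m)}=\tfrac IN\tfrac{\mathrm iZ_1Z_2D^{(m)}B_3^{(m)}}{\Delta^{(m)}}\ (e=1);\qquad I^{(m)}=\tfrac IN\tfrac{Z_2D^{(m)}B_2^{(m)}}{\Delta^{(m)}},\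 K^{(m)}=\tfrac IN\tfrac{\mathrm iZ_1Z_2D^{(m)}B_1^{(m)}}{\Delta^{(m)}}\ (e=2).$$ This is the case for all sufficiently large $N$. 3. $\Delta_n\ne0$ for all $n\in\mathbb Z$; the series of $J_z^s$ and $M^s_\phi$ converge absolutely to continuous functions, which satisfy the continuous NFM-SEP equations $E_j[J_z^s,M_\phi^s](\rho_{\rm aux}^{(j)},\phi)=0$ for $j=1,2$ and all $\phi$. 4. At every point of $R_1$ ($\rho>\rho_{\rm cyl}$) and of $R_2$ ($0\le\rho<\rho_{\rm cyl}$) other than the source point, the series of the exact field converges absolutely and $E_j[J_z^s,M_\phi^s]=E_z^{(j)}$. 5. Let $I_l=I_l(N)$, $K_l=K_l(N)$ solve the discrete system for all large $N$. Then, as $N\to\infty$, $$\max_{0\le l<N}\Big|\tfrac{N I_l}{2\pi\rho_{\rm cyl}}-J_z^s\big(\tfrac{2\pi l}N\big)\Big|\to0,\qquad \max_{0\le l<N}\Big|\tfrac{N K_l}{2\pi\rho_{\rm cyl}}-M_\phi^s\big(\tfrac{2\pi l}N\big)\Big|\to0;$$ in particular $NI_{l}/(2\pi\rho_{\rm cyl})\to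 J_z^s(\phi)$ and $NK_{l}/(2\pi\rho_{\rm cyl})\to M_\phi^s(\phi)$ whenever $l=l_N$ with $2\pi l_N/N\to\phi$, so no divergence or oscillation occurs. The fields of the discrete currents converge to the exact fields: $E^N_j(\rho,\phi)\to E_z^{(j)}(\rho,\phi)$ at every point of $R_j$, $j=1,2$, other than the source point. -/

import Mathlib

open Filter Topology

/-! ### Bessel and Hankel functions of integer order, for a positive real argument -/

/-- The Bessel function `J_n` for `n ≥ 0`, by its power series. -/
noncomputable def besselJNat (n : ℕ) (x : ℝ) : ℝ :=
  ∑' k : ℕ, (-1 : ℝ) ^ k / ((k.factorial : ℝ) * ((n + k).factorial : ℝ)) * (x / 2) ^ (2 * k + n)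

/-- The Bessel function of the second kind (Neumann function) `Y_n` for `n ≥ 0` and `x > 0`, by its
classical expansion; `harmonic k = 1 + 1/2 + ⋯ + 1/k = ψ(k+1) + γ`. -/
noncomputable def besselYNat (n : ℕ) (x : ℝ) : ℝ :=
  (2 / Real.pi) * (Real.log (x / 2) + Real.eulerMascheroniConstant) * besselJNat n x
    - (1 / Real.pi) * ∑ k ∈ Finset.range n,
        ((n - 1 - k).factorial : ℝ) / (k.factorial : ℝ) * (x / 2) ^ ((2 * k : ℤ) - (n : ℤ))
    - (1 / Real.pi) * ∑' k : ℕ,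
        (-1 : ℝ) ^ k * ((harmonic k : ℝ) + (harmonic (n + k) : ℝ))
          / ((k.factorial : ℝ) * ((n + k).factorial : ℝ)) * (x / 2) ^ (2 * k + n)

/-- `J_n` for `n : ℤ`, with `J_{-n} = (-1)^n J_n`. -/
noncomputable def besselJ (n : ℤ) (x : ℝ) : ℝ :=
  if 0 ≤ n then besselJNat n.natAbs x else (-1 : ℝ) ^ n.natAbs * besselJNat n.natAbs x

/-- `Y_n` for `n : ℤ`, with `Y_{-n} = (-1)^n Y_n`. -/
noncomputable def besselY (n : ℤ) (x : ℝ) : ℝ :=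
  if 0 ≤ n then besselYNat n.natAbs x else (-1 : ℝ) ^ n.natAbs * besselYNat n.natAbs x

/-- The Hankel function of the second kind `H_n^{(2)} = J_n - i Y_n`. -/
noncomputable def hankel2 (n : ℤ) (x : ℝ) : ℂ :=
  (besselJ n x : ℂ) - Complex.I * (besselY n x : ℂ)

/-- `J_n'`, the derivative with respect to the argument. -/
noncomputable def besselJ' (n : ℤ) (x : ℝ) : ℝ := deriv (besselJ n) x

/-- `H_n^{(2)}'`, the derivative with respect to the argument. -/
noncomputable def hankel2' (n : ℤ) (x : ℝ) : ℂ := deriv (hankel2 n) x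

/-! ### The circular dielectric cylinder -/

/-- The two regions: `R1` is the exterior of the cylinder, `R2` its interior. -/
inductive Region where
  | R1
  | R2

/-- The sign with which the surface currents `(J, M)` on the boundary radiate in the equivalent
problem of each region: `(J, M)` in the problem for `R1`, `(-J, -M)` in the problem for `R2`. -/
def Region.sgn : Region → ℂ
  | .R1 => 1
  | .R2 => -1

/-- The data of the problem. The filament of amplitude `I` is at polar coordinates `(ρfil, 0)`;
`ρaux .R1 < ρcyl < ρaux .R2` are the radii of the two auxiliary circles, on which the total field
of the equivalent problem of `R1`, respectively `R2`, is required to vanish. -/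
structure Cylinder where
  ω : ℝ
  ε : Region → ℝ
  μ : Region → ℝ
  ρcyl : ℝ
  ρfil : ℝ
  ρaux : Region → ℝ
  I : ℂ
  ω_pos : 0 < ω
  ε_pos : ∀ j, 0 < ε j
  μ_pos : ∀ j, 0 < μ j
  ρaux₁_pos : 0 < ρaux .R1
  ρaux₁_lt : ρaux .R1 < ρcyl
  lt_ρaux₂ : ρcyl < ρaux .R2

namespace Cylinder

variable (S : Cylinder)

/-- Wavenumber of region `j`. -/
noncomputable def k (j : Region) : ℝ := S.ω * Real.sqrt (S.ε j * S.μ j)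

/-- Impedance of region `j`. -/
noncomputable def Z (j : Region) : ℝ := Real.sqrt (S.μ j / S.ε j)

/-- Points with radial coordinate `ρ` lie in (the open) region `j`. -/
def InRegion : Region → ℝ → Prop
  | .R1, ρ => S.ρcyl < ρ
  | .R2, ρ => 0 ≤ ρ ∧ ρ < S.ρcyl

/-- Distance of the points with polar coordinates `(a, φ)`, `(b, φ + θ)`. -/
noncomputable def polarDist (a b θ : ℝ) : ℝ :=
  Real.sqrt (a ^ 2 + b ^ 2 - 2 * a * b * Real.cos θ)

/-- Kernel of the electric currents: `H_0^{(2)}(k_j D)`, with `D` the distance from a source point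
of the circle `ρ = ρcyl` to an observation point of radius `ρ`, with angular separation `θ`. -/
noncomputable def kerE (j : Region) (ρ θ : ℝ) : ℂ :=
  hankel2 0 (S.k j * polarDist S.ρcyl ρ θ)

/-- Kernel of the magnetic currents: `(ρcyl - ρ cos θ) / D * H_1^{(2)}(k_j D)`, which is minus the
derivative of `H_0^{(2)}(k_j D)` with respect to `k_j ρcyl`. -/
noncomputable def kerM (j : Region) (ρ θ : ℝ) : ℂ :=
  (((S.ρcyl - ρ * Real.cos θ) / polarDist S.ρcyl ρ θ : ℝ) : ℂ)
    * hankel2 1 (S.k j * polarDist S.ρcyl ρ θ)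

/-- Field that the filament would generate in an unbounded medium `j`. -/
noncomputable def filField (j : Region) (ρ φ : ℝ) : ℂ :=
  -((S.k j * S.Z j / 4 : ℝ) : ℂ) * S.I * hankel2 0 (S.k j * polarDist ρ S.ρfil φ)

open Classical in
/-- Incident field in the equivalent problem of region `j`, for a filament in region `e`:
`e = R1` is external excitation, `e = R2` is internal excitation. -/
noncomputable def incField (e j : Region) (ρ φ : ℝ) : ℂ :=
  if j = e then S.filField j ρ φ else 0

/-! ### Exact fields and continuous surface current densities -/

/-- The common denominator
`Z₁ H_n(k₁ρcyl) J_n'(k₂ρcyl) - Z₂ J_n(k₂ρcyl) H_n'(k₁ρcyl)` of all the series. -/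
noncomputable def den (n : ℤ) : ℂ :=
  S.Z .R1 * hankel2 n (S.k .R1 * S.ρcyl) * besselJ' n (S.k .R2 * S.ρcyl)
    - S.Z .R2 * besselJ n (S.k .R2 * S.ρcyl) * hankel2' n (S.k .R1 * S.ρcyl)

/-- The `n`-th term of the Fourier series of the exact (non-incident part of the) field in region
`j` for a filament in region `e`; arguments `e`, `j` in this order. -/
noncomputable def exactTerm : Region → Region → ℝ → ℝ → ℤ → ℂ
  | .R1, .R1, ρ, φ, n =>
      ((S.k .R1 * S.Z .R1 : ℝ) : ℂ) * S.I / 4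
        * (hankel2 n (S.k .R1 * ρ) * hankel2 n (S.k .R1 * S.ρfil)
          * ((S.Z .R1 * besselJ' n (S.k .R2 * S.ρcyl) * besselJ n (S.k .R1 * S.ρcyl)
              - S.Z .R2 * besselJ n (S.k .R2 * S.ρcyl) * besselJ' n (S.k .R1 * S.ρcyl)) / S.den n)
          * Complex.exp (Complex.I * n * φ))
  | .R1, .R2, ρ, φ, n =>
      -S.I / (2 * Real.pi * S.ρcyl)
        * (besselJ n (S.k .R2 * ρ) * hankel2 n (S.k .R1 * S.ρfil)
          * (Complex.I * S.Z .R1 * S.Z .R2 / S.den n)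
          * Complex.exp (Complex.I * n * φ))
  | .R2, .R1, ρ, φ, n =>
      -S.I / (2 * Real.pi * S.ρcyl)
        * (hankel2 n (S.k .R1 * ρ) * besselJ n (S.k .R2 * S.ρfil)
          * (Complex.I * S.Z .R1 * S.Z .R2 / S.den n)
          * Complex.exp (Complex.I * n * φ))
  | .R2, .R2, ρ, φ, n =>
      ((S.k .R2 * S.Z .R2 : ℝ) : ℂ) * S.I / 4
        * (besselJ n (S.k .R2 * ρ) * besselJ n (S.k .R2 * S.ρfil)
          * ((S.Z .R1 * hankel2 n (S.k .R1 * S.ρcyl) * hankel2' n (S.k .R2 * S.ρcyl)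
              - S.Z .R2 * hankel2' n (S.k .R1 * S.ρcyl) * hankel2 n (S.k .R2 * S.ρcyl)) / S.den n)
          * Complex.exp (Complex.I * n * φ))

/-- The exact total field `E_z^{(j)}` in region `j`, for a filament in region `e`. -/
noncomputable def exactField (e j : Region) (ρ φ : ℝ) : ℂ :=
  S.incField e j ρ φ + ∑' n : ℤ, S.exactTerm e j ρ φ n

/-- The `n`-th Fourier coefficient of the electric surface current density `J_z^s`. -/
noncomputable def JCoeff : Region → ℤ → ℂ
  | .R1, n => -S.I / (2 * Real.pi * S.ρcyl)
      * (S.Z .R1 * hankel2 n (S.k .R1 * S.ρfil) * besselJ' n (S.k .R2 * S.ρcyl) / S.den n)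
  | .R2, n => -S.I / (2 * Real.pi * S.ρcyl)
      * (S.Z .R2 * besselJ n (S.k .R2 * S.ρfil) * hankel2' n (S.k .R1 * S.ρcyl) / S.den n)

/-- The `n`-th Fourier coefficient of the magnetic surface current density `M_φ^s`. -/
noncomputable def MCoeff : Region → ℤ → ℂ
  | .R1, n => S.I / (2 * Real.pi * S.ρcyl)
      * (Complex.I * S.Z .R1 * S.Z .R2 * hankel2 n (S.k .R1 * S.ρfil)
          * besselJ n (S.k .R2 * S.ρcyl) / S.den n)
  | .R2, n => S.I / (2 * Real.pi * S.ρcyl)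
      * (Complex.I * S.Z .R1 * S.Z .R2 * besselJ n (S.k .R2 * S.ρfil)
          * hankel2 n (S.k .R1 * S.ρcyl) / S.den n)

/-- The continuous electric surface current density `J_z^s`, for a filament in region `e`. -/
noncomputable def Jz (e : Region) (φ : ℝ) : ℂ :=
  ∑' n : ℤ, S.JCoeff e n * Complex.exp (Complex.I * n * φ)

/-- The continuous magnetic surface current density `M_φ^s`, for a filament in region `e`. -/
noncomputable def Mφ (e : Region) (φ : ℝ) : ℂ :=
  ∑' n : ℤ, S.MCoeff e n * Complex.exp (Complex.I * n * φ)

/-- Total field at `(ρ, φ)` of the equivalent problem of region `j`, for a filament in region `e`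
and surface current densities `J`, `M` on the circle `ρ = ρcyl`. -/
noncomputable def contField (e j : Region) (J M : ℝ → ℂ) (ρ φ : ℝ) : ℂ :=
  S.incField e j ρ φ
    + j.sgn * (-((S.k j * S.Z j * S.ρcyl / 4 : ℝ) : ℂ)
          * (∫ φ' in (-Real.pi)..Real.pi, J φ' * S.kerE j ρ (φ' - φ))
        + ((S.k j * S.ρcyl : ℝ) : ℂ) / (4 * Complex.I)
          * (∫ φ' in (-Real.pi)..Real.pi, M φ' * S.kerM j ρ (φ' - φ)))

/-! ### The discrete problem -/

/-- The angle `2πp/N`. -/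
noncomputable def angle (N : ℕ) (p : ℤ) : ℝ := 2 * Real.pi * (p : ℝ) / (N : ℝ)

/-- Total field at `(ρ, φ)` of the equivalent problem of region `j`, for a filament in region `e`
and `N` electric and magnetic filaments of amplitudes `I l`, `K l` at the angles `2πl/N` of the
circle `ρ = ρcyl`. -/
noncomputable def discField (e j : Region) {N : ℕ} (I K : Fin N → ℂ) (ρ φ : ℝ) : ℂ :=
  S.incField e j ρ φ
    + j.sgn * (-((S.k j * S.Z j / 4 : ℝ) : ℂ)
          * (∑ l : Fin N, I l * S.kerE j ρ (angle N (l : ℕ) - φ))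
        + ((S.k j : ℝ) : ℂ) / (4 * Complex.I)
          * (∑ l : Fin N, K l * S.kerM j ρ (angle N (l : ℕ) - φ)))

/-- The blocks `Z₁₁` (`j = R1`) and `Z₂₁` (`j = R2`) of the system matrix. -/
noncomputable def blockE (N : ℕ) (j : Region) : Matrix (Fin N) (Fin N) ℂ :=
  Matrix.of fun p l => S.Z j * S.kerE j (S.ρaux j) (angle N ((p : ℕ) - (l : ℕ) : ℤ))

/-- The blocks `Z₁₂` (`j = R1`) and `Z₂₂` (`j = R2`) of the system matrix. -/
noncomputable def blockM (N : ℕ) (j : Region) : Matrix (Fin N) (Fin N) ℂ :=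
  Matrix.of fun p l => Complex.I * S.kerM j (S.ρaux j) (angle N ((p : ℕ) - (l : ℕ) : ℤ))

/-- The matrix of the `2N × 2N` system. -/
noncomputable def sysMatrix (N : ℕ) : Matrix (Fin N ⊕ Fin N) (Fin N ⊕ Fin N) ℂ :=
  Matrix.fromBlocks (S.blockE N .R1) (S.blockM N .R1) (S.blockE N .R2) (S.blockM N .R2)

open Classical in
/-- The contribution of the source to the right-hand side of the equations on the auxiliary circle
of region `j`: `-I Z₁ H_0^{(2)}(k₁ d_p^{(1)})` on the first circle (and `0` on the second) for
external excitation; `I Z₂ H_0^{(2)}(k₂ d_p^{(2)})` on the second circle (and `0` on the first) for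
internal excitation. -/
noncomputable def rhs (e j : Region) (N : ℕ) (p : Fin N) : ℂ :=
  if j = e then
    -(j.sgn * S.I * S.Z j
      * hankel2 0 (S.k j * polarDist (S.ρaux j) S.ρfil (angle N (p : ℕ))))
  else 0

/-- The amplitudes `I`, `K` solve the `2N × 2N` system of the discretized method. -/
def IsDiscreteSolution (e : Region) {N : ℕ} (I K : Fin N → ℂ) : Prop :=
  (S.sysMatrix N).mulVec (Sum.elim I K) = Sum.elim (S.rhs e .R1 N) (S.rhs e .R2 N)

/-- `m`-th coefficient of the discrete Fourier transform of the samples `f(2πp/N)`. -/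
noncomputable def dft (N : ℕ) (f : ℝ → ℂ) (m : Fin N) : ℂ :=
  (1 / (N : ℂ)) * ∑ p : Fin N, f (angle N (p : ℕ))
    * Complex.exp (-(Complex.I * 2 * Real.pi * ((m : ℕ) : ℂ) * ((p : ℕ) : ℂ) / (N : ℂ)))

noncomputable def B₁ (N : ℕ) (m : Fin N) : ℂ := dft N (S.kerE .R1 (S.ρaux .R1)) m

noncomputable def B₂ (N : ℕ) (m : Fin N) : ℂ := dft N (S.kerM .R1 (S.ρaux .R1)) m

noncomputable def B₃ (N : ℕ) (m : Fin N) : ℂ := dft N (S.kerE .R2 (S.ρaux .R2)) m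

noncomputable def B₄ (N : ℕ) (m : Fin N) : ℂ := dft N (S.kerM .R2 (S.ρaux .R2)) m

/-- Minus the transform of the field of the source at the collocation points of the auxiliary circle
of the region `e` that contains the source. -/
noncomputable def D (e : Region) (N : ℕ) (m : Fin N) : ℂ :=
  -dft N (fun θ => hankel2 0 (S.k e * polarDist (S.ρaux e) S.ρfil θ)) m

/-- The determinant `Z₁ B₁ B₄ - Z₂ B₂ B₃` of the `m`-th transformed system. -/
noncomputable def disc (N : ℕ) (m : Fin N) : ℂ :=
  S.Z .R1 * S.B₁ N m * S.B₄ N m - S.Z .R2 * S.B₂ N m * S.B₃ N m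

/-- The transformed electric amplitudes `I^{(m)}`. -/
noncomputable def dftI : Region → (N : ℕ) → Fin N → ℂ
  | .R1, N, m => S.I / N * (S.Z .R1 * S.D .R1 N m * S.B₄ N m / S.disc N m)
  | .R2, N, m => S.I / N * (S.Z .R2 * S.D .R2 N m * S.B₂ N m / S.disc N m)

/-- The transformed magnetic amplitudes `K^{(m)}`. -/
noncomputable def dftK : Region → (N : ℕ) → Fin N → ℂ
  | .R1, N, m => S.I / N * (Complex.I * S.Z .R1 * S.Z .R2 * S.D .R1 N m * S.B₃ N m / S.disc N m)
  | .R2, N, m => S.I / N * (Complex.I * S.Z .R1 * S.Z .R2 * S.D .R2 N m * S.B₁ N m / S.disc N m)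

/-- Inverse discrete Fourier transform `l ↦ ∑_m c_m e^{i2πlm/N}`. -/
noncomputable def invDFT {N : ℕ} (c : Fin N → ℂ) (l : Fin N) : ℂ :=
  ∑ m : Fin N, c m
    * Complex.exp (Complex.I * 2 * Real.pi * ((l : ℕ) : ℂ) * ((m : ℕ) : ℂ) / (N : ℂ))

end Cylinder

/-!
The two kernels, as functions of the angle, have explicit Fourier series: Graf's addition theorem
(`cylWave_eq_grafSum`) separates the variables, and its coefficients `coefE`, `coefM` are products
of a Bessel and a Hankel function or of their derivatives. Graf's theorem is proved for all orders
at once: both sides are real-analytic in the smaller radius, obey the ladder relation `d_m' = A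
d_{m-1} + B d_{m+1}`, and agree at radius zero, so all derivatives of their difference vanish
there (`eqOn_zero_of_ladder`).

For continuous densities everything is then a computation with single orders. The convolution with
a kernel multiplies Fourier coefficients (`Cylinder.hasSum_contField`); on the auxiliary circles
the radiated field cancels the incident field order by order (`Cylinder.radCoeff_aux`), and
elsewhere the Wronskian turns it into the exact field (`Cylinder.radCoeff_eq_exactTerm`). The
Wronskian also shows that the denominators `Δ_n` do not vanish (`Cylinder.den_ne_zero`).

The discrete system has circulant blocks, so the discrete Fourier transform splits it into `2 × 2`
systems with determinants `Δ^{(m)}`. By aliasing, the transforms of the sampled kernels are the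
sums of `coefE` or `coefM` over residue classes modulo `N` (`dft_eq_aliasSum`). The central point
is a lower bound for these determinants that is uniform in `N`
(`Cylinder.exists_le_norm_discSum`). At a fixed order, `Δ^{(n)}` tends to `-J_n(k₁ρ⁽¹⁾)
H_n(k₂ρ⁽²⁾) Δ_n`, with `ρ⁽¹⁾`, `ρ⁽²⁾` the radii of the auxiliary circles, which is nonzero by the
non-resonance condition. At high orders with `2|n| ≤ N`, the coefficients are asymptotic to purely
imaginary constants times positive weights `q^{|n|} / |n|^s`; all members of the residue class of
`n` are of at least as high an order, so aliasing keeps these asymptotics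
(`tendsto_aliasSum_div`), and the signs of the constants prevent any cancellation between the two
products in `Δ^{(n)}`.

Together with geometric bounds for the source coefficients this dominates the transformed
currents, uniformly in `N`, by a summable sequence. Dominated convergence gives the uniform
convergence of the currents (`Cylinder.current_limits`), and the fields follow, because the sums
over the discrete currents are perturbed Riemann sums of the radiation integrals
(`Cylinder.tendsto_sum_mul_kernel`).
-/

/-! ### Power series with factorially decaying coefficients -/

/-- The coefficients `a k` are `O(1 / k!)`. -/
def FactorialDecay (a : ℕ → ℝ) : Prop := ∃ C : ℝ, ∀ k, |a k| ≤ C / (k.factorial : ℝ)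

/-- The sum of the power series with coefficients `a`. -/
noncomputable def powerSum (a : ℕ → ℝ) (y : ℝ) : ℝ := ∑' k : ℕ, a k * y ^ k

namespace FactorialDecay

theorem nonneg_const {a : ℕ → ℝ} (ha : FactorialDecay a) :
    ∃ C : ℝ, 0 ≤ C ∧ ∀ k, |a k| ≤ C / (k.factorial : ℝ) := by
  obtain ⟨C, hC⟩ := ha
  refine ⟨C, ?_, hC⟩
  have := (abs_nonneg _).trans (hC 0)
  simpa using this

theorem summable_norm {a : ℕ → ℝ} (ha : FactorialDecay a) (y : ℝ) :
    Summable fun k => ‖a k * y ^ k‖ := by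
  obtain ⟨C, hC0, hC⟩ := ha.nonneg_const
  refine Summable.of_nonneg_of_le (fun k => norm_nonneg _) (fun k => ?_)
    ((Real.summable_pow_div_factorial |y|).mul_left C)
  rw [norm_mul, norm_pow, Real.norm_eq_abs, Real.norm_eq_abs]
  calc |a k| * |y| ^ k ≤ C / (k.factorial : ℝ) * |y| ^ k := by gcongr; exact hC k
    _ = C * (|y| ^ k / (k.factorial : ℝ)) := by ring

theorem summable {a : ℕ → ℝ} (ha : FactorialDecay a) (y : ℝ) :
    Summable fun k => a k * y ^ k := (ha.summable_norm y).of_norm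

theorem shift {a : ℕ → ℝ} (ha : FactorialDecay a) :
    FactorialDecay fun k => (k + 1 : ℝ) * a (k + 1) := by
  obtain ⟨C, hC0, hC⟩ := ha.nonneg_const
  refine ⟨C, fun k => ?_⟩
  have h1 : (0 : ℝ) < k + 1 := by positivity
  rw [abs_mul, abs_of_pos h1]
  calc (k + 1 : ℝ) * |a (k + 1)| ≤ (k + 1 : ℝ) * (C / ((k + 1).factorial : ℝ)) := by
        gcongr; exact hC _
    _ = C / (k.factorial : ℝ) := by
        rw [Nat.factorial_succ]; push_cast; field_simp

theorem hasDerivAt {a : ℕ → ℝ} (ha : FactorialDecay a) (y : ℝ) :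
    HasDerivAt (powerSum a) (powerSum (fun k => (k + 1 : ℝ) * a (k + 1)) y) y := by
  set R : ℝ := |y| + 1 with hR
  have hR0 : 0 ≤ R := by positivity
  have hsum : Summable fun k : ℕ => ‖(k : ℝ) * a k * R ^ (k - 1)‖ := by
    rw [← summable_nat_add_iff 1]
    simpa using ha.shift.summable_norm R
  have key := hasDerivAt_tsum_of_isPreconnected (𝕜 := ℝ) (g := fun k y => a k * y ^ k)
    (g' := fun k y => a k * (k * y ^ (k - 1))) (t := Metric.ball 0 R) (y₀ := 0) (y := y) hsum
    Metric.isOpen_ball (convex_ball 0 R).isPreconnected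
    (fun k z _ => (hasDerivAt_pow k z).const_mul (a k)) (fun k z hz => ?_)
    (Metric.mem_ball_self (by positivity)) (ha.summable 0) (by simp [hR])
  · refine key.congr_deriv ?_
    rw [Summable.tsum_eq_zero_add]
    · simp only [powerSum, Nat.cast_zero, zero_mul, mul_zero, zero_add, Nat.cast_add, Nat.cast_one,
        Nat.add_sub_cancel]
      exact tsum_congr fun k => by ring
    · rw [← summable_nat_add_iff 1]
      refine (ha.shift.summable y).congr fun k => ?_
      simp; ring
  · have hz' : |z| ≤ R := by simpa using (mem_ball_zero_iff.1 hz).le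
    simp only [norm_mul, norm_pow, Real.norm_eq_abs, abs_of_nonneg hR0]
    rw [mul_comm (|(k : ℝ)|) |a k|, mul_assoc]
    gcongr

theorem analyticAt {a : ℕ → ℝ} (ha : FactorialDecay a) (y : ℝ) : AnalyticAt ℝ (powerSum a) y := by
  set p := FormalMultilinearSeries.ofScalars ℝ a with hp
  have hr : p.radius = ⊤ := by
    refine ENNReal.eq_top_of_forall_nnreal_le fun r => p.le_radius_of_summable ?_
    refine (ha.summable_norm r).congr fun k => ?_
    rw [hp, FormalMultilinearSeries.ofScalars_norm, norm_mul, norm_pow]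
    simp
  have h1 := p.hasFPowerSeriesOnBall (by simp [hr])
  have h2 : p.sum = powerSum a := by
    funext z
    have : p.sum = FormalMultilinearSeries.ofScalarsSum a := rfl
    rw [this, FormalMultilinearSeries.ofScalarsSum_eq_tsum]
    simp [powerSum]
  rw [← h2]
  exact h1.analyticAt_of_mem (by simp [hr])

end FactorialDecay

theorem powerSum_zero (a : ℕ → ℝ) : powerSum a 0 = a 0 := by
  rw [powerSum, tsum_eq_single 0]
  · simp
  · intro k hk; simp [hk]

theorem powerSum_add {a b : ℕ → ℝ} (ha : FactorialDecay a) (hb : FactorialDecay b) (y : ℝ) :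
    powerSum (fun k => a k + b k) y = powerSum a y + powerSum b y := by
  rw [powerSum, powerSum, powerSum, ← (ha.summable y).tsum_add (hb.summable y)]
  exact tsum_congr fun k => by ring

theorem powerSum_const_mul (a : ℕ → ℝ) (c y : ℝ) :
    powerSum (fun k => c * a k) y = c * powerSum a y := by
  rw [powerSum, powerSum, ← tsum_mul_left]
  exact tsum_congr fun k => by ring

theorem mul_powerSum_succ {a : ℕ → ℝ} (ha : FactorialDecay a) (y : ℝ) :
    y * powerSum (fun k => a (k + 1)) y = powerSum a y - a 0 := by
  rw [powerSum, powerSum, (ha.summable y).tsum_eq_zero_add, ← tsum_mul_left]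
  simp only [pow_zero, mul_one, add_sub_cancel_left]
  exact tsum_congr fun k => by ring

/-- The operator `y d/dy` multiplies the `k`-th coefficient by `k`. Without any decay both sides are
the junk value `0` when the series diverge. -/
theorem mul_powerSum_deriv {a : ℕ → ℝ} (y : ℝ) :
    y * powerSum (fun k => (k + 1 : ℝ) * a (k + 1)) y = powerSum (fun k => (k : ℝ) * a k) y := by
  by_cases h : Summable fun k : ℕ => (k : ℝ) * a k * y ^ k
  · rw [powerSum, powerSum, h.tsum_eq_zero_add, ← tsum_mul_left]
    simp only [Nat.cast_zero, zero_mul, zero_add]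
    refine tsum_congr fun k => ?_
    push_cast; ring
  · rw [powerSum, powerSum, tsum_eq_zero_of_not_summable h, ← tsum_mul_left]
    apply tsum_eq_zero_of_not_summable
    rw [← summable_nat_add_iff 1] at h
    refine fun h' => h (h'.congr fun k => ?_)
    push_cast; ring

/-! ### Recurrences of the Bessel functions of integer order -/

/-- Coefficients of `J_n(2h) = h^n ∑ a_k h^{2k}`. -/
noncomputable def coeffJ (n k : ℕ) : ℝ :=
  (-1 : ℝ) ^ k / ((k.factorial : ℝ) * ((n + k).factorial : ℝ))

/-- Coefficients of the harmonic series in the expansion of `Y_n`. -/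
noncomputable def coeffS (n k : ℕ) : ℝ :=
  (-1 : ℝ) ^ k * ((harmonic k : ℝ) + (harmonic (n + k) : ℝ))
    / ((k.factorial : ℝ) * ((n + k).factorial : ℝ))

/-- The polynomial in the principal part `h^{-n} P_n(h^2)` of `-π Y_n(2h)`. -/
noncomputable def polyY (n : ℕ) (y : ℝ) : ℝ :=
  ∑ k ∈ Finset.range n, ((n - 1 - k).factorial : ℝ) / (k.factorial : ℝ) * y ^ k

theorem abs_coeffJ (n k : ℕ) :
    |coeffJ n k| = 1 / ((k.factorial : ℝ) * ((n + k).factorial : ℝ)) := by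
  rw [coeffJ, abs_div, abs_pow, abs_neg, abs_one, one_pow, abs_of_pos (by positivity)]

theorem abs_coeffJ_le (n k : ℕ) : |coeffJ n k| ≤ 1 / (n.factorial : ℝ) / (k.factorial : ℝ) := by
  rw [abs_coeffJ, div_div, mul_comm]
  gcongr
  omega

theorem factorialDecay_coeffJ (n : ℕ) : FactorialDecay (coeffJ n) := ⟨_, abs_coeffJ_le n⟩

theorem harmonic_le_self (n : ℕ) : (harmonic n : ℝ) ≤ n := by
  induction n with
  | zero => simp
  | succ n ih =>
    rw [harmonic_succ]; push_cast
    have : ((n : ℝ) + 1)⁻¹ ≤ 1 := inv_le_one_of_one_le₀ (by linarith [Nat.cast_nonneg (α := ℝ) n])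
    linarith

theorem harmonic_nonneg' (n : ℕ) : 0 ≤ (harmonic n : ℝ) := by
  induction n with
  | zero => simp
  | succ n ih => rw [harmonic_succ]; push_cast; positivity

theorem abs_coeffS_le (n k : ℕ) :
    |coeffS n k| ≤ 2 / ((n - 1).factorial : ℝ) / (k.factorial : ℝ) := by
  have h1 := harmonic_nonneg' k
  have h2 := harmonic_nonneg' (n + k)
  rw [coeffS, abs_div, abs_mul, abs_pow, abs_neg, abs_one, one_pow, one_mul,
    abs_of_nonneg (by positivity), abs_of_pos (by positivity), div_div]
  rcases Nat.eq_zero_or_pos (n + k) with h | h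
  · obtain ⟨rfl, rfl⟩ : n = 0 ∧ k = 0 := by omega
    simp
  · have h3 : (harmonic k : ℝ) + (harmonic (n + k) : ℝ) ≤ 2 * ((n + k : ℕ) : ℝ) := by
      have := harmonic_le_self k
      have := harmonic_le_self (n + k)
      push_cast at *
      linarith [Nat.cast_nonneg (α := ℝ) n]
    calc ((harmonic k : ℝ) + (harmonic (n + k) : ℝ)) / ((k.factorial : ℝ) * ((n + k).factorial : ℝ))
        ≤ 2 * ((n + k : ℕ) : ℝ) / ((k.factorial : ℝ) * ((n + k).factorial : ℝ)) := by gcongr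
      _ = 2 / (((n + k - 1).factorial : ℝ) * (k.factorial : ℝ)) := by
          rw [← Nat.mul_factorial_pred h.ne']
          have : ((n + k : ℕ) : ℝ) ≠ 0 := by positivity
          push_cast at *
          field_simp
      _ ≤ 2 / (((n - 1).factorial : ℝ) * (k.factorial : ℝ)) := by
          gcongr
          omega

theorem factorialDecay_coeffS (n : ℕ) : FactorialDecay (coeffS n) := ⟨_, abs_coeffS_le n⟩

theorem besselJNat_eq (n : ℕ) (x : ℝ) :
    besselJNat n x = (x / 2) ^ n * powerSum (coeffJ n) ((x / 2) ^ 2) := by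
  rw [besselJNat, powerSum, ← tsum_mul_left]
  refine tsum_congr fun k => ?_
  rw [coeffJ, pow_add, pow_mul]; ring

theorem besselYNat_eq (n : ℕ) {x : ℝ} (hx : 0 < x) :
    besselYNat n x = (1 / Real.pi) * (2 * (Real.log (x / 2) + Real.eulerMascheroniConstant)
        * ((x / 2) ^ n * powerSum (coeffJ n) ((x / 2) ^ 2))
      - ((x / 2) ^ n)⁻¹ * polyY n ((x / 2) ^ 2)
      - (x / 2) ^ n * powerSum (coeffS n) ((x / 2) ^ 2)) := by
  rw [besselYNat, besselJNat_eq]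
  have h1 : ∑ k ∈ Finset.range n,
        ((n - 1 - k).factorial : ℝ) / (k.factorial : ℝ) * (x / 2) ^ ((2 * k : ℤ) - (n : ℤ))
      = ((x / 2) ^ n)⁻¹ * polyY n ((x / 2) ^ 2) := by
    rw [polyY, Finset.mul_sum]
    refine Finset.sum_congr rfl fun k _ => ?_
    rw [zpow_sub₀ (by positivity), zpow_natCast, show (2 * k : ℤ) = ((2 * k : ℕ) : ℤ) by simp,
      zpow_natCast, pow_mul]
    ring
  have h2 : ∑' k : ℕ, (-1 : ℝ) ^ k * ((harmonic k : ℝ) + (harmonic (n + k) : ℝ))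
          / ((k.factorial : ℝ) * ((n + k).factorial : ℝ)) * (x / 2) ^ (2 * k + n)
      = (x / 2) ^ n * powerSum (coeffS n) ((x / 2) ^ 2) := by
    rw [powerSum, ← tsum_mul_left]
    refine tsum_congr fun k => ?_
    rw [coeffS, pow_add, pow_mul]; ring
  rw [h1, h2]; ring

theorem coeffJ_succ (n k : ℕ) : ((k : ℝ) + 1) * coeffJ n (k + 1) = -1 * coeffJ (n + 1) k := by
  have e : n + (k + 1) = n + 1 + k := by ring
  rw [coeffJ, coeffJ, e, Nat.factorial_succ k, pow_succ]
  push_cast; field_simp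

theorem powerSum_coeffJ_rec (n : ℕ) (y : ℝ) :
    ((n : ℝ) + 1) * powerSum (coeffJ (n + 1)) y - y * powerSum (coeffJ (n + 2)) y
      = powerSum (coeffJ n) y := by
  have h1 := mul_powerSum_deriv (a := coeffJ (n + 1)) y
  simp_rw [coeffJ_succ (n + 1), powerSum_const_mul] at h1
  have h2 : powerSum (fun k : ℕ => (k : ℝ) * coeffJ (n + 1) k) y
      = powerSum (fun k => coeffJ n k + (-((n : ℝ) + 1)) * coeffJ (n + 1) k) y := by
    congr 1; funext k
    have e : n + 1 + k = n + k + 1 := by ring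
    rw [coeffJ, coeffJ, e, Nat.factorial_succ (n + k)]
    push_cast; field_simp; ring
  rw [h2, powerSum_add (factorialDecay_coeffJ n), powerSum_const_mul] at h1
  · linarith
  · obtain ⟨C, hC⟩ := factorialDecay_coeffJ (n + 1)
    refine ⟨((n : ℝ) + 1) * C, fun k => ?_⟩
    rw [abs_mul, abs_neg, abs_of_pos (by positivity), mul_div_assoc]
    gcongr
    exact hC k

theorem hasDerivAt_powerSum_coeffJ (n : ℕ) (y : ℝ) :
    HasDerivAt (powerSum (coeffJ n)) (-powerSum (coeffJ (n + 1)) y) y := by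
  refine ((factorialDecay_coeffJ n).hasDerivAt y).congr_deriv ?_
  simp_rw [coeffJ_succ n, powerSum_const_mul]
  ring

/-- Relation behind `Y_n' = (n/x) Y_n - Y_{n+1}`: in `(k+1) b_{n,k+1} + b_{n+1,k}` the harmonic
numbers telescope, leaving a Bessel coefficient. -/
theorem powerSum_coeffS_rec₁ (n : ℕ) (y : ℝ) :
    y * (powerSum (fun k => (k + 1 : ℝ) * coeffS n (k + 1)) y + powerSum (coeffS (n + 1)) y)
      = powerSum (coeffJ n) y - 1 / (n.factorial : ℝ) := by
  rw [← powerSum_add (factorialDecay_coeffS n).shift (factorialDecay_coeffS (n + 1))]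
  have h : (fun k : ℕ => ((k : ℝ) + 1) * coeffS n (k + 1) + coeffS (n + 1) k)
      = fun k => coeffJ n (k + 1) := by
    funext k
    have e : n + (k + 1) = n + k + 1 := by ring
    have e' : n + 1 + k = n + k + 1 := by ring
    rw [coeffS, coeffS, coeffJ, e, e', Nat.factorial_succ k, harmonic_succ k, pow_succ]
    push_cast; field_simp; ring
  rw [h, mul_powerSum_succ (factorialDecay_coeffJ n)]
  simp [coeffJ]

/-- Relation behind `Y_{n+1}' = Y_n - ((n+1)/x) Y_{n+1}`. -/
theorem powerSum_coeffS_rec₂ (n : ℕ) (y : ℝ) :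
    ((n : ℝ) + 1) * powerSum (coeffS (n + 1)) y
        + y * powerSum (fun k => (k + 1 : ℝ) * coeffS (n + 1) (k + 1)) y
      = powerSum (coeffS n) y + powerSum (coeffJ (n + 1)) y := by
  have hd : FactorialDecay fun k => (-((n : ℝ) + 1)) * coeffS (n + 1) k := by
    obtain ⟨C, hC⟩ := factorialDecay_coeffS (n + 1)
    refine ⟨((n : ℝ) + 1) * C, fun k => ?_⟩
    rw [abs_mul, abs_neg, abs_of_pos (by positivity), mul_div_assoc]
    gcongr
    exact hC k
  have hd' : FactorialDecay fun k => coeffJ (n + 1) k + (-((n : ℝ) + 1)) * coeffS (n + 1) k := by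
    obtain ⟨C, hC⟩ := hd
    obtain ⟨C', hC'⟩ := factorialDecay_coeffJ (n + 1)
    exact ⟨C' + C, fun k => (abs_add_le _ _).trans
      (by rw [add_div]; exact add_le_add (hC' k) (hC k))⟩
  rw [mul_powerSum_deriv]
  have h2 : (fun k : ℕ => (k : ℝ) * coeffS (n + 1) k)
      = fun k => coeffS n k + (coeffJ (n + 1) k + (-((n : ℝ) + 1)) * coeffS (n + 1) k) := by
    funext k
    have e : n + 1 + k = n + k + 1 := by ring
    rw [coeffS, coeffS, coeffJ, e, Nat.factorial_succ (n + k), harmonic_succ (n + k)]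
    push_cast
    have : (n : ℝ) + k + 1 ≠ 0 := by positivity
    field_simp; ring
  rw [h2, powerSum_add (factorialDecay_coeffS n) hd', powerSum_add (factorialDecay_coeffJ _) hd,
    powerSum_const_mul]
  ring

/-- The polynomials `P_n` form an Appell-type sequence, `P_{n+1}' = P_n`. -/
theorem hasDerivAt_polyY (n : ℕ) (y : ℝ) : HasDerivAt (polyY (n + 1)) (polyY n y) y := by
  have h := HasDerivAt.fun_sum (u := Finset.range (n + 1)) (x := y)
    (A := fun k y => ((n + 1 - 1 - k).factorial : ℝ) / (k.factorial : ℝ) * y ^ k)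
    (A' := fun k => ((n + 1 - 1 - k).factorial : ℝ) / (k.factorial : ℝ) * (k * y ^ (k - 1)))
    (fun k _ => (hasDerivAt_pow k y).const_mul _)
  refine h.congr_deriv ?_
  rw [Finset.sum_range_succ', polyY]
  simp only [Nat.cast_zero, zero_mul, mul_zero, add_zero]
  refine Finset.sum_congr rfl fun k _ => ?_
  rw [show n + 1 - 1 - (k + 1) = n - 1 - k by omega, Nat.factorial_succ, Nat.add_sub_cancel]
  push_cast; field_simp

theorem polyY_succ (n : ℕ) (y : ℝ) :
    polyY (n + 1) y = n * polyY n y - y * polyY (n - 1) y + y ^ n / (n.factorial : ℝ) := by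
  rcases n with _ | n
  · simp [polyY]
  · rw [polyY, Finset.sum_range_succ, Nat.add_sub_cancel, Nat.add_sub_cancel, Nat.sub_self]
    have h1 : y * polyY n y = ∑ k ∈ Finset.range (n + 1),
        ((n + 1 - 1 - k).factorial : ℝ) / (k.factorial : ℝ) * (k * y ^ k) := by
      rw [Finset.sum_range_succ', polyY, Finset.mul_sum]
      simp only [Nat.cast_zero, zero_mul, mul_zero, add_zero]
      refine Finset.sum_congr rfl fun k _ => ?_
      rw [show n + 1 - 1 - (k + 1) = n - 1 - k by omega, Nat.factorial_succ]
      push_cast; field_simp; ring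
    rw [h1, polyY, Finset.mul_sum, ← Finset.sum_sub_distrib]
    congr 1
    · refine Finset.sum_congr rfl fun k hk => ?_
      have hk' : k ≤ n := by simpa [Nat.lt_succ_iff] using hk
      rw [show n + 1 - k = (n - k) + 1 by omega, Nat.factorial_succ, Nat.add_sub_cancel]
      push_cast [Nat.cast_sub hk']; ring
    · simp; ring

theorem hasDerivAt_half_sq (x : ℝ) : HasDerivAt (fun x : ℝ => (x / 2) ^ 2) (x / 2) x := by
  have := ((hasDerivAt_id x).div_const 2).pow 2
  refine this.congr_deriv ?_
  simp; ring

theorem hasDerivAt_half_pow (n : ℕ) (x : ℝ) :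
    HasDerivAt (fun x : ℝ => (x / 2) ^ n) (n / 2 * (x / 2) ^ (n - 1)) x := by
  have := ((hasDerivAt_id x).div_const 2).pow n
  refine this.congr_deriv ?_
  simp; ring

theorem hasDerivAt_besselJNat_zero (x : ℝ) :
    HasDerivAt (besselJNat 0) (-besselJNat 1 x) x := by
  have h := (hasDerivAt_powerSum_coeffJ 0 ((x / 2) ^ 2)).comp x (hasDerivAt_half_sq x)
  have e : besselJNat 0 = powerSum (coeffJ 0) ∘ fun x : ℝ => (x / 2) ^ 2 := by
    funext z; simp [besselJNat_eq]
  rw [e]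
  refine h.congr_deriv ?_
  rw [besselJNat_eq]; ring

theorem besselJNat_rec (n : ℕ) (x : ℝ) :
    ((n : ℝ) + 1) * besselJNat (n + 1) x = x / 2 * (besselJNat n x + besselJNat (n + 2) x) := by
  simp only [besselJNat_eq]
  have h := powerSum_coeffJ_rec n ((x / 2) ^ 2)
  rw [← h]; ring

theorem hasDerivAt_besselJNat_succ (n : ℕ) (x : ℝ) :
    HasDerivAt (besselJNat (n + 1)) ((besselJNat n x - besselJNat (n + 2) x) / 2) x := by
  have h := (hasDerivAt_half_pow (n + 1) x).mul
    ((hasDerivAt_powerSum_coeffJ (n + 1) ((x / 2) ^ 2)).comp x (hasDerivAt_half_sq x))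
  have e : besselJNat (n + 1)
      = (fun x : ℝ => (x / 2) ^ (n + 1))
        * (powerSum (coeffJ (n + 1)) ∘ fun x : ℝ => (x / 2) ^ 2) := by
    funext z; simp [besselJNat_eq]
  rw [e]
  refine h.congr_deriv ?_
  simp only [besselJNat_eq, Function.comp, Nat.add_sub_cancel]
  rw [← powerSum_coeffJ_rec n ((x / 2) ^ 2)]
  push_cast
  ring

theorem hasDerivAt_half_pow_inv (n : ℕ) {x : ℝ} (hx : 0 < x) :
    HasDerivAt (fun x : ℝ => ((x / 2) ^ n)⁻¹) (-(n / 2 * ((x / 2) ^ (n + 1))⁻¹)) x := by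
  have h := (hasDerivAt_half_pow n x).inv (by positivity)
  refine h.congr_deriv ?_
  rcases n with _ | n
  · simp
  · rw [Nat.add_sub_cancel]
    field_simp
    ring

/-- The derivative of `Y_n`, from the logarithmic term, the principal part and the harmonic series
in its expansion. -/
theorem hasDerivAt_besselYNat_aux (n : ℕ) {x : ℝ} (hx : 0 < x) {j' p' : ℝ}
    (hj : HasDerivAt (besselJNat n) j' x) (hp : HasDerivAt (polyY n) p' ((x / 2) ^ 2)) :
    HasDerivAt (besselYNat n) (1 / Real.pi *
      (2 / x * besselJNat n x + 2 * (Real.log (x / 2) + Real.eulerMascheroniConstant) * j'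
        + n / 2 * ((x / 2) ^ (n + 1))⁻¹ * polyY n ((x / 2) ^ 2) - ((x / 2) ^ n)⁻¹ * (p' * (x / 2))
        - (n / 2 * (x / 2) ^ (n - 1) * powerSum (coeffS n) ((x / 2) ^ 2)
          + (x / 2) ^ (n + 1)
            * powerSum (fun k => (k + 1 : ℝ) * coeffS n (k + 1)) ((x / 2) ^ 2)))) x := by
  have hl : HasDerivAt (fun x : ℝ => 2 * (Real.log (x / 2) + Real.eulerMascheroniConstant))
      (2 / x) x := by
    have h := ((((hasDerivAt_id x).div_const 2).log (by simp; positivity)).add_const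
      Real.eulerMascheroniConstant).const_mul 2
    refine h.congr_deriv ?_
    simp only [id]; field_simp
  have h2 := (hasDerivAt_half_pow_inv n hx).mul (hp.comp x (hasDerivAt_half_sq x))
  have h3 := (hasDerivAt_half_pow n x).mul
    (((factorialDecay_coeffS n).hasDerivAt ((x / 2) ^ 2)).comp x (hasDerivAt_half_sq x))
  have h := (((hl.mul hj).sub h2).sub h3).const_mul (1 / Real.pi)
  refine (h.congr_of_eventuallyEq ?_).congr_deriv ?_
  · filter_upwards [lt_mem_nhds hx] with z hz
    rw [besselYNat_eq n hz]
    simp [besselJNat_eq]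
  · simp only [Function.comp]
    ring

theorem hasDerivAt_besselYNat_zero {x : ℝ} (hx : 0 < x) :
    HasDerivAt (besselYNat 0) (-besselYNat 1 x) x := by
  have h0 : polyY 0 = fun _ => 0 := by funext y; simp [polyY]
  have hp : HasDerivAt (polyY 0) 0 ((x / 2) ^ 2) := by
    rw [h0]; exact hasDerivAt_const _ _
  refine (hasDerivAt_besselYNat_aux 0 hx (hasDerivAt_besselJNat_zero x) hp).congr_deriv ?_
  rw [besselYNat_eq 1 hx]
  have h1 := powerSum_coeffS_rec₁ 0 ((x / 2) ^ 2)
  simp only [h0, besselJNat_eq, show polyY 1 = fun _ => 1 by funext y; simp [polyY]]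
  have hx' : x ≠ 0 := hx.ne'
  have h2 : powerSum (fun k : ℕ => ((k : ℝ) + 1) * coeffS 0 (k + 1)) ((x / 2) ^ 2)
      = (powerSum (coeffJ 0) ((x / 2) ^ 2) - 1) / (x / 2) ^ 2
        - powerSum (coeffS (0 + 1)) ((x / 2) ^ 2) := by
    rw [eq_sub_iff_add_eq, eq_div_iff (by positivity), mul_comm, h1]; simp
  rw [h2]
  norm_num
  generalize powerSum (coeffJ 0) ((x / 2) ^ 2) = a
  generalize powerSum (coeffJ 1) ((x / 2) ^ 2) = a
  generalize powerSum (coeffS 1) ((x / 2) ^ 2) = a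
  field_simp
  ring

/-- The two derivative formulas `Y_{n+1}' = Y_n - (n+1)/x Y_{n+1}` and
`Y_{n+1}' = (n+1)/x Y_{n+1} - Y_{n+2}`. -/
theorem hasDerivAt_besselYNat_succ_aux (n : ℕ) {x : ℝ} (hx : 0 < x) :
    HasDerivAt (besselYNat (n + 1))
        (besselYNat n x - (n + 1) / x * besselYNat (n + 1) x) x ∧
      HasDerivAt (besselYNat (n + 1))
        ((n + 1) / x * besselYNat (n + 1) x - besselYNat (n + 2) x) x := by
  have hx' : x ≠ 0 := hx.ne'
  have h := hasDerivAt_besselYNat_aux (n + 1) hx (hasDerivAt_besselJNat_succ n x)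
    (hasDerivAt_polyY n _)
  have j1 := powerSum_coeffJ_rec n ((x / 2) ^ 2)
  have s1 := powerSum_coeffS_rec₁ (n + 1) ((x / 2) ^ 2)
  have s2 := powerSum_coeffS_rec₂ n ((x / 2) ^ 2)
  have p1 := polyY_succ (n + 1) ((x / 2) ^ 2)
  simp only [besselJNat_eq] at h
  rw [besselYNat_eq n hx, besselYNat_eq (n + 1) hx, besselYNat_eq (n + 2) hx]
  simp only [Nat.add_sub_cancel, Nat.factorial_succ] at *
  have hf : (n.factorial : ℝ) ≠ 0 := by positivity
  push_cast at *
  generalize powerSum (fun k : ℕ => ((k : ℝ) + 1) * coeffS (n + 1) (k + 1)) ((x / 2) ^ 2) = T at *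
  generalize powerSum (coeffJ n) ((x / 2) ^ 2) = a0 at *
  generalize powerSum (coeffJ (n + 1)) ((x / 2) ^ 2) = a1 at *
  generalize powerSum (coeffJ (n + 2)) ((x / 2) ^ 2) = a2 at *
  generalize powerSum (coeffS n) ((x / 2) ^ 2) = b0 at *
  generalize powerSum (coeffS (n + 1)) ((x / 2) ^ 2) = b1 at *
  generalize hb2 : powerSum (coeffS (n + 1 + 1)) ((x / 2) ^ 2) = b2 at *
  generalize polyY n ((x / 2) ^ 2) = q0 at *
  generalize polyY (n + 1) ((x / 2) ^ 2) = q1 at *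
  generalize polyY (n + 1 + 1) ((x / 2) ^ 2) = q2 at *
  generalize Real.log (x / 2) + Real.eulerMascheroniConstant = L at *
  obtain ⟨t, rfl⟩ : ∃ t, x = 2 * t := ⟨x / 2, by ring⟩
  have ht : t ≠ 0 := by intro h; simp [h] at hx'
  simp only [mul_div_cancel_left₀ t (two_ne_zero' ℝ)] at *
  have ev : a1 = t ^ 2 * T + t ^ 2 * b2 + 1 / ((n + 1) * (n.factorial : ℝ)) := by linarith
  constructor
  · refine h.congr_deriv ?_
    have e1 : t ^ 2 * T = b0 + a1 - (n + 1) * b1 := by linarith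
    have e2 : t ^ (n + 1 + 1) * T = t ^ n * (b0 + a1 - (n + 1) * b1) := by rw [← e1]; ring
    rw [e2, ← j1]
    field_simp
    ring
  · refine h.congr_deriv ?_
    have e2 : t ^ (n + 1 + 1) * T
        = t ^ n * (a1 - 1 / ((n + 1) * (n.factorial : ℝ)) - t ^ 2 * b2) := by
      rw [ev]; ring
    rw [e2, ← j1, p1]
    have hn : (n : ℝ) + 1 ≠ 0 := by positivity
    have et : (t ^ 2) ^ (n + 1) = (t ^ (n + 1)) ^ 2 := by ring
    rw [et]
    have htn : t ^ n ≠ 0 := pow_ne_zero _ ht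
    simp only [pow_succ]
    generalize t ^ n = u at *
    field_simp
    ring

theorem besselYNat_rec (n : ℕ) {x : ℝ} (hx : 0 < x) :
    ((n : ℝ) + 1) * besselYNat (n + 1) x = x / 2 * (besselYNat n x + besselYNat (n + 2) x) := by
  have h := hasDerivAt_besselYNat_succ_aux n hx
  have := h.1.unique h.2
  field_simp at this ⊢
  linarith

theorem hasDerivAt_besselYNat_succ (n : ℕ) {x : ℝ} (hx : 0 < x) :
    HasDerivAt (besselYNat (n + 1)) ((besselYNat n x - besselYNat (n + 2) x) / 2) x := by
  have h := hasDerivAt_besselYNat_succ_aux n hx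
  refine h.1.congr_deriv ?_
  have := h.1.unique h.2
  linarith

/-- The extension `c_{-n} = (-1)^n c_n` to negative orders. -/
noncomputable def extendOrder (c : ℕ → ℝ → ℝ) (n : ℤ) (x : ℝ) : ℝ :=
  if 0 ≤ n then c n.natAbs x else (-1 : ℝ) ^ n.natAbs * c n.natAbs x

theorem extendOrder_natCast (c : ℕ → ℝ → ℝ) (n : ℕ) : extendOrder c n = c n := by
  funext x; simp [extendOrder]

theorem extendOrder_neg_natCast (c : ℕ → ℝ → ℝ) (n : ℕ) (x : ℝ) :
    extendOrder c (-n) x = (-1) ^ n * c n x := by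
  rcases n with _ | n
  · simp [extendOrder]
  · simp only [extendOrder]
    rw [if_neg (by push_cast; omega)]
    simp only [Int.natAbs_neg, Int.natAbs_natCast]

theorem extendOrder_neg (c : ℕ → ℝ → ℝ) (n : ℤ) (x : ℝ) :
    extendOrder c (-n) x = (-1) ^ n.natAbs * extendOrder c n x := by
  obtain ⟨k, rfl | rfl⟩ := n.eq_nat_or_neg
  · rw [extendOrder_neg_natCast, extendOrder_natCast]; simp
  · rw [extendOrder_neg_natCast, neg_neg, extendOrder_natCast, ← mul_assoc]
    simp [← mul_pow]

theorem extendOrder_rec {c : ℕ → ℝ → ℝ} {x : ℝ}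
    (h : ∀ n : ℕ, ((n : ℝ) + 1) * c (n + 1) x = x / 2 * (c n x + c (n + 2) x)) (n : ℤ) :
    (n : ℝ) * extendOrder c n x
      = x / 2 * (extendOrder c (n - 1) x + extendOrder c (n + 1) x) := by
  have pos : ∀ k : ℕ, ((k + 1 : ℕ) : ℝ) * extendOrder c ((k + 1 : ℕ) : ℤ) x
      = x / 2 * (extendOrder c (((k + 1 : ℕ) : ℤ) - 1) x
        + extendOrder c (((k + 1 : ℕ) : ℤ) + 1) x) := by
    intro k
    rw [show (((k + 1 : ℕ) : ℤ) - 1) = (k : ℕ) by push_cast; ring,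
      show (((k + 1 : ℕ) : ℤ) + 1) = ((k + 2 : ℕ) : ℤ) by push_cast; ring]
    simp only [extendOrder_natCast]
    push_cast
    exact h k
  obtain ⟨k, rfl | rfl⟩ := n.eq_nat_or_neg
  · rcases k with _ | k
    · have := extendOrder_neg c 1 x
      simp only [Nat.cast_zero, Int.cast_zero, zero_mul, zero_sub, zero_add, this]
      simp
    · exact_mod_cast pos k
  · rcases k with _ | k
    · have := extendOrder_neg c 1 x
      simp only [Nat.cast_zero, neg_zero, Int.cast_zero, zero_mul, zero_sub, zero_add, this]
      simp
    · have e := pos k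
      rw [show -((k + 1 : ℕ) : ℤ) - 1 = -(((k + 1 : ℕ) : ℤ) + 1) by ring,
        show -((k + 1 : ℕ) : ℤ) + 1 = -(((k + 1 : ℕ) : ℤ) - 1) by ring]
      rw [extendOrder_neg, extendOrder_neg, extendOrder_neg]
      rw [show (((k + 1 : ℕ) : ℤ) - 1) = (k : ℕ) by push_cast; ring,
        show (((k + 1 : ℕ) : ℤ) + 1) = ((k + 2 : ℕ) : ℤ) by push_cast; ring] at *
      simp only [Int.natAbs_natCast]
      push_cast at *
      rw [pow_add, pow_add]
      linear_combination (-1) ^ k * e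

theorem hasDerivAt_extendOrder {c : ℕ → ℝ → ℝ} {x : ℝ}
    (h0 : HasDerivAt (c 0) (-c 1 x) x)
    (h : ∀ n : ℕ, HasDerivAt (c (n + 1)) ((c n x - c (n + 2) x) / 2) x) (n : ℤ) :
    HasDerivAt (extendOrder c n)
      ((extendOrder c (n - 1) x - extendOrder c (n + 1) x) / 2) x := by
  have pos : ∀ k : ℕ, HasDerivAt (extendOrder c (k : ℕ))
      ((extendOrder c ((k : ℤ) - 1) x - extendOrder c ((k : ℤ) + 1) x) / 2) x := by
    intro k
    rw [extendOrder_natCast]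
    rcases k with _ | k
    · refine h0.congr_deriv ?_
      have := extendOrder_neg c 1 x
      have h1 := extendOrder_natCast c 1
      simp only [Nat.cast_zero, zero_sub, zero_add, this]
      simp only [Nat.cast_one] at h1
      simp [h1]; ring
    · refine (h k).congr_deriv ?_
      rw [show (((k + 1 : ℕ) : ℤ) - 1) = (k : ℕ) by push_cast; ring,
        show (((k + 1 : ℕ) : ℤ) + 1) = ((k + 2 : ℕ) : ℤ) by push_cast; ring]
      simp only [extendOrder_natCast]
  obtain ⟨k, rfl | rfl⟩ := n.eq_nat_or_neg
  · exact pos k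
  · have hk := (pos k).const_mul ((-1 : ℝ) ^ k)
    have e : extendOrder c (-(k : ℤ)) = fun y => (-1 : ℝ) ^ k * extendOrder c (k : ℕ) y := by
      funext y; rw [extendOrder_neg_natCast, extendOrder_natCast]
    rw [e]
    refine hk.congr_deriv ?_
    have e1 : -(k : ℤ) - 1 = -((k + 1 : ℕ) : ℤ) := by push_cast; ring
    have e2 : (k : ℤ) + 1 = ((k + 1 : ℕ) : ℤ) := by push_cast; ring
    have e3 : -(k : ℤ) + 1 = -((k : ℤ) - 1) := by ring
    rw [e1, e2, e3, extendOrder_neg, extendOrder_neg c ((k : ℤ) - 1), Int.natAbs_natCast]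
    rcases k with _ | k
    · have := extendOrder_neg c 1 x
      simp [this]
    · rw [show (((k + 1 : ℕ) : ℤ) - 1) = (k : ℕ) by push_cast; ring, Int.natAbs_natCast]
      ring

theorem besselJ_eq_extendOrder : besselJ = extendOrder besselJNat := rfl

theorem besselY_eq_extendOrder : besselY = extendOrder besselYNat := rfl

theorem besselJ_natCast (n : ℕ) (x : ℝ) : besselJ n x = besselJNat n x := by
  rw [besselJ_eq_extendOrder, extendOrder_natCast]

theorem besselY_natCast (n : ℕ) (x : ℝ) : besselY n x = besselYNat n x := by
  rw [besselY_eq_extendOrder, extendOrder_natCast]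

theorem besselJ_neg (n : ℤ) (x : ℝ) : besselJ (-n) x = (-1) ^ n.natAbs * besselJ n x :=
  extendOrder_neg _ _ _

theorem besselY_neg (n : ℤ) (x : ℝ) : besselY (-n) x = (-1) ^ n.natAbs * besselY n x :=
  extendOrder_neg _ _ _

theorem besselJ_rec (n : ℤ) (x : ℝ) :
    (n : ℝ) * besselJ n x = x / 2 * (besselJ (n - 1) x + besselJ (n + 1) x) :=
  extendOrder_rec (fun n => besselJNat_rec n x) n

theorem besselY_rec (n : ℤ) {x : ℝ} (hx : 0 < x) :
    (n : ℝ) * besselY n x = x / 2 * (besselY (n - 1) x + besselY (n + 1) x) :=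
  extendOrder_rec (fun n => besselYNat_rec n hx) n

theorem hasDerivAt_besselJ (n : ℤ) (x : ℝ) :
    HasDerivAt (besselJ n) ((besselJ (n - 1) x - besselJ (n + 1) x) / 2) x :=
  hasDerivAt_extendOrder (hasDerivAt_besselJNat_zero x)
    (fun n => hasDerivAt_besselJNat_succ n x) n

theorem hasDerivAt_besselY (n : ℤ) {x : ℝ} (hx : 0 < x) :
    HasDerivAt (besselY n) ((besselY (n - 1) x - besselY (n + 1) x) / 2) x :=
  hasDerivAt_extendOrder (hasDerivAt_besselYNat_zero hx)
    (fun n => hasDerivAt_besselYNat_succ n hx) n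

theorem besselJ'_eq (n : ℤ) (x : ℝ) :
    besselJ' n x = (besselJ (n - 1) x - besselJ (n + 1) x) / 2 := (hasDerivAt_besselJ n x).deriv

theorem hankel2_neg (n : ℤ) (x : ℝ) : hankel2 (-n) x = (-1) ^ n.natAbs * hankel2 n x := by
  simp only [hankel2, besselJ_neg, besselY_neg]
  push_cast; ring

theorem hankel2_rec (n : ℤ) {x : ℝ} (hx : 0 < x) :
    (n : ℂ) * hankel2 n x = x / 2 * (hankel2 (n - 1) x + hankel2 (n + 1) x) := by
  have h1 : ((n : ℂ)) * (besselJ n x : ℂ)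
      = x / 2 * (besselJ (n - 1) x + besselJ (n + 1) x) := by exact_mod_cast besselJ_rec n x
  have h2 : ((n : ℂ)) * (besselY n x : ℂ)
      = x / 2 * (besselY (n - 1) x + besselY (n + 1) x) := by exact_mod_cast besselY_rec n hx
  simp only [hankel2]
  linear_combination h1 - Complex.I * h2

theorem hasDerivAt_hankel2 (n : ℤ) {x : ℝ} (hx : 0 < x) :
    HasDerivAt (hankel2 n) ((hankel2 (n - 1) x - hankel2 (n + 1) x) / 2) x := by
  have h := (hasDerivAt_besselJ n x).ofReal_comp.sub
    ((hasDerivAt_besselY n hx).ofReal_comp.const_mul Complex.I)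
  refine h.congr_deriv ?_
  simp only [hankel2]
  push_cast; ring

theorem hankel2'_eq (n : ℤ) {x : ℝ} (hx : 0 < x) :
    hankel2' n x = (hankel2 (n - 1) x - hankel2 (n + 1) x) / 2 := (hasDerivAt_hankel2 n hx).deriv

theorem analyticAt_besselJNat (n : ℕ) (x : ℝ) : AnalyticAt ℝ (besselJNat n) x := by
  have e : besselJNat n = fun x => (x / 2) ^ n * powerSum (coeffJ n) ((x / 2) ^ 2) := by
    funext x; exact besselJNat_eq n x
  rw [e]
  have h := (factorialDecay_coeffJ n).analyticAt ((x / 2) ^ 2)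
  have h2 : AnalyticAt ℝ (fun x : ℝ => (x / 2) ^ 2) x := by fun_prop
  have h3 : AnalyticAt ℝ (fun x : ℝ => (x / 2) ^ n) x := by fun_prop
  exact h3.mul (AnalyticAt.fun_comp (f := fun x : ℝ => (x / 2) ^ 2) h h2)

theorem analyticAt_besselYNat (n : ℕ) {x : ℝ} (hx : 0 < x) : AnalyticAt ℝ (besselYNat n) x := by
  have h2 : AnalyticAt ℝ (fun x : ℝ => (x / 2) ^ 2) x := by fun_prop
  have h3 : AnalyticAt ℝ (fun x : ℝ => (x / 2) ^ n) x := by fun_prop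
  have hJ := h3.mul (AnalyticAt.fun_comp (f := fun x : ℝ => (x / 2) ^ 2)
    ((factorialDecay_coeffJ n).analyticAt ((x / 2) ^ 2)) h2)
  have hS := h3.mul (AnalyticAt.fun_comp (f := fun x : ℝ => (x / 2) ^ 2)
    ((factorialDecay_coeffS n).analyticAt ((x / 2) ^ 2)) h2)
  have hP : AnalyticAt ℝ (fun x : ℝ => polyY n ((x / 2) ^ 2)) x := by
    unfold polyY; fun_prop
  have hl : AnalyticAt ℝ (fun x : ℝ => Real.log (x / 2)) x :=
    (analyticAt_id.div_const).log (by simpa using hx)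
  have h4 := h3.inv (by positivity)
  have h := (analyticAt_const (v := 1 / Real.pi)).mul
    ((((analyticAt_const (v := (2 : ℝ))).mul (hl.add (analyticAt_const
      (v := Real.eulerMascheroniConstant)))).mul hJ |>.sub (h4.mul hP)).sub hS)
  refine h.congr ?_
  filter_upwards [lt_mem_nhds hx] with z hz
  rw [besselYNat_eq n hz]
  rfl

theorem analyticAt_hankel2 (n : ℤ) {x : ℝ} (hx : 0 < x) : AnalyticAt ℝ (hankel2 n) x := by
  have hJ : AnalyticAt ℝ (besselJ n) x := by
    obtain ⟨k, rfl | rfl⟩ := n.eq_nat_or_neg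
    · rw [besselJ_eq_extendOrder, extendOrder_natCast]; exact analyticAt_besselJNat k x
    · have : besselJ (-(k : ℤ)) = fun y => (-1 : ℝ) ^ k * besselJNat k y := by
        funext y; exact extendOrder_neg_natCast _ _ _
      rw [this]
      exact analyticAt_const.mul (analyticAt_besselJNat k x)
  have hY : AnalyticAt ℝ (besselY n) x := by
    obtain ⟨k, rfl | rfl⟩ := n.eq_nat_or_neg
    · rw [besselY_eq_extendOrder, extendOrder_natCast]; exact analyticAt_besselYNat k hx
    · have : besselY (-(k : ℤ)) = fun y => (-1 : ℝ) ^ k * besselYNat k y := by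
        funext y; exact extendOrder_neg_natCast _ _ _
      rw [this]
      exact analyticAt_const.mul (analyticAt_besselYNat k hx)
  have ho : ∀ y : ℝ, AnalyticAt ℝ (fun t : ℝ => (t : ℂ)) y := fun y =>
    Complex.ofRealCLM.analyticAt y
  exact ((ho _).comp hJ).sub (analyticAt_const.mul ((ho _).comp hY))

/-! ### The Wronskian -/

/-- `x (J_1 Y_0 - J_0 Y_1)` is the restriction to `x > 0` of a function that is continuous at `0`:
the logarithms cancel. -/
theorem wronskian_zero_eq {x : ℝ} (hx : 0 < x) :
    x * (besselJNat 1 x * besselYNat 0 x - besselJNat 0 x * besselYNat 1 x)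
      = 1 / Real.pi * (2 * powerSum (coeffJ 0) ((x / 2) ^ 2)
        + 2 * (x / 2) ^ 2 * (powerSum (coeffJ 0) ((x / 2) ^ 2) * powerSum (coeffS 1) ((x / 2) ^ 2)
          - powerSum (coeffJ 1) ((x / 2) ^ 2) * powerSum (coeffS 0) ((x / 2) ^ 2))) := by
  rw [besselYNat_eq 0 hx, besselYNat_eq 1 hx, besselJNat_eq, besselJNat_eq]
  have hp : polyY 1 ((x / 2) ^ 2) = 1 := by simp [polyY]
  have hp0 : polyY 0 ((x / 2) ^ 2) = 0 := by simp [polyY]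
  rw [hp, hp0]
  field_simp
  ring

/-- The function `x (J_1 Y_0 - J_0 Y_1)` has derivative zero, and its constant value is its limit
at `0`. -/
theorem wronskian_zero {x : ℝ} (hx : 0 < x) :
    x * (besselJNat 1 x * besselYNat 0 x - besselJNat 0 x * besselYNat 1 x) = 2 / Real.pi := by
  set f : ℝ → ℝ := fun x =>
    x * (besselJNat 1 x * besselYNat 0 x - besselJNat 0 x * besselYNat 1 x) with hf
  have hder : ∀ y ∈ Set.Ioi (0 : ℝ), HasDerivAt f 0 y := by
    intro y hy
    have hy : 0 < y := hy
    have h := (hasDerivAt_id y).mul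
      (((hasDerivAt_besselJNat_succ 0 y).mul (hasDerivAt_besselYNat_zero hy)).sub
        ((hasDerivAt_besselJNat_zero y).mul (hasDerivAt_besselYNat_succ 0 hy)))
    refine h.congr_deriv ?_
    have e1 := besselJNat_rec 0 y
    have e2 := besselYNat_rec 0 hy
    simp only [zero_add, id, Pi.sub_apply, Pi.mul_apply, Nat.cast_zero, one_mul] at *
    linear_combination besselYNat 0 y * e1 - besselJNat 0 y * e2
  have hc : ∀ y ∈ Set.Ioi (0 : ℝ), f y = f x := by
    intro y hy
    exact IsOpen.is_const_of_deriv_eq_zero isOpen_Ioi isPreconnected_Ioi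
      (fun z hz => (hder z hz).differentiableAt.differentiableWithinAt)
      (fun z hz => (hder z hz).deriv) hy hx
  have c : ∀ a : ℕ → ℝ, FactorialDecay a →
      Continuous fun x : ℝ => powerSum a ((x / 2) ^ 2) := fun a ha =>
    (continuous_iff_continuousAt.2 fun y => (ha.hasDerivAt y).continuousAt).comp (by fun_prop)
  have cJ0 := c _ (factorialDecay_coeffJ 0)
  have cJ1 := c _ (factorialDecay_coeffJ 1)
  have cS0 := c _ (factorialDecay_coeffS 0)
  have cS1 := c _ (factorialDecay_coeffS 1)
  have hg : Continuous fun x : ℝ => 1 / Real.pi * (2 * powerSum (coeffJ 0) ((x / 2) ^ 2)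
        + 2 * (x / 2) ^ 2 * (powerSum (coeffJ 0) ((x / 2) ^ 2) * powerSum (coeffS 1) ((x / 2) ^ 2)
          - powerSum (coeffJ 1) ((x / 2) ^ 2) * powerSum (coeffS 0) ((x / 2) ^ 2))) := by
    fun_prop
  have h1 : Tendsto f (𝓝[>] 0) (𝓝 (f x)) :=
    tendsto_const_nhds.congr'
      (by filter_upwards [self_mem_nhdsWithin] with y hy using (hc y hy).symm)
  have h2 := (hg.tendsto 0).mono_left (nhdsWithin_le_nhds (s := Set.Ioi 0))
  have h3 := h2.congr' (f₂ := f)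
    (by filter_upwards [self_mem_nhdsWithin] with y hy using (wronskian_zero_eq hy).symm)
  have h4 := tendsto_nhds_unique h1 h3
  change f x = _
  rw [h4]
  simp [powerSum_zero, coeffJ]
  ring

/-- The Wronskian of `J_n` and `Y_n`, in the form of a cross product of neighbouring orders. -/
theorem besselJ_besselY_cross (n : ℤ) {x : ℝ} (hx : 0 < x) :
    besselJ (n + 1) x * besselY n x - besselJ n x * besselY (n + 1) x
      = 2 / (Real.pi * x) := by
  have step : ∀ n : ℤ, besselJ (n + 1) x * besselY n x - besselJ n x * besselY (n + 1) x
      = besselJ n x * besselY (n - 1) x - besselJ (n - 1) x * besselY n x := by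
    intro n
    have e1 := besselJ_rec n x
    have e2 := besselY_rec n hx
    have : x * (besselJ (n + 1) x * besselY n x - besselJ n x * besselY (n + 1) x)
      = x * (besselJ n x * besselY (n - 1) x - besselJ (n - 1) x * besselY n x) := by
      linear_combination 2 * besselJ n x * e2 - 2 * besselY n x * e1
    exact mul_left_cancel₀ hx.ne' this
  induction n using Int.induction_on with
  | zero =>
    have h := wronskian_zero hx
    have e0 : ∀ x, besselJ 0 x = besselJNat 0 x := besselJ_natCast 0
    have e1 : ∀ x, besselJ 1 x = besselJNat 1 x := besselJ_natCast 1
    have f0 : ∀ x, besselY 0 x = besselYNat 0 x := besselY_natCast 0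
    have f1 : ∀ x, besselY 1 x = besselYNat 1 x := besselY_natCast 1
    rw [zero_add, e0, e1, f0, f1]
    have hpi := Real.pi_pos
    field_simp at h ⊢
    linarith
  | succ k ih => rw [step]; simpa using ih
  | pred k ih =>
    rw [step] at ih
    simpa using ih

/-- The Wronskian `J_n H_n' - J_n' H_n = -2i / (π x)`. -/
theorem besselJ_hankel2_wronskian (n : ℤ) {x : ℝ} (hx : 0 < x) :
    (besselJ n x : ℂ) * hankel2' n x - besselJ' n x * hankel2 n x
      = -Complex.I * (2 / (Real.pi * x)) := by
  have h : (besselJ (n + 1) x : ℂ) * besselY n x - besselJ n x * besselY (n + 1) x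
      = 2 / (Real.pi * x) := by exact_mod_cast besselJ_besselY_cross n hx
  have e1 : (n : ℂ) * besselJ n x = x / 2 * (besselJ (n - 1) x + besselJ (n + 1) x) := by
    exact_mod_cast besselJ_rec n x
  have e2 : (n : ℂ) * besselY n x = x / 2 * (besselY (n - 1) x + besselY (n + 1) x) := by
    exact_mod_cast besselY_rec n hx
  rw [hankel2'_eq n hx, besselJ'_eq]
  simp only [hankel2]
  rw [← h]
  have hx' : (x : ℂ) ≠ 0 := by exact_mod_cast hx.ne'
  apply mul_left_cancel₀ hx'
  push_cast
  linear_combination Complex.I * (besselJ n x : ℂ) * e2 - Complex.I * (besselY n x : ℂ) * e1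

/-- Real zeros of `H_n` would be common zeros of `J_n` and `Y_n`, which the Wronskian excludes. -/
theorem hankel2_ne_zero (n : ℤ) {x : ℝ} (hx : 0 < x) : hankel2 n x ≠ 0 := by
  intro h0
  have hre := congrArg Complex.re h0
  have him := congrArg Complex.im h0
  simp [hankel2] at hre him
  have h := besselJ_besselY_cross n hx
  rw [hre, him] at h
  have : 0 < 2 / (Real.pi * x) := by positivity
  rw [← h] at this
  simp at this

/-! ### Behaviour for large order -/

theorem abs_powerSum_le {a : ℕ → ℝ} {C : ℝ} (ha : ∀ k, |a k| ≤ C / (k.factorial : ℝ)) (y : ℝ) :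
    |powerSum a y| ≤ C * Real.exp |y| := by
  have hd : FactorialDecay a := ⟨C, ha⟩
  have hs := hd.summable_norm y
  have he : Summable fun k : ℕ => C * (|y| ^ k / (k.factorial : ℝ)) :=
    (Real.summable_pow_div_factorial |y|).mul_left C
  calc |powerSum a y| ≤ ∑' k, ‖a k * y ^ k‖ := norm_tsum_le_tsum_norm hs
    _ ≤ ∑' k : ℕ, C * (|y| ^ k / (k.factorial : ℝ)) := by
        refine hs.tsum_le_tsum (fun k => ?_) he
        rw [norm_mul, norm_pow, Real.norm_eq_abs, Real.norm_eq_abs]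
        calc |a k| * |y| ^ k ≤ C / (k.factorial : ℝ) * |y| ^ k := by gcongr; exact ha k
          _ = C * (|y| ^ k / (k.factorial : ℝ)) := by ring
    _ = C * Real.exp |y| := by
        rw [tsum_mul_left, Real.exp_eq_exp_ℝ, NormedSpace.exp_eq_tsum_div]

theorem abs_powerSum_coeffJ_sub_le (n : ℕ) (y : ℝ) :
    |powerSum (coeffJ n) y - 1 / (n.factorial : ℝ)|
      ≤ |y| * Real.exp |y| / ((n + 1).factorial : ℝ) := by
  have h := mul_powerSum_succ (factorialDecay_coeffJ n) y
  have h0 : coeffJ n 0 = 1 / (n.factorial : ℝ) := by simp [coeffJ]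
  rw [← h0, ← h, abs_mul]
  have : |powerSum (fun k => coeffJ n (k + 1)) y|
      ≤ 1 / ((n + 1).factorial : ℝ) * Real.exp |y| := by
    refine abs_powerSum_le (fun k => ?_) y
    rw [abs_coeffJ, div_div, mul_comm ((k + 1).factorial : ℝ)]
    gcongr <;> omega
  calc _ ≤ |y| * (1 / ((n + 1).factorial : ℝ) * Real.exp |y|) := by gcongr
    _ = _ := by ring

theorem abs_besselJNat_le (n : ℕ) (x : ℝ) :
    |besselJNat n x| ≤ Real.exp ((x / 2) ^ 2) * (|x / 2| ^ n / (n.factorial : ℝ)) := by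
  rw [besselJNat_eq, abs_mul, abs_pow]
  have := abs_powerSum_le (abs_coeffJ_le n) ((x / 2) ^ 2)
  rw [abs_of_nonneg (sq_nonneg (x / 2))] at this
  calc _ ≤ |x / 2| ^ n * (1 / (n.factorial : ℝ) * Real.exp ((x / 2) ^ 2)) := by gcongr
    _ = _ := by ring

theorem abs_besselJ_le (n : ℤ) (x : ℝ) :
    |besselJ n x| ≤ Real.exp ((x / 2) ^ 2) * (|x / 2| ^ n.natAbs / (n.natAbs.factorial : ℝ)) := by
  obtain ⟨k, rfl | rfl⟩ := n.eq_nat_or_neg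
  · rw [besselJ_natCast]; exact abs_besselJNat_le k x
  · rw [besselJ_neg, besselJ_natCast, abs_mul]
    simpa using abs_besselJNat_le k x

/-- `J_n` has no zero in `(0, x]` once `n` is large compared with `x`. -/
theorem besselJNat_ne_zero_of_lt {n : ℕ} {x : ℝ} (hx : 0 < x)
    (hn : (x / 2) ^ 2 * Real.exp ((x / 2) ^ 2) < n + 1) : besselJNat n x ≠ 0 := by
  rw [besselJNat_eq]
  refine mul_ne_zero (by positivity) fun h0 => ?_
  have h := abs_powerSum_coeffJ_sub_le n ((x / 2) ^ 2)
  rw [h0, zero_sub, abs_neg, abs_of_pos (by positivity), abs_of_nonneg (sq_nonneg (x / 2)),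
    Nat.factorial_succ, div_le_div_iff₀ (by positivity) (by positivity)] at h
  have hf : (0 : ℝ) < n.factorial := by positivity
  push_cast at h
  nlinarith

theorem tendsto_besselJNat (x : ℝ) (hx : 0 < x) :
    Tendsto (fun n : ℕ => (n.factorial : ℝ) / (x / 2) ^ n * besselJNat n x) atTop (𝓝 1) := by
  set y := (x / 2) ^ 2 with hy
  have hb : ∀ n : ℕ, |(n.factorial : ℝ) / (x / 2) ^ n * besselJNat n x - 1|
      ≤ (y * Real.exp y) * (1 / ((n : ℝ) + 1)) := by
    intro n
    have h := abs_powerSum_coeffJ_sub_le n y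
    rw [abs_of_nonneg (show 0 ≤ y from sq_nonneg _)] at h
    have e : (n.factorial : ℝ) / (x / 2) ^ n * besselJNat n x - 1
        = (n.factorial : ℝ) * (powerSum (coeffJ n) y - 1 / (n.factorial : ℝ)) := by
      rw [besselJNat_eq, ← hy]
      field_simp
    rw [e, abs_mul, abs_of_pos (by positivity)]
    calc _ ≤ (n.factorial : ℝ) * (y * Real.exp y / ((n + 1).factorial : ℝ)) := by gcongr
      _ = _ := by rw [Nat.factorial_succ]; push_cast; field_simp
  rw [tendsto_iff_norm_sub_tendsto_zero]
  refine squeeze_zero (fun n => norm_nonneg _) hb ?_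
  simpa using tendsto_one_div_add_atTop_nhds_zero_nat.const_mul (y * Real.exp y)

theorem abs_polyY_sub_le (m : ℕ) {y : ℝ} (hy : 0 ≤ y) :
    |polyY (m + 2) y - ((m + 1).factorial : ℝ)| ≤ (m.factorial : ℝ) * (y * Real.exp y) := by
  rw [polyY, Finset.sum_range_succ']
  have e : (((m + 2 - 1 - 0).factorial : ℝ) / ((0 : ℕ).factorial : ℝ) * y ^ 0)
      = ((m + 1).factorial : ℝ) := by simp
  rw [e, add_sub_cancel_right, abs_of_nonneg (by positivity)]
  have he : ∑ k ∈ Finset.range (m + 1), y ^ k / (k.factorial : ℝ) ≤ Real.exp y :=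
    Real.sum_le_exp_of_nonneg hy _
  calc _ ≤ ∑ k ∈ Finset.range (m + 1), (m.factorial : ℝ) * (y * (y ^ k / (k.factorial : ℝ))) := by
        refine Finset.sum_le_sum fun k _ => ?_
        have h1 : ((m + 2 - 1 - (k + 1)).factorial : ℝ) ≤ (m.factorial : ℝ) := by
          exact_mod_cast Nat.factorial_le (by omega)
        have h2 : (k.factorial : ℝ) ≤ ((k + 1).factorial : ℝ) := by
          exact_mod_cast Nat.factorial_le (by omega)
        calc _ ≤ (m.factorial : ℝ) / (k.factorial : ℝ) * y ^ (k + 1) := by gcongr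
          _ = _ := by ring
    _ = (m.factorial : ℝ) * (y * ∑ k ∈ Finset.range (m + 1), y ^ k / (k.factorial : ℝ)) := by
        rw [Finset.mul_sum, Finset.mul_sum]
    _ ≤ _ := by gcongr

/-- The term `k = 0` dominates `P_{n+1}(y)`. -/
theorem tendsto_polyY {y : ℝ} (hy : 0 ≤ y) :
    Tendsto (fun n : ℕ => polyY (n + 1) y / (n.factorial : ℝ)) atTop (𝓝 1) := by
  rw [← tendsto_add_atTop_iff_nat 1, tendsto_iff_norm_sub_tendsto_zero]
  refine squeeze_zero (fun n => norm_nonneg _)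
    (g := fun n : ℕ => (y * Real.exp y) * (1 / ((n : ℝ) + 1)))
    (fun m => ?_) ?_
  · have e : polyY (m + 1 + 1) y / ((m + 1).factorial : ℝ) - 1
        = (polyY (m + 2) y - ((m + 1).factorial : ℝ)) / ((m + 1).factorial : ℝ) := by
      field_simp
    rw [e, Real.norm_eq_abs, abs_div,
      abs_of_pos (show (0 : ℝ) < ((m + 1).factorial : ℝ) by positivity), div_le_iff₀ (by positivity)]
    refine (abs_polyY_sub_le m hy).trans (le_of_eq ?_)
    rw [Nat.factorial_succ]; push_cast; field_simp
  · simpa using tendsto_one_div_add_atTop_nhds_zero_nat.const_mul (y * Real.exp y)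

theorem tendsto_besselYNat {x : ℝ} (hx : 0 < x) :
    Tendsto (fun n : ℕ => (x / 2) ^ (n + 1) / (n.factorial : ℝ) * besselYNat (n + 1) x) atTop
      (𝓝 (-(1 / Real.pi))) := by
  set h := x / 2 with hh
  have hh0 : 0 < h := by positivity
  set y := h ^ 2 with hy
  have hy0 : 0 ≤ y := sq_nonneg _
  have hz : Tendsto (fun n : ℕ => y * (y ^ n / (n.factorial : ℝ))) atTop (𝓝 0) := by
    simpa using (FloorSemiring.tendsto_pow_div_factorial_atTop y).const_mul y
  have small : ∀ (a : ℕ → ℕ → ℝ) (C : ℝ), (∀ n k, |a (n + 1) k| ≤ C / (k.factorial : ℝ)) →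
      Tendsto (fun n : ℕ => y * (y ^ n / (n.factorial : ℝ)) * powerSum (a (n + 1)) y) atTop
        (𝓝 0) := by
    intro a C ha
    refine squeeze_zero_norm
      (a := fun n : ℕ => y * (y ^ n / (n.factorial : ℝ)) * (C * Real.exp |y|))
      (fun n => ?_) ?_
    · rw [norm_mul, Real.norm_of_nonneg (by positivity)]
      gcongr
      exact abs_powerSum_le (ha n) y
    · simpa using hz.mul_const (C * Real.exp |y|)
  have t1 := small coeffJ 1 fun n k => (abs_coeffJ_le _ _).trans (by
    gcongr
    rw [div_le_one (by positivity)]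
    exact_mod_cast Nat.succ_le_of_lt (Nat.factorial_pos _))
  have t2 := small coeffS 2 fun n k => (abs_coeffS_le _ _).trans (by
    gcongr
    rw [div_le_iff₀ (by positivity)]
    have : (1 : ℝ) ≤ ((n + 1 - 1).factorial : ℝ) := by
      exact_mod_cast Nat.succ_le_of_lt (Nat.factorial_pos _)
    linarith)
  have t := (((t1.const_mul (2 * (Real.log h + Real.eulerMascheroniConstant))).sub
    (tendsto_polyY hy0)).sub t2).const_mul (1 / Real.pi)
  have e : 1 / Real.pi * (2 * (Real.log h + Real.eulerMascheroniConstant) * 0 - 1 - 0)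
      = -(1 / Real.pi) := by ring
  rw [e] at t
  refine t.congr fun n => ?_
  rw [besselYNat_eq _ hx, ← hh, ← hy]
  have : y ^ n * y = h ^ (n + 1) * h ^ (n + 1) := by
    rw [hy, ← pow_succ, ← pow_mul, ← pow_add]; congr 1; ring
  field_simp
  linear_combination ((Real.log h + Real.eulerMascheroniConstant) * 2 * powerSum (coeffJ (n + 1)) y
    - powerSum (coeffS (n + 1)) y) * this

/-- `H_n(x) ~ (i/π) (n-1)! (2/x)^n`: the contribution of `J_n` is negligible. -/
theorem tendsto_hankel2 {x : ℝ} (hx : 0 < x) :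
    Tendsto (fun n : ℕ => (((x / 2) ^ (n + 1) / (n.factorial : ℝ) : ℝ) : ℂ)
      * hankel2 (n + 1 : ℕ) x) atTop (𝓝 (Complex.I / Real.pi)) := by
  have hJ : Tendsto (fun n : ℕ => (x / 2) ^ (n + 1) / (n.factorial : ℝ) * besselJNat (n + 1) x)
      atTop (𝓝 0) := by
    set y := (x / 2) ^ 2 with hy
    have h1 := ((tendsto_besselJNat x hx).comp (tendsto_add_atTop_nat 1)).mul
      ((FloorSemiring.tendsto_pow_div_factorial_atTop y).comp (tendsto_add_atTop_nat 1))
    have h2 : Tendsto (fun n : ℕ => 1 / (n.factorial : ℝ)) atTop (𝓝 0) := by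
      simpa using FloorSemiring.tendsto_pow_div_factorial_atTop (1 : ℝ)
    have h3 := h1.mul h2
    simp only [mul_zero] at h3
    refine h3.congr fun n => ?_
    simp only [Function.comp]
    have : y ^ (n + 1) = (x / 2) ^ (n + 1) * (x / 2) ^ (n + 1) := by
      rw [hy, ← pow_mul, ← pow_add]; congr 1; ring
    rw [this]
    field_simp
  have h := ((Complex.continuous_ofReal.tendsto _).comp hJ).sub
    (((Complex.continuous_ofReal.tendsto _).comp (tendsto_besselYNat hx)).const_mul Complex.I)
  have e : ((0 : ℝ) : ℂ) - Complex.I * ((-(1 / Real.pi) : ℝ) : ℂ) = Complex.I / Real.pi := by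
    push_cast; ring
  rw [e] at h
  refine h.congr fun n => ?_
  simp only [Function.comp, hankel2, besselJ_natCast, besselY_natCast]
  push_cast; ring

theorem tendsto_besselJ' {x : ℝ} (hx : 0 < x) :
    Tendsto (fun n : ℕ => (n.factorial : ℝ) / (x / 2) ^ n * besselJ' (n + 1 : ℕ) x) atTop
      (𝓝 (1 / 2)) := by
  have h1 := tendsto_besselJNat x hx
  have h2 := h1.comp (tendsto_add_atTop_nat 2)
  have h3 : Tendsto (fun n : ℕ => 1 / ((n : ℝ) + 1)) atTop (𝓝 0) :=
    tendsto_one_div_add_atTop_nhds_zero_nat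
  have h4 := h3.comp (tendsto_add_atTop_nat 1)
  have h := ((h1.sub ((h2.mul (h3.mul h4)).const_mul ((x / 2) ^ 2))).const_mul (1 / 2))
  simp only [mul_zero, sub_zero, mul_one] at h
  refine h.congr fun n => ?_
  rw [besselJ'_eq, show ((n + 1 : ℕ) : ℤ) - 1 = (n : ℕ) by push_cast; ring,
    show ((n + 1 : ℕ) : ℤ) + 1 = (n + 2 : ℕ) by push_cast; ring, besselJ_natCast, besselJ_natCast]
  simp only [Function.comp, Nat.factorial_succ]
  have a1 : (n : ℝ) + 1 ≠ 0 := by positivity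
  have a2 : (n : ℝ) + 1 + 1 ≠ 0 := by positivity
  push_cast
  field_simp
  ring

theorem tendsto_hankel2' {x : ℝ} (hx : 0 < x) :
    Tendsto (fun n : ℕ => (((x / 2) ^ (n + 2) / ((n + 1).factorial : ℝ) : ℝ) : ℂ)
      * hankel2' (n + 1 : ℕ) x) atTop (𝓝 (-(Complex.I / (2 * Real.pi)))) := by
  rw [← tendsto_add_atTop_iff_nat 1]
  have h1 := tendsto_hankel2 hx
  have h2 := h1.comp (tendsto_add_atTop_nat 2)
  have h3 : Tendsto (fun n : ℕ => ((1 / ((n : ℝ) + 1) : ℝ) : ℂ)) atTop (𝓝 ((0 : ℝ) : ℂ)) :=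
    (Complex.continuous_ofReal.tendsto _).comp tendsto_one_div_add_atTop_nhds_zero_nat
  have h4 := h3.comp (tendsto_add_atTop_nat 1)
  have h := ((((h1.mul (h3.mul h4)).const_mul ((x / 2 : ℂ) ^ 2)).sub h2).const_mul (1 / 2 : ℂ))
  have e : (1 / 2 : ℂ) * ((x / 2 : ℂ) ^ 2 * (Complex.I / Real.pi * (((0 : ℝ) : ℂ) * ((0 : ℝ) : ℂ)))
      - Complex.I / Real.pi) = -(Complex.I / (2 * Real.pi)) := by
    simp; ring
  rw [e] at h
  refine h.congr fun n => ?_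
  rw [hankel2'_eq _ hx, show ((n + 1 + 1 : ℕ) : ℤ) - 1 = (n + 1 : ℕ) by push_cast; ring,
    show ((n + 1 + 1 : ℕ) : ℤ) + 1 = (n + 2 + 1 : ℕ) by push_cast; ring]
  simp only [Function.comp, Nat.factorial_succ]
  have a1 : (n : ℂ) + 1 ≠ 0 := by exact_mod_cast (Nat.succ_ne_zero n)
  have a2 : (n : ℂ) + 1 + 1 ≠ 0 := by exact_mod_cast (Nat.succ_ne_zero (n + 1))
  have a3 : (n.factorial : ℂ) ≠ 0 := by exact_mod_cast n.factorial_ne_zero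
  push_cast
  field_simp
  ring

/-- The Hankel functions are `O((|n|-1)! (2/x)^{|n|})`; here `(|n|-1)!` is written as
`|n|! / max(1, |n|)` to include `n = 0`. -/
theorem norm_hankel2_le {x : ℝ} (hx : 0 < x) :
    ∃ C : ℝ, 0 < C ∧ ∀ n : ℤ, ‖hankel2 n x‖
      ≤ C * ((n.natAbs.factorial : ℝ) / max 1 (n.natAbs : ℝ) / (x / 2) ^ n.natAbs) := by
  obtain ⟨C, hC⟩ := (tendsto_hankel2 hx).norm.bddAbove_range
  have hC' : ∀ n : ℕ, (x / 2) ^ (n + 1) / (n.factorial : ℝ) * ‖hankel2 (n + 1 : ℕ) x‖ ≤ C := by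
    intro n
    have h := hC (Set.mem_range_self n)
    rwa [norm_mul, Complex.norm_real, Real.norm_of_nonneg (by positivity)] at h
  have nat : ∀ n : ℕ, ‖hankel2 n x‖
      ≤ max C (‖hankel2 0 x‖ + 1) * ((n.factorial : ℝ) / max 1 (n : ℝ) / (x / 2) ^ n) := by
    intro n
    rcases n with _ | n
    · simp
    · have h1 := hC' n
      have hm : max 1 (((n + 1 : ℕ) : ℝ)) = n + 1 := by
        rw [max_eq_right (by push_cast; linarith [Nat.cast_nonneg (α := ℝ) n]), Nat.cast_succ]
      have hf : ((n + 1).factorial : ℝ) / (n + 1) = n.factorial := by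
        rw [Nat.factorial_succ]; push_cast; field_simp
      rw [hm, hf]
      have h2 : (x / 2) ^ (n + 1) / (n.factorial : ℝ) * ‖hankel2 (n + 1 : ℕ) x‖
          ≤ max C (‖hankel2 0 x‖ + 1) := h1.trans (le_max_left _ _)
      have hp : 0 < (x / 2) ^ (n + 1) := by positivity
      rw [div_mul_eq_mul_div, div_le_iff₀ (by positivity)] at h2
      rw [← mul_div_assoc, le_div_iff₀ hp]
      linarith
  refine ⟨max C (‖hankel2 0 x‖ + 1), lt_max_of_lt_right (by positivity), fun n => ?_⟩
  obtain ⟨k, rfl | rfl⟩ := n.eq_nat_or_neg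
  · exact nat k
  · rw [hankel2_neg, norm_mul]
    simpa using nat k

/-! ### Graf's addition theorem -/

theorem Summable.comp_int_natAbs {f : ℕ → ℝ} (hf : Summable f) :
    Summable fun n : ℤ => f n.natAbs := by
  rw [summable_int_iff_summable_nat_and_neg]
  simpa using hf

theorem Summable.comp_add_int {E : Type*} [NormedAddCommGroup E] {f : ℤ → E} (hf : Summable f)
    (k : ℤ) : Summable fun n => f (n + k) := (Equiv.addRight k).summable_iff.2 hf

theorem tsum_comp_add_int {E : Type*} [NormedAddCommGroup E] (f : ℤ → E) (k : ℤ) :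
    ∑' n, f (n + k) = ∑' n, f n := (Equiv.addRight k).tsum_eq f

/-- A shift of the order by `m` changes the factorial by a polynomial factor. -/
theorem factorial_natAbs_add_le (n m : ℤ) :
    (((n + m).natAbs.factorial : ℕ) : ℝ)
      ≤ n.natAbs.factorial * ((n.natAbs : ℝ) + m.natAbs) ^ m.natAbs := by
  have h1 : (n + m).natAbs ≤ n.natAbs + m.natAbs := Int.natAbs_add_le n m
  have h2 := Nat.factorial_le h1
  rw [← Nat.factorial_mul_ascFactorial] at h2
  exact_mod_cast h2.trans (Nat.mul_le_mul_left _ (Nat.ascFactorial_le_pow_add _ _))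

theorem pow_natAbs_le_mul {ρ : ℝ} (hρ : 0 < ρ) (n m : ℤ) :
    ρ ^ n.natAbs ≤ (ρ ^ m.natAbs + (ρ ^ m.natAbs)⁻¹) * ρ ^ (n + m).natAbs := by
  have hpos : 0 < ρ ^ m.natAbs := by positivity
  have hpos' : 0 < ρ ^ (n + m).natAbs := by positivity
  rcases le_total 1 ρ with h | h
  · calc ρ ^ n.natAbs ≤ ρ ^ (m.natAbs + (n + m).natAbs) := pow_le_pow_right₀ h (by omega)
      _ = ρ ^ m.natAbs * ρ ^ (n + m).natAbs := pow_add _ _ _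
      _ ≤ _ := by gcongr; linarith [inv_pos.2 hpos]
  · calc ρ ^ n.natAbs = (ρ ^ m.natAbs)⁻¹ * ρ ^ (n.natAbs + m.natAbs) := by
          rw [pow_add]; field_simp
      _ ≤ (ρ ^ m.natAbs)⁻¹ * ρ ^ (n + m).natAbs := by
          gcongr ?_ * ?_
          exact pow_le_pow_of_le_one hρ.le h (by omega)
      _ ≤ _ := by gcongr; linarith

theorem summable_add_pow_mul_geometric (b : ℕ) {q : ℝ} (hq0 : 0 ≤ q) (hq : q < 1) :
    Summable fun a : ℕ => ((a : ℝ) + b) ^ b * q ^ a := by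
  have h1 : Summable fun a : ℕ => (a : ℝ) ^ b * q ^ a :=
    summable_pow_mul_geometric_of_norm_lt_one b (by rwa [Real.norm_of_nonneg hq0])
  have h2 : Summable fun a : ℕ => (b : ℝ) ^ b * q ^ a :=
    (summable_geometric_of_lt_one hq0 hq).mul_left _
  refine Summable.of_nonneg_of_le (fun a => by positivity) (fun a => ?_)
    ((h1.add h2).mul_left (2 ^ b))
  rw [← add_mul, ← mul_assoc]
  gcongr
  rcases le_total (a : ℝ) b with h | h
  · calc ((a : ℝ) + b) ^ b ≤ (2 * b) ^ b := by gcongr; linarith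
      _ = 2 ^ b * (b : ℝ) ^ b := mul_pow _ _ _
      _ ≤ _ := by gcongr; linarith [pow_nonneg (Nat.cast_nonneg (α := ℝ) a) b]
  · calc ((a : ℝ) + b) ^ b ≤ (2 * a) ^ b := by gcongr; linarith
      _ = 2 ^ b * (a : ℝ) ^ b := mul_pow _ _ _
      _ ≤ _ := by gcongr; linarith [pow_nonneg (Nat.cast_nonneg (α := ℝ) b) b]

theorem summable_hankel2_mul_pow (m : ℤ) {r R : ℝ} (hr : 0 ≤ r) (hR : r < R) :
    Summable fun n : ℤ =>
      ‖hankel2 (n + m) R‖ * ((r / 2) ^ n.natAbs / (n.natAbs.factorial : ℝ)) := by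
  have hR0 : 0 < R := hr.trans_lt hR
  obtain ⟨C, hC0, hC⟩ := norm_hankel2_le hR0
  set ρ := R / 2 with hρ
  have hρ0 : 0 < ρ := by positivity
  set κ := ρ ^ m.natAbs + (ρ ^ m.natAbs)⁻¹ with hκ
  have hκ0 : 0 < κ := by positivity
  have hq : r / R < 1 := (div_lt_one hR0).2 hR
  refine Summable.of_nonneg_of_le (fun n => by positivity) (fun n => ?_)
    ((summable_add_pow_mul_geometric m.natAbs
      (by positivity : 0 ≤ r / R) hq).comp_int_natAbs.mul_left (C * κ))
  have h1 : ‖hankel2 (n + m) R‖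
      ≤ C * (n.natAbs.factorial * ((n.natAbs : ℝ) + m.natAbs) ^ m.natAbs * (κ / ρ ^ n.natAbs)) := by
    refine (hC (n + m)).trans ?_
    gcongr
    calc ((n + m).natAbs.factorial : ℝ) / max 1 ((n + m).natAbs : ℝ) / ρ ^ (n + m).natAbs
        ≤ ((n + m).natAbs.factorial : ℝ) / ρ ^ (n + m).natAbs := by
          gcongr
          exact div_le_self (by positivity) (le_max_left _ _)
      _ = ((n + m).natAbs.factorial : ℝ) * (1 / ρ ^ (n + m).natAbs) := by ring
      _ ≤ _ := by
          refine mul_le_mul (factorial_natAbs_add_le n m) ?_ (by positivity) (by positivity)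
          · rw [div_le_div_iff₀ (by positivity) (by positivity), one_mul]
            exact pow_natAbs_le_mul hρ0 n m
  calc _ ≤ C * (n.natAbs.factorial * ((n.natAbs : ℝ) + m.natAbs) ^ m.natAbs * (κ / ρ ^ n.natAbs))
        * ((r / 2) ^ n.natAbs / (n.natAbs.factorial : ℝ)) := by gcongr
    _ = _ := by
        have e : (r / R) ^ n.natAbs = (r / 2) ^ n.natAbs / ρ ^ n.natAbs := by
          rw [← div_pow, hρ]; congr 1; field_simp
        rw [e]
        field_simp

theorem summable_norm_hankel2_mul_besselJ (m : ℤ) {r R : ℝ} (hR : |r| < R) :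
    Summable fun n : ℤ => ‖hankel2 (n + m) R‖ * |besselJ n r| := by
  refine Summable.of_nonneg_of_le (fun n => by positivity) (fun n => ?_)
    ((summable_hankel2_mul_pow m (abs_nonneg r) hR).mul_left (Real.exp ((r / 2) ^ 2)))
  calc _ ≤ ‖hankel2 (n + m) R‖ * (Real.exp ((r / 2) ^ 2)
        * (|r / 2| ^ n.natAbs / (n.natAbs.factorial : ℝ))) := by
        gcongr; exact abs_besselJ_le n r
    _ = _ := by rw [abs_div, abs_two]; ring

/-- Analytic functions linked by the ladder relations `d_m' = A d_{m-1} + B d_{m+1}` and vanishing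
at `0` vanish identically: all their derivatives at `0` are zero. -/
theorem eqOn_zero_of_ladder {R : ℝ} (hR : 0 < R) {A B : ℂ} {d : ℤ → ℝ → ℂ}
    (ha : ∀ m, ∀ x ∈ Set.Ioo (-R) R, AnalyticAt ℝ (d m) x)
    (hd : ∀ m, ∀ x ∈ Set.Ioo (-R) R, HasDerivAt (d m) (A * d (m - 1) x + B * d (m + 1) x) x)
    (h0 : ∀ m, d m 0 = 0) (m : ℤ) : Set.EqOn (d m) 0 (Set.Ioo (-R) R) := by
  have hmem : (0 : ℝ) ∈ Set.Ioo (-R) R := ⟨by linarith, hR⟩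
  have key : ∀ k : ℕ, ∀ m, (k : ℕ∞) ≤ analyticOrderAt (d m) 0 := by
    intro k
    induction k with
    | zero => intro m; simp
    | succ k ih =>
      intro m
      have h1 := (ha m 0 hmem).analyticOrderAt_deriv_add_one
      simp only [h0, sub_zero] at h1
      rw [← h1, Nat.cast_succ]
      gcongr
      have h2 : deriv (d m) =ᶠ[𝓝 0] fun x => A * d (m - 1) x + B * d (m + 1) x := by
        filter_upwards [isOpen_Ioo.mem_nhds hmem] with x hx using (hd m x hx).deriv
      have a1 := ha (m - 1) 0 hmem
      have a2 := ha (m + 1) 0 hmem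
      rw [analyticOrderAt_congr h2, natCast_le_analyticOrderAt (by fun_prop)]
      obtain ⟨g1, hg1, e1⟩ := (natCast_le_analyticOrderAt a1).1 (ih (m - 1))
      obtain ⟨g2, hg2, e2⟩ := (natCast_le_analyticOrderAt a2).1 (ih (m + 1))
      refine ⟨fun x => A * g1 x + B * g2 x, by fun_prop, ?_⟩
      filter_upwards [e1, e2] with x hx1 hx2
      rw [hx1, hx2]
      simp only [Complex.real_smul]
      ring
  have htop : analyticOrderAt (d m) 0 = ⊤ := ENat.eq_top_iff_forall_ge.2 fun k => key k m
  exact AnalyticOnNhd.eqOn_zero_of_preconnected_of_eventuallyEq_zero (fun x hx => ha m x hx)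
    isPreconnected_Ioo hmem (analyticOrderAt_eq_top.1 htop)

/-- The outgoing cylindrical wave `H_m(|z|) e^{i m arg z}`, the phase being `(z / |z|)^m`. -/
noncomputable def cylWave (m : ℤ) (z : ℂ) : ℂ := hankel2 m ‖z‖ * (z / ‖z‖) ^ m

section Wave

variable {R : ℝ} {ζ : ℂ}

theorem norm_sub_mul_pos (hζ : ‖ζ‖ = 1) {r : ℝ} (hr : |r| < R) : 0 < ‖(R : ℂ) - r * ζ‖ := by
  have h := norm_sub_norm_le (R : ℂ) (r * ζ)
  rw [norm_mul, hζ, Complex.norm_real, Complex.norm_real, Real.norm_eq_abs, Real.norm_eq_abs,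
    abs_of_pos ((abs_nonneg r).trans_lt hr)] at h
  linarith

theorem norm_sub_mul_eq (hζ : ‖ζ‖ = 1) (r : ℝ) :
    ‖(R : ℂ) - r * ζ‖ = Real.sqrt (R ^ 2 + r ^ 2 - 2 * R * r * ζ.re) := by
  have h : ζ.re * ζ.re + ζ.im * ζ.im = 1 := by
    rw [← Complex.normSq_apply, Complex.normSq_eq_norm_sq, hζ]; norm_num
  rw [Complex.norm_def, Complex.normSq_apply]
  congr 1
  simp
  linear_combination r ^ 2 * h

theorem analyticAt_cylWave (hζ : ‖ζ‖ = 1) (m : ℤ) {r : ℝ} (hr : |r| < R) :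
    AnalyticAt ℝ (fun r : ℝ => cylWave m (R - r * ζ)) r := by
  have hD := norm_sub_mul_pos hζ hr
  have hDa : AnalyticAt ℝ (fun r : ℝ => ‖(R : ℂ) - r * ζ‖) r := by
    simp_rw [norm_sub_mul_eq hζ]
    rw [norm_sub_mul_eq hζ] at hD
    have hs : AnalyticAt ℝ Real.sqrt (R ^ 2 + r ^ 2 - 2 * R * r * ζ.re) :=
      (Real.contDiffAt_sqrt (Real.sqrt_pos.1 hD).ne').analyticAt
    exact AnalyticAt.fun_comp (f := fun r : ℝ => R ^ 2 + r ^ 2 - 2 * R * r * ζ.re) hs (by fun_prop)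
  have ho : ∀ y : ℝ, AnalyticAt ℝ (fun t : ℝ => (t : ℂ)) y := fun y =>
    Complex.ofRealCLM.analyticAt y
  have hH : AnalyticAt ℝ (fun r : ℝ => hankel2 m ‖(R : ℂ) - r * ζ‖) r :=
    AnalyticAt.fun_comp (f := fun r : ℝ => ‖(R : ℂ) - r * ζ‖) (analyticAt_hankel2 m hD) hDa
  have hDc : AnalyticAt ℝ (fun r : ℝ => ((‖(R : ℂ) - r * ζ‖ : ℝ) : ℂ)) r :=
    AnalyticAt.fun_comp (f := fun r : ℝ => ‖(R : ℂ) - r * ζ‖) (ho _) hDa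
  have hDne : ((‖(R : ℂ) - r * ζ‖ : ℝ) : ℂ) ≠ 0 := by exact_mod_cast hD.ne'
  have hz : AnalyticAt ℝ (fun r : ℝ => (R : ℂ) - r * ζ) r :=
    analyticAt_const.sub ((ho r).mul analyticAt_const)
  exact hH.mul ((hz.div hDc hDne).zpow (div_ne_zero (norm_pos_iff.1 hD) hDne))

/-- Ladder relation for the waves: the derivative along `-ζ` shifts the order. -/
theorem hasDerivAt_cylWave (hζ : ‖ζ‖ = 1) (m : ℤ) {r : ℝ} (hr : |r| < R) :
    HasDerivAt (fun r : ℝ => cylWave m (R - r * ζ))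
      (-ζ / 2 * cylWave (m - 1) (R - r * ζ)
        + (starRingEnd ℂ) ζ / 2 * cylWave (m + 1) (R - r * ζ)) r := by
  have hD := norm_sub_mul_pos hζ hr
  set D := ‖(R : ℂ) - r * ζ‖ with hDdef
  set z := (R : ℂ) - r * ζ with hzdef
  have hDne : (D : ℂ) ≠ 0 := by exact_mod_cast hD.ne'
  have hz0 : z ≠ 0 := norm_pos_iff.1 hD
  set D' : ℝ := (r - R * ζ.re) / D with hD'
  have hDd : HasDerivAt (fun r : ℝ => ‖(R : ℂ) - r * ζ‖) D' r := by
    have e := norm_sub_mul_eq (R := R) hζ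
    simp_rw [e]
    have hne : R ^ 2 + r ^ 2 - 2 * R * r * ζ.re ≠ 0 := by
      rw [hDdef, e] at hD; exact (Real.sqrt_pos.1 hD).ne'
    have hp : HasDerivAt (fun r : ℝ => R ^ 2 + r ^ 2 - 2 * R * r * ζ.re)
        (2 * r - 2 * R * ζ.re) r := by
      have := (((hasDerivAt_id r).pow 2).const_add (R ^ 2)).sub
        (((hasDerivAt_id r).const_mul (2 * R)).mul_const ζ.re)
      refine this.congr_deriv ?_
      simp
    refine (hp.sqrt hne).congr_deriv ?_
    rw [hD', hDdef, hzdef, e]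
    field_simp
  have hzd : HasDerivAt (fun r : ℝ => (R : ℂ) - r * ζ) (-ζ) r := by
    have := ((hasDerivAt_id r).ofReal_comp.mul_const ζ).const_sub (R : ℂ)
    refine this.congr_deriv ?_
    simp
  set W := z / D with hW
  have hW0 : W ≠ 0 := div_ne_zero hz0 hDne
  have hWd : HasDerivAt (fun r : ℝ => ((R : ℂ) - r * ζ) / (‖(R : ℂ) - r * ζ‖ : ℝ))
      ((-ζ * D - z * D') / D ^ 2) r := hzd.div hDd.ofReal_comp hDne
  have hWm := (hasDerivAt_zpow m W (Or.inl hW0)).scomp r hWd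
  have hH := (hasDerivAt_hankel2 m hD).scomp r hDd
  have h := hH.mul hWm
  have e0 : (fun r : ℝ => cylWave m (R - r * ζ)) =
      (hankel2 m ∘ fun r : ℝ => ‖(R : ℂ) - r * ζ‖) * ((fun x : ℂ => x ^ m) ∘
        fun r : ℝ => ((R : ℂ) - r * ζ) / (‖(R : ℂ) - r * ζ‖ : ℝ)) := by
    funext r; rfl
  rw [e0]
  refine h.congr_deriv ?_
  have hrec := hankel2_rec m hD
  -- the radial derivative of the modulus is the real part of the unit direction
  have hunit : ζ * (starRingEnd ℂ) ζ = 1 := by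
    rw [Complex.mul_conj, Complex.normSq_eq_norm_sq, hζ]; norm_num
  have hre : (ζ.re : ℂ) = (ζ + (starRingEnd ℂ) ζ) / 2 := by
    rw [Complex.re_eq_add_conj]
  have hzz : z * (R - r * (starRingEnd ℂ) ζ) = D ^ 2 := by
    have : (starRingEnd ℂ) z = R - r * (starRingEnd ℂ) ζ := by simp [hzdef]
    rw [← this, Complex.mul_conj, Complex.normSq_eq_norm_sq]; push_cast; rfl
  have hD'c : (D' : ℂ) * D = r - R * ζ.re := by
    rw [hD']; push_cast; field_simp
  have hkey : -2 * z * ((D' : ℂ) * D) = ζ * D ^ 2 + (starRingEnd ℂ) ζ * z ^ 2 := by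
    rw [hD'c, hre, ← hzz, hzdef]
    linear_combination (2 * r * (R - r * ζ) : ℂ) * hunit
  have hWz : W * D = z := by rw [hW]; field_simp
  have hQ : (-ζ * D - z * D') / D ^ 2 * D = -ζ - W * D' := by
    rw [← hWz]; field_simp
  simp only [cylWave, Complex.real_smul, smul_eq_mul, Function.comp]
  rw [← hDdef, ← hzdef, ← hW, zpow_add_one₀ hW0]
  obtain ⟨u, hu⟩ : ∃ u, u = W ^ (m - 1) := ⟨_, rfl⟩
  have hu' : W ^ m = u * W := by
    rw [hu, zpow_sub_one₀ hW0, mul_assoc, inv_mul_cancel₀ hW0, mul_one]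
  rw [← hu, hu']
  clear hWm hH h hWd hDd hzd e0
  generalize (-ζ * D - z * D') / D ^ 2 = Q at *
  clear_value W z D D'
  have hk2 : -2 * W * D' = ζ + (starRingEnd ℂ) ζ * W ^ 2 := by
    have : (D : ℂ) ^ 2 * (-2 * W * D') = (D : ℂ) ^ 2 * (ζ + (starRingEnd ℂ) ζ * W ^ 2) := by
      linear_combination hkey + (-2 * D * D' - (starRingEnd ℂ) ζ * (W * D + z)) * hWz
    exact mul_left_cancel₀ (pow_ne_zero 2 hDne) this
  linear_combination (Q * u) * hrec + (1 / 2 * (hankel2 (m - 1) D + hankel2 (m + 1) D) * u) * hQ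
    + (1 / 2 * hankel2 (m + 1) D * u) * hk2

/-- The partial-wave sum on the right-hand side of Graf's formula. -/
noncomputable def grafSum (R : ℝ) (ζ : ℂ) (m : ℤ) (r : ℝ) : ℂ :=
  ∑' n : ℤ, hankel2 (n + m) R * ζ ^ (-n) * besselJ n r

theorem norm_zpow_of_norm_one (hζ : ‖ζ‖ = 1) (n : ℤ) : ‖ζ ^ n‖ = 1 := by
  rw [norm_zpow, hζ, one_zpow]

theorem summable_grafSum (hζ : ‖ζ‖ = 1) (m : ℤ) {r : ℝ} (hr : |r| < R) :
    Summable fun n : ℤ => hankel2 (n + m) R * ζ ^ (-n) * besselJ n r := by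
  refine Summable.of_norm ((summable_norm_hankel2_mul_besselJ m hr).congr fun n => ?_)
  rw [norm_mul, norm_mul, norm_zpow_of_norm_one hζ, mul_one, Complex.norm_real, Real.norm_eq_abs]

theorem grafSum_zero (m : ℤ) : grafSum R ζ m 0 = hankel2 m R := by
  rw [grafSum, tsum_eq_single 0]
  · have : besselJ 0 0 = 1 := by
      have := besselJ_natCast 0 0
      simp only [Nat.cast_zero] at this
      rw [this, besselJNat_eq]
      simp [powerSum_zero, coeffJ]
    simp [this]
  · intro n hn
    have h := abs_besselJ_le n 0
    have hn' : n.natAbs ≠ 0 := by simpa using hn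
    simp [hn'] at h
    simp [h]

theorem hasDerivAt_grafSum (hζ : ‖ζ‖ = 1) (m : ℤ) {r : ℝ} (hr : |r| < R) :
    HasDerivAt (grafSum R ζ m)
      (-ζ / 2 * grafSum R ζ (m - 1) r + (starRingEnd ℂ) ζ / 2 * grafSum R ζ (m + 1) r) r := by
  have hζ0 : ζ ≠ 0 := by rw [← norm_pos_iff, hζ]; norm_num
  have hinv : (starRingEnd ℂ) ζ = ζ⁻¹ := by
    rw [Complex.inv_def, Complex.normSq_eq_norm_sq, hζ]; simp
  obtain ⟨r₀, hr1, hr2⟩ := exists_between hr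
  have hr0 : 0 < r₀ := (abs_nonneg r).trans_lt hr1
  set E := Real.exp ((r₀ / 2) ^ 2) with hE
  -- a summable bound for the derivatives of the terms on `(-r₀, r₀)`
  set g : ℤ → ℤ → ℝ := fun m n =>
    ‖hankel2 (n + m) R‖ * ((r₀ / 2) ^ n.natAbs / (n.natAbs.factorial : ℝ)) with hg
  have hgs : ∀ m, Summable (g m) := fun m => summable_hankel2_mul_pow m hr0.le hr2
  have hgm : Summable fun n : ℤ => g (m + 1) (n + -1) := (hgs (m + 1)).comp_add_int (-1)
  have hgp : Summable fun n : ℤ => g (m - 1) (n + 1) := (hgs (m - 1)).comp_add_int 1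
  have hu := (hgm.add hgp).mul_left E
  have hJ : ∀ (n : ℤ) (x : ℝ), x ∈ Set.Ioo (-r₀) r₀ →
      |besselJ n x| ≤ E * ((r₀ / 2) ^ n.natAbs / (n.natAbs.factorial : ℝ)) := by
    intro n x hx
    have hx' : |x / 2| ≤ r₀ / 2 := by
      rw [abs_div, abs_two]; gcongr; exact (abs_lt.2 hx).le
    refine (abs_besselJ_le n x).trans ?_
    rw [hE]
    gcongr ?_ * (?_ / _)
    · exact Real.exp_le_exp.2 (sq_le_sq' (by linarith [(abs_le.1 hx').1]) (abs_le.1 hx').2)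
    · gcongr
  have hd := hasDerivAt_tsum_of_isPreconnected (𝕜 := ℝ)
    (g := fun (n : ℤ) (x : ℝ) => hankel2 (n + m) R * ζ ^ (-n) * (besselJ n x : ℂ))
    (g' := fun n x => hankel2 (n + m) R * ζ ^ (-n)
      * (((besselJ (n - 1) x - besselJ (n + 1) x) / 2 : ℝ) : ℂ)) (t := Set.Ioo (-r₀) r₀)
    (y₀ := 0) (y := r) hu isOpen_Ioo isPreconnected_Ioo
    (fun n x _ => (hasDerivAt_besselJ n x).ofReal_comp.const_mul _) (fun n x hx => ?_)
    ⟨by linarith, hr0⟩ (summable_grafSum hζ m (by simpa using hr0.trans hr2)) (abs_lt.1 hr1)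
  · refine hd.congr_deriv ?_
    have s1 := summable_grafSum hζ (m + 1) hr
    have s2 := summable_grafSum hζ (m - 1) hr
    have s1' := s1.comp_add_int (-1)
    have s2' := s2.comp_add_int 1
    rw [grafSum, grafSum, ← tsum_comp_add_int (fun n : ℤ =>
      hankel2 (n + (m + 1)) R * ζ ^ (-n) * (besselJ n r : ℂ)) (-1),
      ← tsum_comp_add_int (fun n : ℤ =>
      hankel2 (n + (m - 1)) R * ζ ^ (-n) * (besselJ n r : ℂ)) 1]
    rw [← tsum_mul_left, ← tsum_mul_left, ← (s2'.mul_left _).tsum_add (s1'.mul_left _)]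
    refine tsum_congr fun n => ?_
    rw [show n + -1 + (m + 1) = n + m by ring, show n + 1 + (m - 1) = n + m by ring, hinv,
      show -(n + -1) = -n + 1 by ring, show -(n + 1) = -n - 1 by ring, zpow_add_one₀ hζ0,
      zpow_sub_one₀ hζ0, ← sub_eq_add_neg n 1]
    push_cast
    linear_combination (1 / 2 * hankel2 (n + m) R * ζ ^ (-n) * besselJ (n + 1) r)
      * (mul_inv_cancel₀ hζ0) + (-(1 / 2) * hankel2 (n + m) R * ζ ^ (-n) * besselJ (n - 1) r)
      * (mul_inv_cancel₀ hζ0)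
  · rw [norm_mul, norm_mul, norm_zpow_of_norm_one hζ, mul_one, Complex.norm_real, Real.norm_eq_abs]
    have h1 := hJ (n - 1) x hx
    have h2 := hJ (n + 1) x hx
    simp only [hg]
    rw [show n + -1 + (m + 1) = n + m by ring, ← sub_eq_add_neg n 1,
      show n + 1 + (m - 1) = n + m by ring, ← mul_add,
      mul_left_comm]
    gcongr
    rw [abs_div, abs_two, mul_add]
    have h3 := abs_sub (besselJ (n - 1) x) (besselJ (n + 1) x)
    have h4 := abs_nonneg (besselJ (n - 1) x)
    have h5 := abs_nonneg (besselJ (n + 1) x)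
    linarith

/-- `grafSum` is analytic in the small radius: it extends to a holomorphic function, as a locally
uniformly convergent double series of monomials. -/
theorem analyticAt_grafSum (hζ : ‖ζ‖ = 1) (m : ℤ) {r : ℝ} (hr : |r| < R) :
    AnalyticAt ℝ (grafSum R ζ m) r := by
  obtain ⟨r₀, hr1, hr2⟩ := exists_between hr
  have hr0 : 0 < r₀ := (abs_nonneg r).trans_lt hr1
  set sgn : ℤ → ℂ := fun n => if 0 ≤ n then 1 else (-1) ^ n.natAbs with hsgn
  have hsgn1 : ∀ n, ‖sgn n‖ = 1 := by
    intro n; simp only [hsgn]; split_ifs <;> simp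
  set F : ℤ × ℕ → ℂ → ℂ := fun p z =>
    hankel2 (p.1 + m) R * ζ ^ (-p.1) * (sgn p.1 * (coeffJ p.1.natAbs p.2 : ℂ)
      * ((z / 2) ^ (2 * p.2 + p.1.natAbs))) with hF
  have hu := Summable.mul_of_nonneg (summable_hankel2_mul_pow m hr0.le hr2)
    (Real.summable_pow_div_factorial ((r₀ / 2) ^ 2)) (fun _ => by positivity)
    (fun _ => by positivity)
  have hb : ∀ (p : ℤ × ℕ) (z : ℂ), z ∈ Metric.ball (0 : ℂ) r₀ → ‖F p z‖ ≤
      ‖hankel2 (p.1 + m) R‖ * ((r₀ / 2) ^ p.1.natAbs / (p.1.natAbs.factorial : ℝ))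
        * (((r₀ / 2) ^ 2) ^ p.2 / (p.2.factorial : ℝ)) := by
    intro p z hz
    have hz' : ‖z‖ / 2 ≤ r₀ / 2 := by
      have := (mem_ball_zero_iff.1 hz).le; gcongr
    simp only [hF]
    rw [norm_mul, norm_mul, norm_mul, norm_mul, norm_zpow_of_norm_one hζ, hsgn1, mul_one, one_mul,
      Complex.norm_real, Real.norm_eq_abs, norm_pow, norm_div, Complex.norm_ofNat, mul_assoc]
    refine mul_le_mul_of_nonneg_left ?_ (norm_nonneg _)
    calc _ ≤ 1 / (p.1.natAbs.factorial : ℝ) / (p.2.factorial : ℝ)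
          * (r₀ / 2) ^ (2 * p.2 + p.1.natAbs) := by
          gcongr
          exact abs_coeffJ_le _ _
      _ = _ := by rw [pow_add, pow_mul]; ring
  have hdiff : DifferentiableOn ℂ (fun z => ∑' p, F p z) (Metric.ball 0 r₀) :=
    Complex.differentiableOn_tsum_of_summable_norm hu (fun p => by
      simp only [hF]; fun_prop) Metric.isOpen_ball hb
  have hmem : (r : ℂ) ∈ Metric.ball (0 : ℂ) r₀ := by simpa using hr1
  have han : AnalyticAt ℝ (fun z : ℂ => ∑' p, F p z) (r : ℂ) :=
    (hdiff.analyticAt (Metric.isOpen_ball.mem_nhds hmem)).restrictScalars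
  have hcomp := AnalyticAt.fun_comp (f := fun x : ℝ => (x : ℂ)) han (Complex.ofRealCLM.analyticAt r)
  refine hcomp.congr ?_
  have hnhds : Set.Ioo (-r₀) r₀ ∈ 𝓝 r := isOpen_Ioo.mem_nhds (abs_lt.1 hr1)
  filter_upwards [hnhds] with x hx
  have hxm : (x : ℂ) ∈ Metric.ball (0 : ℂ) r₀ := by simpa using abs_lt.2 hx
  have hs : Summable fun p => F p x := Summable.of_norm_bounded hu fun p => hb p x hxm
  rw [hs.tsum_prod, grafSum]
  refine tsum_congr fun n => ?_
  simp only [hF]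
  rw [tsum_mul_left]
  congr 1
  have : (besselJ n x : ℂ) = sgn n * (besselJNat n.natAbs x : ℂ) := by
    simp only [hsgn, besselJ]
    split_ifs <;> push_cast <;> ring
  rw [this]
  simp_rw [mul_assoc]
  rw [tsum_mul_left, besselJNat, Complex.ofReal_tsum]
  congr 1
  refine tsum_congr fun k => ?_
  rw [coeffJ]; push_cast; ring

/-- **Graf's addition theorem**, for all orders: for `|r| < R` and `|ζ| = 1`, the wave of order `m`
at `R - r ζ` is the sum of its partial waves in `r` and `ζ`. Both sides are analytic in `r`, satisfy
the same ladder relations and agree at `r = 0`. -/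
theorem cylWave_eq_grafSum (hζ : ‖ζ‖ = 1) (m : ℤ) {r : ℝ} (hr : |r| < R) :
    cylWave m (R - r * ζ) = grafSum R ζ m r := by
  have hR : 0 < R := (abs_nonneg r).trans_lt hr
  have h := eqOn_zero_of_ladder hR
    (d := fun m r => cylWave m (R - r * ζ) - grafSum R ζ m r)
    (A := -ζ / 2) (B := (starRingEnd ℂ) ζ / 2)
    (fun m x hx => (analyticAt_cylWave hζ m (abs_lt.2 hx)).sub
      (analyticAt_grafSum hζ m (abs_lt.2 hx)))
    (fun m x hx => by
      refine ((hasDerivAt_cylWave hζ m (abs_lt.2 hx)).sub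
        (hasDerivAt_grafSum hζ m (abs_lt.2 hx))).congr_deriv ?_
      ring)
    (fun m => by
      have hR' : (R : ℂ) ≠ 0 := by exact_mod_cast hR.ne'
      simp [grafSum_zero, cylWave, abs_of_pos hR, div_self hR']) m (abs_lt.1 hr)
  exact sub_eq_zero.1 h

end Wave

/-! ### Fourier series of the kernels -/

/-- The Fourier mode `e^{i n θ}`. -/
noncomputable def fourierMode (n : ℤ) (θ : ℝ) : ℂ := Complex.exp (Complex.I * n * θ)

theorem norm_fourierMode (n : ℤ) (θ : ℝ) : ‖fourierMode n θ‖ = 1 := by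
  rw [fourierMode, show Complex.I * n * θ = ((n * θ : ℝ) : ℂ) * Complex.I by push_cast; ring]
  exact Complex.norm_exp_ofReal_mul_I _

theorem fourierMode_eq_zpow (n : ℤ) (θ : ℝ) : fourierMode n θ = fourierMode 1 θ ^ n := by
  rw [fourierMode, fourierMode, ← Complex.exp_int_mul]
  congr 1; push_cast; ring

theorem fourierMode_add (m n : ℤ) (θ : ℝ) :
    fourierMode (m + n) θ = fourierMode m θ * fourierMode n θ := by
  simp only [fourierMode, ← Complex.exp_add]
  congr 1; push_cast; ring

theorem fourierMode_sub_arg (n : ℤ) (θ φ : ℝ) :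
    fourierMode n (θ - φ) = fourierMode n θ * fourierMode (-n) φ := by
  simp only [fourierMode, ← Complex.exp_add]
  congr 1; push_cast; ring

theorem fourierMode_zero (θ : ℝ) : fourierMode 0 θ = 1 := by simp [fourierMode]

theorem fourierMode_one_re (θ : ℝ) : (fourierMode 1 θ).re = Real.cos θ := by
  rw [fourierMode, show Complex.I * (1 : ℤ) * θ = (θ : ℂ) * Complex.I by push_cast; ring,
    Complex.exp_ofReal_mul_I_re]

theorem fourierMode_one_inv_re (θ : ℝ) : ((fourierMode 1 θ)⁻¹).re = Real.cos θ := by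
  rw [Complex.inv_re, fourierMode_one_re, Complex.normSq_eq_norm_sq, norm_fourierMode]
  norm_num

theorem fourierMode_ne_zero (n : ℤ) (θ : ℝ) : fourierMode n θ ≠ 0 := Complex.exp_ne_zero _

theorem continuous_fourierMode (n : ℤ) : Continuous (fourierMode n) := by
  unfold fourierMode; fun_prop

theorem neg_one_pow_natAbs_mul_self (n : ℤ) : ((-1 : ℂ) ^ n.natAbs) * (-1) ^ n.natAbs = 1 := by
  rw [← mul_pow]; simp

theorem besselJ'_neg (n : ℤ) (x : ℝ) : besselJ' (-n) x = (-1) ^ n.natAbs * besselJ' n x := by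
  have h : besselJ (-n) = fun x => (-1) ^ n.natAbs * besselJ n x := funext (besselJ_neg n)
  rw [besselJ', besselJ', h, deriv_const_mul_field]

theorem hankel2'_neg (n : ℤ) (x : ℝ) : hankel2' (-n) x = (-1) ^ n.natAbs * hankel2' n x := by
  have h : hankel2 (-n) = fun x => (-1) ^ n.natAbs * hankel2 n x := funext (hankel2_neg n)
  rw [hankel2', hankel2', h, deriv_const_mul_field]

/-- The field `H_0(|R - r e^{iθ}|)` in powers of `e^{iθ}`. -/
theorem hasSum_hankel2_zero {r R : ℝ} (hr : 0 ≤ r) (hR : r < R) (θ : ℝ) :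
    HasSum (fun n : ℤ => (besselJ n r * hankel2 n R) * fourierMode n θ)
      (hankel2 0 (Real.sqrt (R ^ 2 + r ^ 2 - 2 * R * r * Real.cos θ))) := by
  have hζ : ‖(fourierMode 1 θ)⁻¹‖ = 1 := by rw [norm_inv, norm_fourierMode, inv_one]
  have hr' : |r| < R := by rwa [abs_of_nonneg hr]
  have h := (summable_grafSum hζ 0 hr').hasSum
  have e := cylWave_eq_grafSum hζ 0 hr'
  rw [grafSum] at e
  rw [← e, cylWave, norm_sub_mul_eq hζ, fourierMode_one_inv_re, zpow_zero, mul_one] at h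
  refine h.congr_fun fun n => ?_
  rw [fourierMode_eq_zpow n, inv_zpow', neg_neg, add_zero]; ring

theorem cylWave_one_sub (z : ℂ) :
    cylWave 1 z - cylWave (-1) z = 2 * (((z.re / ‖z‖ : ℝ) : ℂ) * hankel2 1 ‖z‖) := by
  have h1 : hankel2 (-1) ‖z‖ = -hankel2 1 ‖z‖ := by simpa using hankel2_neg 1 ‖z‖
  have hz : ((z / ‖z‖) : ℂ)⁻¹ = (starRingEnd ℂ) z / ‖z‖ := by
    by_cases h : z = 0
    · simp [h]
    · have : (‖z‖ : ℂ) ≠ 0 := by exact_mod_cast norm_ne_zero_iff.2 h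
      rw [inv_div, div_eq_div_iff h this, mul_comm ((starRingEnd ℂ) z), Complex.mul_conj,
        Complex.normSq_eq_norm_sq]
      push_cast; ring
  rw [cylWave, cylWave, h1, zpow_neg, zpow_one, hz]
  have := Complex.add_conj z
  push_cast at this ⊢
  linear_combination (hankel2 1 ‖z‖ / ‖z‖) * this

/-- Minus the derivative with respect to `R` of the expansion of `H_0(|R - r e^{iθ}|)`. -/
theorem hasSum_hankel2_one_outer {r R : ℝ} (hr : 0 ≤ r) (hR : r < R) (θ : ℝ) :
    HasSum (fun n : ℤ => (-(besselJ n r * hankel2' n R)) * fourierMode n θ)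
      ((((R - r * Real.cos θ) / Real.sqrt (R ^ 2 + r ^ 2 - 2 * R * r * Real.cos θ) : ℝ) : ℂ)
        * hankel2 1 (Real.sqrt (R ^ 2 + r ^ 2 - 2 * R * r * Real.cos θ))) := by
  have hζ : ‖(fourierMode 1 θ)⁻¹‖ = 1 := by rw [norm_inv, norm_fourierMode, inv_one]
  have hr' : |r| < R := by rwa [abs_of_nonneg hr]
  have h1 := (summable_grafSum hζ 1 hr').hasSum
  have h2 := (summable_grafSum hζ (-1) hr').hasSum
  have e1 := cylWave_eq_grafSum hζ 1 hr'
  have e2 := cylWave_eq_grafSum hζ (-1) hr'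
  rw [grafSum] at e1 e2
  rw [← e1] at h1
  rw [← e2] at h2
  have h := (h1.sub h2).mul_left (1 / 2 : ℂ)
  rw [cylWave_one_sub, norm_sub_mul_eq hζ, fourierMode_one_inv_re] at h
  have ere : ((R : ℂ) - r * (fourierMode 1 θ)⁻¹).re = R - r * Real.cos θ := by
    simp [fourierMode_one_inv_re, -Complex.inv_re]
  rw [ere, ← mul_assoc, one_div_mul_cancel (two_ne_zero' ℂ), one_mul] at h
  refine h.congr_fun fun n => ?_
  rw [hankel2'_eq n (hr.trans_lt hR), fourierMode_eq_zpow n, inv_zpow', neg_neg, ← sub_eq_add_neg]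
  ring

/-- Minus the derivative with respect to `r` of the expansion of `H_0(|r - R e^{iθ}|)`. -/
theorem hasSum_hankel2_one_inner {r R : ℝ} (hr : 0 ≤ r) (hR : r < R) (θ : ℝ) :
    HasSum (fun n : ℤ => (-(besselJ' n r * hankel2 n R)) * fourierMode n θ)
      ((((r - R * Real.cos θ) / Real.sqrt (r ^ 2 + R ^ 2 - 2 * r * R * Real.cos θ) : ℝ) : ℂ)
        * hankel2 1 (Real.sqrt (r ^ 2 + R ^ 2 - 2 * r * R * Real.cos θ))) := by
  set ζ := fourierMode 1 θ with hζdef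
  have hζ1 : ‖ζ‖ = 1 := norm_fourierMode 1 θ
  have hζ0 : ζ ≠ 0 := fourierMode_ne_zero 1 θ
  have hζ : ‖ζ⁻¹‖ = 1 := by rw [norm_inv, hζ1, inv_one]
  have hr' : |r| < R := by rwa [abs_of_nonneg hr]
  have hfac : (r : ℂ) - R * ζ = -ζ * (R - r * ζ⁻¹) := by
    field_simp; ring
  have rot : ∀ m : ℤ, cylWave m (-ζ * (R - r * ζ⁻¹)) = (-ζ) ^ m * cylWave m (R - r * ζ⁻¹) := by
    intro m
    rw [cylWave, cylWave, norm_mul, norm_neg, hζ1, one_mul, mul_div_assoc, mul_zpow]; ring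
  -- multiplying by the unit factor shifts the orders back by one
  have h1 := ((summable_grafSum hζ 1 hr').hasSum).mul_left (-ζ)
  have h2 := ((summable_grafSum hζ (-1) hr').hasSum).mul_left ((-ζ)⁻¹)
  have e1 := cylWave_eq_grafSum hζ 1 hr'
  have e2 := cylWave_eq_grafSum hζ (-1) hr'
  rw [grafSum] at e1 e2
  have r1 := rot 1
  have r2 := rot (-1)
  rw [zpow_one] at r1
  rw [zpow_neg, zpow_one] at r2
  rw [← e1, ← r1, ← hfac] at h1
  rw [← e2, ← r2, ← hfac] at h2
  have s1 := (Equiv.addRight (-1 : ℤ)).hasSum_iff.2 h1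
  have s2 := (Equiv.addRight (1 : ℤ)).hasSum_iff.2 h2
  have h := (s1.sub s2).mul_left (1 / 2 : ℂ)
  have enorm : ‖(r : ℂ) - R * ζ‖ = Real.sqrt (r ^ 2 + R ^ 2 - 2 * r * R * Real.cos θ) := by
    rw [norm_sub_mul_eq hζ1, hζdef, fourierMode_one_re]
  have ere : ((r : ℂ) - R * ζ).re = r - R * Real.cos θ := by
    simp [hζdef, fourierMode_one_re]
  rw [cylWave_one_sub, enorm, ere, ← mul_assoc, one_div_mul_cancel (two_ne_zero' ℂ), one_mul] at h
  refine h.congr_fun fun n => ?_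
  simp only [Function.comp, Equiv.coe_addRight]
  rw [besselJ'_eq, fourierMode_eq_zpow n, inv_zpow', inv_zpow', neg_neg, neg_neg, ← hζdef,
    show n + -1 + 1 = n by ring, show n + 1 + -1 = n by ring, zpow_add_one₀ hζ0,
    ← sub_eq_add_neg n 1, zpow_sub_one₀ hζ0]
  push_cast
  field_simp
  ring

/-- Fourier coefficients of the electric kernel: source radius `a`, observation radius `ρ`. -/
noncomputable def coefE (k a ρ : ℝ) (n : ℤ) : ℂ :=
  if ρ < a then besselJ n (k * ρ) * hankel2 n (k * a) else besselJ n (k * a) * hankel2 n (k * ρ)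

/-- Fourier coefficients of the magnetic kernel: source radius `a`, observation radius `ρ`. -/
noncomputable def coefM (k a ρ : ℝ) (n : ℤ) : ℂ :=
  if ρ < a then -(besselJ n (k * ρ) * hankel2' n (k * a))
  else -(besselJ' n (k * a) * hankel2 n (k * ρ))

theorem coefE_neg (k a ρ : ℝ) (n : ℤ) : coefE k a ρ (-n) = coefE k a ρ n := by
  simp only [coefE, besselJ_neg, hankel2_neg]
  have := neg_one_pow_natAbs_mul_self n
  split_ifs
  · push_cast; linear_combination (besselJ n (k * ρ) * hankel2 n (k * a)) * this
  · push_cast; linear_combination (besselJ n (k * a) * hankel2 n (k * ρ)) * this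

theorem coefM_neg (k a ρ : ℝ) (n : ℤ) : coefM k a ρ (-n) = coefM k a ρ n := by
  simp only [coefM, besselJ_neg, hankel2_neg, besselJ'_neg, hankel2'_neg]
  have := neg_one_pow_natAbs_mul_self n
  split_ifs
  · push_cast; linear_combination (-besselJ n (k * ρ) * hankel2' n (k * a)) * this
  · push_cast; linear_combination (-besselJ' n (k * a) * hankel2 n (k * ρ)) * this

theorem mul_polarDist {k : ℝ} (hk : 0 < k) (a b θ : ℝ) :
    k * Cylinder.polarDist a b θ
      = Real.sqrt ((k * a) ^ 2 + (k * b) ^ 2 - 2 * (k * a) * (k * b) * Real.cos θ) := by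
  rw [Cylinder.polarDist, show (k * a) ^ 2 + (k * b) ^ 2 - 2 * (k * a) * (k * b) * Real.cos θ
    = k ^ 2 * (a ^ 2 + b ^ 2 - 2 * a * b * Real.cos θ) by ring, Real.sqrt_mul (sq_nonneg k),
    Real.sqrt_sq hk.le]

theorem polarDist_comm (a b θ : ℝ) : Cylinder.polarDist a b θ = Cylinder.polarDist b a θ := by
  rw [Cylinder.polarDist, Cylinder.polarDist]; congr 1; ring

theorem hasSum_hankel2_polarDist {k : ℝ} (hk : 0 < k) {a ρ : ℝ} (ha : 0 ≤ a) (hρ : 0 ≤ ρ)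
    (hne : ρ ≠ a) (θ : ℝ) :
    HasSum (fun n : ℤ => coefE k a ρ n * fourierMode n θ)
      (hankel2 0 (k * Cylinder.polarDist a ρ θ)) := by
  rcases hne.lt_or_gt with h | h
  · simp only [coefE, if_pos h]
    rw [mul_polarDist hk]
    exact hasSum_hankel2_zero (by positivity) (by gcongr) θ
  · simp only [coefE, if_neg h.not_gt]
    rw [polarDist_comm, mul_polarDist hk]
    exact hasSum_hankel2_zero (by positivity) (by gcongr) θ

theorem summable_coefE {k : ℝ} (hk : 0 < k) {a ρ : ℝ} (ha : 0 ≤ a) (hρ : 0 ≤ ρ) (hne : ρ ≠ a) :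
    Summable (coefE k a ρ) := by
  simpa [fourierMode] using (hasSum_hankel2_polarDist hk ha hρ hne 0).summable

namespace Cylinder

variable (S : Cylinder)

theorem k_pos (j : Region) : 0 < S.k j :=
  mul_pos S.ω_pos (Real.sqrt_pos.2 (mul_pos (S.ε_pos j) (S.μ_pos j)))

theorem Z_pos (j : Region) : 0 < S.Z j := Real.sqrt_pos.2 (div_pos (S.μ_pos j) (S.ε_pos j))

theorem ρcyl_pos : 0 < S.ρcyl := S.ρaux₁_pos.trans S.ρaux₁_lt

theorem hasSum_kerE (j : Region) {ρ : ℝ} (hρ : 0 ≤ ρ) (hne : ρ ≠ S.ρcyl) (θ : ℝ) :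
    HasSum (fun n : ℤ => coefE (S.k j) S.ρcyl ρ n * fourierMode n θ) (S.kerE j ρ θ) :=
  hasSum_hankel2_polarDist (S.k_pos j) S.ρcyl_pos.le hρ hne θ

theorem hasSum_kerM (j : Region) {ρ : ℝ} (hρ : 0 ≤ ρ) (hne : ρ ≠ S.ρcyl) (θ : ℝ) :
    HasSum (fun n : ℤ => coefM (S.k j) S.ρcyl ρ n * fourierMode n θ) (S.kerM j ρ θ) := by
  have hk := S.k_pos j
  have ha := S.ρcyl_pos
  have e : (S.ρcyl - ρ * Real.cos θ) / polarDist S.ρcyl ρ θ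
      = (S.k j * S.ρcyl - S.k j * ρ * Real.cos θ) / (S.k j * polarDist S.ρcyl ρ θ) := by
    rw [mul_assoc, ← mul_sub, mul_div_mul_left _ _ hk.ne']
  rw [kerM, e, mul_polarDist hk]
  rcases hne.lt_or_gt with h | h
  · simp only [coefM, if_pos h]
    exact hasSum_hankel2_one_outer (by positivity) (by gcongr) θ
  · simp only [coefM, if_neg h.not_gt]
    exact hasSum_hankel2_one_inner (by positivity) (by gcongr) θ

theorem summable_coefM (j : Region) {ρ : ℝ} (hρ : 0 ≤ ρ) (hne : ρ ≠ S.ρcyl) :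
    Summable (coefM (S.k j) S.ρcyl ρ) := by
  simpa [fourierMode] using (S.hasSum_kerM j hρ hne 0).summable

end Cylinder

/-! ### Sampling of Fourier series -/

open Cylinder in
theorem fourierMode_angle_eq_one_iff {N : ℕ} (hN : 0 < N) (n : ℤ) :
    fourierMode n (angle N 1) = 1 ↔ (N : ℤ) ∣ n := by
  have hN' : (N : ℂ) ≠ 0 := by exact_mod_cast hN.ne'
  rw [fourierMode, Complex.exp_eq_one_iff, angle]
  have h2 : (2 * Real.pi * Complex.I : ℂ) ≠ 0 := Complex.two_pi_I_ne_zero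
  constructor
  · rintro ⟨k, hk⟩
    refine ⟨k, ?_⟩
    have : (n : ℂ) = N * k := by
      apply mul_left_cancel₀ h2
      push_cast at hk
      field_simp at hk
      linear_combination hk * (2 * Real.pi * Complex.I)
    exact_mod_cast this
  · rintro ⟨k, rfl⟩
    refine ⟨k, ?_⟩
    push_cast
    field_simp

open Cylinder in
theorem fourierMode_angle (N : ℕ) (n p : ℤ) :
    fourierMode n (angle N p) = fourierMode n (angle N 1) ^ p := by
  rw [fourierMode, fourierMode, ← Complex.exp_int_mul]
  congr 1
  simp only [angle]; push_cast; ring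

open Cylinder in
theorem fourierMode_angle_comm (N : ℕ) (n p : ℤ) :
    fourierMode n (angle N p) = fourierMode p (angle N n) := by
  simp only [fourierMode, angle]
  congr 1
  push_cast; ring

/-- Orthogonality of the sampled modes. -/
theorem sum_fourierMode_angle {N : ℕ} (hN : 0 < N) (n : ℤ) :
    ∑ l : Fin N, fourierMode n (Cylinder.angle N (l : ℕ))
      = if (N : ℤ) ∣ n then (N : ℂ) else 0 := by
  have h1 : ∀ l : Fin N, fourierMode n (Cylinder.angle N (l : ℕ))
      = fourierMode n (Cylinder.angle N 1) ^ (l : ℕ) := by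
    intro l
    have := fourierMode_angle N n (l : ℕ)
    rw [zpow_natCast] at this
    exact this
  simp_rw [h1]
  rw [Fin.sum_univ_eq_sum_range (fun l => fourierMode n (Cylinder.angle N 1) ^ l)]
  split_ifs with h
  · rw [(fourierMode_angle_eq_one_iff hN n).2 h]; simp
  · have hne : fourierMode n (Cylinder.angle N 1) ≠ 1 :=
      fun h' => h ((fourierMode_angle_eq_one_iff hN n).1 h')
    rw [geom_sum_eq hne]
    have hN' : (N : ℂ) ≠ 0 := by exact_mod_cast hN.ne'
    have : fourierMode n (Cylinder.angle N 1) ^ N = 1 := by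
      rw [← zpow_natCast, ← fourierMode_angle, fourierMode, Complex.exp_eq_one_iff]
      refine ⟨n, ?_⟩
      rw [Cylinder.angle]; push_cast; field_simp
    rw [this]; simp

theorem fourierMode_angle_congr {N : ℕ} (hN : 0 < N) (p : ℤ) {m n : ℤ} (h : (N : ℤ) ∣ m - n) :
    fourierMode m (Cylinder.angle N p) = fourierMode n (Cylinder.angle N p) := by
  have : m = (m - n) + n := by ring
  rw [this, fourierMode_add, fourierMode_angle N (m - n), (fourierMode_angle_eq_one_iff hN _).2 h,
    one_zpow, one_mul]

theorem sum_range_add_of_periodic {F : ℤ → ℂ} {N : ℕ} (hF : ∀ n, F (n + N) = F n) (a : ℤ) :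
    ∑ i ∈ Finset.range N, F (a + i) = ∑ i ∈ Finset.range N, F i := by
  have step : ∀ a : ℤ, ∑ i ∈ Finset.range N, F (a + 1 + i) = ∑ i ∈ Finset.range N, F (a + i) := by
    intro a
    have h1 := Finset.sum_range_succ' (fun i : ℕ => F (a + i)) N
    have h2 := Finset.sum_range_succ (fun i : ℕ => F (a + i)) N
    rw [h1] at h2
    simp only [Nat.cast_zero, add_zero, hF] at h2
    have h3 := add_right_cancel h2
    rw [← h3]
    refine Finset.sum_congr rfl fun i _ => ?_
    congr 1; push_cast; ring
  induction a using Int.induction_on with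
  | zero => simp
  | succ k ih => rw [step, ih]
  | pred k ih => rw [← ih, ← step]; simp

/-- The window `-⌊N/2⌋ ≤ n < N - ⌊N/2⌋` of orders of least modulus. -/
noncomputable def centralWindow (N : ℕ) : Finset ℤ :=
  Finset.Ico (-((N / 2 : ℕ) : ℤ)) (-((N / 2 : ℕ) : ℤ) + N)

theorem two_mul_natAbs_le_of_mem {N : ℕ} {n : ℤ} (h : n ∈ centralWindow N) :
    2 * n.natAbs ≤ N := by
  rw [centralWindow, Finset.mem_Ico] at h
  omega

theorem mem_centralWindow {N : ℕ} {n : ℤ} (h : 2 * n.natAbs < N) : n ∈ centralWindow N := by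
  rw [centralWindow, Finset.mem_Ico]
  omega

theorem sum_fin_eq_sum_centralWindow {F : ℤ → ℂ} {N : ℕ} (hF : ∀ n, F (n + N) = F n) :
    ∑ m : Fin N, F (m : ℕ) = ∑ n ∈ centralWindow N, F n := by
  rw [Fin.sum_univ_eq_sum_range (fun i : ℕ => F i),
    ← sum_range_add_of_periodic hF (-((N / 2 : ℕ) : ℤ))]
  refine Finset.sum_bij (fun i _ => -((N / 2 : ℕ) : ℤ) + i) (fun i hi => ?_) (fun i _ j _ h => ?_)
    (fun n hn => ?_) (fun _ _ => rfl)
  · rw [centralWindow, Finset.mem_Ico]; rw [Finset.mem_range] at hi; omega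
  · omega
  · rw [centralWindow, Finset.mem_Ico] at hn
    exact ⟨(n + (N / 2 : ℕ)).toNat, by rw [Finset.mem_range]; omega, by omega⟩

open Classical in
/-- Sum of the coefficients `c k` over the residue class of `n` modulo `N`: by aliasing, the
discrete Fourier coefficient of the sampled series. -/
noncomputable def aliasSum (N : ℕ) (c : ℤ → ℂ) (n : ℤ) : ℂ :=
  ∑' k : ℤ, if (N : ℤ) ∣ k - n then c k else 0

theorem aliasSum_add_period (N : ℕ) (c : ℤ → ℂ) (n : ℤ) :
    aliasSum N c (n + N) = aliasSum N c n := by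
  rw [aliasSum, aliasSum]
  refine tsum_congr fun k => ?_
  have : (N : ℤ) ∣ k - (n + N) ↔ (N : ℤ) ∣ k - n := by
    rw [← sub_sub]; exact dvd_sub_self_right
  simp only [this]

theorem norm_ite_le (p : Prop) [Decidable p] (z : ℂ) : ‖if p then z else 0‖ ≤ ‖z‖ := by
  split_ifs <;> simp

/-- A fixed integer is divisible by arbitrarily large `N` only if it is zero. -/
theorem eventually_dvd_iff (d : ℤ) : ∀ᶠ N : ℕ in atTop, ((N : ℤ) ∣ d ↔ d = 0) := by
  filter_upwards [eventually_gt_atTop d.natAbs] with N hN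
  refine ⟨fun h => ?_, fun h => h ▸ dvd_zero _⟩
  exact Int.eq_zero_of_abs_lt_dvd h (by rw [Int.abs_eq_natAbs]; exact_mod_cast hN)

theorem tendsto_tsum_ite_dvd {ι : Type*} {v : ι → ℂ} (hv : Summable v) (d : ι → ℤ) :
    Tendsto (fun N : ℕ => ∑' i, if (N : ℤ) ∣ d i then v i else 0) atTop
      (𝓝 (∑' i, if d i = 0 then v i else 0)) := by
  refine tendsto_tsum_of_dominated_convergence hv.norm (fun i => ?_)
    (Eventually.of_forall fun N i => norm_ite_le _ _)
  refine tendsto_const_nhds.congr' ?_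
  filter_upwards [eventually_dvd_iff (d i)] with N hN
  simp only [hN]

/-- The aliasing terms of a fixed order disappear as `N → ∞`. -/
theorem tendsto_aliasSum {c : ℤ → ℂ} (hc : Summable c) (n : ℤ) :
    Tendsto (fun N : ℕ => aliasSum N c n) atTop (𝓝 (c n)) := by
  classical
  have h := tendsto_tsum_ite_dvd hc (fun k => k - n)
  have e : ∑' i, (if i - n = 0 then c i else 0) = c n := by
    simp_rw [sub_eq_zero]
    exact tsum_ite_eq n c
  rw [e] at h
  refine h.congr fun N => ?_
  rw [aliasSum]

theorem mean_tsum_fourierMode {ι : Type*} {v : ι → ℂ} (hv : Summable v) (d : ι → ℤ) {N : ℕ}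
    (hN : 0 < N) :
    1 / (N : ℂ) * ∑ l : Fin N, ∑' i, v i * fourierMode (d i) (Cylinder.angle N (l : ℕ))
      = ∑' i, if (N : ℤ) ∣ d i then v i else 0 := by
  have hN' : (N : ℂ) ≠ 0 := by exact_mod_cast hN.ne'
  have hs : ∀ θ : ℝ, Summable fun i => v i * fourierMode (d i) θ := fun θ =>
    Summable.of_norm (hv.norm.congr fun i => by rw [norm_mul, norm_fourierMode, mul_one])
  rw [← Summable.tsum_finsetSum fun l _ => hs _, ← tsum_mul_left]
  refine tsum_congr fun i => ?_
  rw [← Finset.mul_sum, sum_fourierMode_angle hN]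
  split_ifs
  · field_simp
  · simp

/-- Aliasing: the discrete Fourier transform of the samples of an absolutely convergent series. -/
theorem dft_eq_aliasSum {f : ℝ → ℂ} {c : ℤ → ℂ} (hc : Summable c)
    (hf : ∀ θ, HasSum (fun n => c n * fourierMode n θ) (f θ)) {N : ℕ} (hN : 0 < N) (m : Fin N) :
    Cylinder.dft N f m = aliasSum N c (m : ℕ) := by
  have h := mean_tsum_fourierMode hc (fun k => k - (m : ℕ)) hN
  rw [Cylinder.dft, aliasSum]
  refine Eq.trans ?_ (h.trans (tsum_congr fun k => by congr))
  congr 1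
  refine Finset.sum_congr rfl fun p _ => ?_
  rw [← (hf _).tsum_eq, ← tsum_mul_right]
  refine tsum_congr fun k => ?_
  rw [sub_eq_add_neg, fourierMode_add, ← mul_assoc]
  congr 1
  simp only [fourierMode, Cylinder.angle]
  congr 1
  push_cast; ring

theorem integral_fourierMode (n : ℤ) :
    ∫ θ in (-Real.pi)..Real.pi, fourierMode n θ = if n = 0 then (2 * Real.pi : ℂ) else 0 := by
  split_ifs with h
  · subst h
    simp [fourierMode_zero]; ring
  · have hn : (Complex.I * n : ℂ) ≠ 0 := mul_ne_zero Complex.I_ne_zero (by exact_mod_cast h)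
    simp only [fourierMode]
    rw [integral_exp_mul_complex hn, div_eq_zero_iff]
    left
    rw [sub_eq_zero, Complex.exp_eq_exp_iff_exists_int]
    refine ⟨n, ?_⟩
    push_cast; ring

theorem integral_tsum_fourierMode {ι : Type*} [Countable ι] {v : ι → ℂ} (hv : Summable v)
    (d : ι → ℤ) :
    ∫ θ in (-Real.pi)..Real.pi, ∑' i, v i * fourierMode (d i) θ
      = 2 * Real.pi * ∑' i, if d i = 0 then v i else 0 := by
  have h := intervalIntegral.hasSum_integral_of_dominated_convergence (μ := MeasureTheory.volume)
    (a := -Real.pi) (b := Real.pi) (F := fun i θ => v i * fourierMode (d i) θ)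
    (f := fun θ => ∑' i, v i * fourierMode (d i) θ) (fun i _ => ‖v i‖)
    (fun i => (continuous_const.mul (continuous_fourierMode (d i))).aestronglyMeasurable)
    (fun i => Eventually.of_forall fun θ _ => by rw [norm_mul, norm_fourierMode, mul_one])
    (Eventually.of_forall fun θ _ => hv.norm) (by simp)
    (Eventually.of_forall fun θ _ => Summable.hasSum (Summable.of_norm
      (hv.norm.congr fun i => by rw [norm_mul, norm_fourierMode, mul_one])))
  rw [← h.tsum_eq, ← tsum_mul_left]
  refine tsum_congr fun i => ?_
  rw [intervalIntegral.integral_const_mul, integral_fourierMode]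
  split_ifs <;> ring

section Convolution

variable {f g : ℝ → ℂ} {a c : ℤ → ℂ}

/-- The product `f(θ) g(θ - φ)` as a double Fourier series. -/
theorem mul_eq_tsum_fourierMode (ha : Summable a) (hc : Summable c)
    (hf : ∀ θ, HasSum (fun n => a n * fourierMode n θ) (f θ))
    (hg : ∀ θ, HasSum (fun n => c n * fourierMode n θ) (g θ)) (θ φ : ℝ) :
    f θ * g (θ - φ) = ∑' p : ℤ × ℤ,
      (a p.1 * c p.2 * fourierMode (-p.2) φ) * fourierMode (p.1 + p.2) θ := by
  have n1 : Summable fun n => ‖a n * fourierMode n θ‖ :=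
    ha.norm.congr fun n => by rw [norm_mul, norm_fourierMode, mul_one]
  have n2 : Summable fun n => ‖c n * fourierMode n (θ - φ)‖ :=
    hc.norm.congr fun n => by rw [norm_mul, norm_fourierMode, mul_one]
  rw [← (hf θ).tsum_eq, ← (hg (θ - φ)).tsum_eq, tsum_mul_tsum_of_summable_norm n1 n2]
  refine tsum_congr fun p => ?_
  rw [fourierMode_sub_arg, fourierMode_add]; ring

theorem summable_double (ha : Summable a) (hc : Summable c) (φ : ℝ) :
    Summable fun p : ℤ × ℤ => a p.1 * c p.2 * fourierMode (-p.2) φ :=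
  Summable.of_norm ((summable_mul_of_summable_norm ha.norm hc.norm).norm.congr fun p => by
    rw [norm_mul _ (fourierMode _ _), norm_fourierMode, mul_one])

theorem tsum_antidiagonal (ha : Summable a) (hc : Summable c) (φ : ℝ) :
    (∑' p : ℤ × ℤ, if p.1 + p.2 = 0 then a p.1 * c p.2 * fourierMode (-p.2) φ else 0)
      = ∑' n : ℤ, a n * c (-n) * fourierMode n φ := by
  have hs := summable_double ha hc φ
  have hs' : Summable fun p : ℤ × ℤ =>
      if p.1 + p.2 = 0 then a p.1 * c p.2 * fourierMode (-p.2) φ else 0 :=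
    Summable.of_norm (Summable.of_nonneg_of_le (fun p => norm_nonneg _)
      (fun p => norm_ite_le _ _) hs.norm)
  rw [hs'.tsum_prod]
  refine tsum_congr fun n => ?_
  rw [tsum_eq_single (-n)]
  · simp
  · intro k hk
    rw [if_neg]
    intro h; exact hk (by simpa using (eq_neg_of_add_eq_zero_right h))

/-- Parseval's formula for the convolution of a density with a kernel. -/
theorem integral_convolution (ha : Summable a) (hc : Summable c)
    (hf : ∀ θ, HasSum (fun n => a n * fourierMode n θ) (f θ))
    (hg : ∀ θ, HasSum (fun n => c n * fourierMode n θ) (g θ)) (φ : ℝ) :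
    ∫ θ in (-Real.pi)..Real.pi, f θ * g (θ - φ)
      = 2 * Real.pi * ∑' n : ℤ, a n * c (-n) * fourierMode n φ := by
  simp_rw [mul_eq_tsum_fourierMode ha hc hf hg]
  rw [integral_tsum_fourierMode (summable_double ha hc φ), tsum_antidiagonal ha hc]

/-- Riemann sums of the convolution integral converge. -/
theorem tendsto_mean_convolution (ha : Summable a) (hc : Summable c)
    (hf : ∀ θ, HasSum (fun n => a n * fourierMode n θ) (f θ))
    (hg : ∀ θ, HasSum (fun n => c n * fourierMode n θ) (g θ)) (φ : ℝ) :
    Tendsto (fun N : ℕ => 1 / (N : ℂ) * ∑ l : Fin N,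
        f (Cylinder.angle N (l : ℕ)) * g (Cylinder.angle N (l : ℕ) - φ)) atTop
      (𝓝 (∑' n : ℤ, a n * c (-n) * fourierMode n φ)) := by
  have h := tendsto_tsum_ite_dvd (summable_double ha hc φ) (fun p => p.1 + p.2)
  rw [tsum_antidiagonal ha hc] at h
  refine h.congr' ?_
  filter_upwards [eventually_gt_atTop 0] with N hN
  rw [← mean_tsum_fourierMode (summable_double ha hc φ) _ hN]
  congr 1
  exact Finset.sum_congr rfl fun l _ => (mul_eq_tsum_fourierMode ha hc hf hg _ _).symm

end Convolution

theorem norm_le_tsum_of_hasSum {f : ℝ → ℂ} {c : ℤ → ℂ} (hc : Summable c)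
    (hf : ∀ θ, HasSum (fun n => c n * fourierMode n θ) (f θ)) (θ : ℝ) :
    ‖f θ‖ ≤ ∑' n, ‖c n‖ := by
  have h : Summable fun n => ‖c n * fourierMode n θ‖ :=
    hc.norm.congr fun n => by rw [norm_mul, norm_fourierMode, mul_one]
  rw [← (hf θ).tsum_eq]
  refine (norm_tsum_le_tsum_norm h).trans (le_of_eq (tsum_congr fun n => ?_))
  rw [norm_mul, norm_fourierMode, mul_one]

/-- Trigonometric polynomials with `N`-periodic coefficients converge uniformly at the sample
points if the coefficients of least order converge dominatedly. -/
theorem tendsto_sum_fourierMode_uniform {F : ℕ → ℤ → ℂ} {L : ℤ → ℂ} {b : ℤ → ℝ}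
    (hper : ∀ N n, F N (n + N) = F N n) (hlim : ∀ n, Tendsto (fun N => F N n) atTop (𝓝 (L n)))
    (hb : Summable b) (hbound : ∀ᶠ N : ℕ in atTop, ∀ n : ℤ, 2 * n.natAbs ≤ N → ‖F N n‖ ≤ b n) :
    (∀ n, ‖L n‖ ≤ b n) ∧ ∀ δ : ℝ, 0 < δ → ∀ᶠ N : ℕ in atTop, ∀ l : Fin N,
      ‖∑ m : Fin N, F N (m : ℕ) * fourierMode (m : ℕ) (Cylinder.angle N (l : ℕ))
        - ∑' n, L n * fourierMode n (Cylinder.angle N (l : ℕ))‖ < δ := by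
  classical
  have hL : ∀ n, ‖L n‖ ≤ b n := by
    intro n
    refine le_of_tendsto (hlim n).norm ?_
    filter_upwards [hbound, eventually_ge_atTop (2 * n.natAbs)] with N h1 h2 using h1 n h2
  refine ⟨hL, ?_⟩
  have hLs : Summable L := Summable.of_norm_bounded hb hL
  have hb0 : ∀ n, 0 ≤ b n := fun n => (norm_nonneg _).trans (hL n)
  have hT : Tendsto (fun N : ℕ => ∑' n, ‖(if n ∈ centralWindow N then F N n else 0) - L n‖) atTop
      (𝓝 (∑' _ : ℤ, (0 : ℝ))) := by
    refine tendsto_tsum_of_dominated_convergence (bound := fun n => b n + b n) (hb.add hb)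
      (fun n => ?_) ?_
    · rw [← tendsto_iff_norm_sub_tendsto_zero]
      refine (hlim n).congr' ?_
      filter_upwards [eventually_gt_atTop (2 * n.natAbs)] with N hN
      rw [if_pos (mem_centralWindow hN)]
    · filter_upwards [hbound] with N hN n
      rw [norm_norm]
      refine (norm_sub_le _ _).trans (add_le_add ?_ (hL n))
      split_ifs with h
      · exact hN n (two_mul_natAbs_le_of_mem h)
      · simpa using hb0 n
  rw [tsum_zero] at hT
  intro δ hδ
  filter_upwards [hT.eventually_lt_const hδ, hbound, eventually_gt_atTop 0] with N h1 h2 hN l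
  refine lt_of_le_of_lt ?_ h1
  set θ := Cylinder.angle N (l : ℕ) with hθ
  have hp : ∀ n : ℤ, F N (n + N) * fourierMode (n + N) θ = F N n * fourierMode n θ := by
    intro n
    rw [hper, hθ, fourierMode_angle_congr hN (l : ℕ) (m := n + N) (n := n) (by simp)]
  have e1 := sum_fin_eq_sum_centralWindow (F := fun n => F N n * fourierMode n θ) hp
  have e2 : ∑ n ∈ centralWindow N, F N n * fourierMode n θ
      = ∑' n, (if n ∈ centralWindow N then F N n else 0) * fourierMode n θ := by
    rw [tsum_eq_sum (s := centralWindow N) (fun n hn => by rw [if_neg hn, zero_mul])]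
    exact Finset.sum_congr rfl fun n hn => by rw [if_pos hn]
  have hs1 : Summable fun n => (if n ∈ centralWindow N then F N n else 0) * fourierMode n θ :=
    summable_of_ne_finset_zero (s := centralWindow N) fun n hn => by rw [if_neg hn, zero_mul]
  have hs2 : Summable fun n => L n * fourierMode n θ :=
    Summable.of_norm (hLs.norm.congr fun i => by rw [norm_mul, norm_fourierMode, mul_one])
  have e3 : ∀ n, ‖(if n ∈ centralWindow N then F N n else 0) * fourierMode n θ
      - L n * fourierMode n θ‖ = ‖(if n ∈ centralWindow N then F N n else 0) - L n‖ := by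
    intro n; rw [← sub_mul, norm_mul, norm_fourierMode, mul_one]
  have e1' : ∑ m : Fin N, F N (m : ℕ) * fourierMode (m : ℕ) θ
      = ∑ n ∈ centralWindow N, F N n * fourierMode n θ := e1
  rw [e1', e2, ← hs1.tsum_sub hs2]
  refine (norm_tsum_le_tsum_norm (hs1.sub hs2).norm).trans (le_of_eq (tsum_congr e3))

/-! ### The discrete system in the transformed variables -/

namespace Cylinder

theorem angle_sub (N : ℕ) (p q : ℤ) : angle N (p - q) = angle N p - angle N q := by
  simp only [angle]; push_cast; ring

theorem cos_angle_congr {N : ℕ} (hN : 0 < N) {p q : ℤ} (h : (N : ℤ) ∣ p - q) :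
    Real.cos (angle N p) = Real.cos (angle N q) := by
  obtain ⟨k, hk⟩ := h
  have hN' : (N : ℝ) ≠ 0 := by exact_mod_cast hN.ne'
  have : angle N p = angle N q + k * (2 * Real.pi) := by
    have hp : p = q + N * k := by omega
    rw [hp]; simp only [angle]; push_cast; field_simp
  rw [this, Real.cos_add_int_mul_two_pi]

theorem natCast_fin_sub_congr {N : ℕ} (p l : Fin N) :
    (N : ℤ) ∣ ((p : ℕ) - (l : ℕ) : ℤ) - ((p - l : Fin N) : ℕ) := by
  have h : ((p - l : Fin N) : ℕ) = (N - l + p) % N := by rw [Fin.sub_def]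
  rw [h]
  push_cast [Nat.cast_sub l.2.le]
  have := Int.emod_add_mul_ediv ((N : ℤ) - l + p) N
  refine ⟨((N : ℤ) - l + p) / N - 1, ?_⟩
  linarith

theorem invDFT_eq {N : ℕ} (c : Fin N → ℂ) (l : Fin N) :
    invDFT c l = ∑ m : Fin N, c m * fourierMode (m : ℕ) (angle N (l : ℕ)) := by
  rw [invDFT]
  refine Finset.sum_congr rfl fun m _ => ?_
  simp only [fourierMode, angle]
  congr 2
  push_cast; ring

theorem dft_eq (N : ℕ) (f : ℝ → ℂ) (m : Fin N) :
    dft N f m = 1 / (N : ℂ) * ∑ p : Fin N, f (angle N (p : ℕ))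
      * fourierMode (-(m : ℕ)) (angle N (p : ℕ)) := by
  rw [dft]
  congr 1
  refine Finset.sum_congr rfl fun p _ => ?_
  simp only [fourierMode, angle]
  congr 2
  push_cast; ring

/-- Discrete Fourier inversion. -/
theorem mean_invDFT_mul {N : ℕ} (hN : 0 < N) (c : Fin N → ℂ) (m : Fin N) :
    1 / (N : ℂ) * ∑ p : Fin N, invDFT c p * fourierMode (-(m : ℕ)) (angle N (p : ℕ)) = c m := by
  have hN' : (N : ℂ) ≠ 0 := by exact_mod_cast hN.ne'
  simp_rw [invDFT_eq, Finset.sum_mul]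
  rw [Finset.sum_comm]
  have h : ∀ k : Fin N, ∑ p : Fin N, c k * fourierMode (k : ℕ) (angle N (p : ℕ))
      * fourierMode (-(m : ℕ)) (angle N (p : ℕ)) = if k = m then (N : ℂ) * c k else 0 := by
    intro k
    simp_rw [mul_assoc, ← fourierMode_add]
    rw [← Finset.mul_sum, sum_fourierMode_angle hN]
    have : (N : ℤ) ∣ ((k : ℕ) : ℤ) + -((m : ℕ) : ℤ) ↔ k = m := by
      constructor
      · intro hd
        have := Int.eq_zero_of_abs_lt_dvd hd (by rw [abs_lt]; omega)
        exact Fin.ext (by omega)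
      · rintro rfl; simp
    simp only [this]
    split_ifs <;> ring
  simp_rw [h]
  rw [Finset.sum_ite_eq' Finset.univ m]
  simp only [Finset.mem_univ, if_true]
  field_simp

theorem invDFT_injective {N : ℕ} : Function.Injective (invDFT (N := N)) := by
  intro c d h
  funext m
  have hN : 0 < N := m.pos
  rw [← mean_invDFT_mul hN c m, h, mean_invDFT_mul hN d m]

theorem invDFT_surjective {N : ℕ} : Function.Surjective (invDFT (N := N)) := by
  let T : (Fin N → ℂ) →ₗ[ℂ] (Fin N → ℂ) :=
    { toFun := invDFT
      map_add' := fun a b => by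
        funext l; simp only [invDFT, Pi.add_apply, add_mul, Finset.sum_add_distrib]
      map_smul' := fun r a => by
        funext l
        simp only [invDFT, Pi.smul_apply, smul_eq_mul, mul_assoc, Finset.mul_sum,
          RingHom.id_apply] }
  exact (LinearMap.injective_iff_surjective (f := T)).1 invDFT_injective

theorem invDFT_dft {N : ℕ} (f : ℝ → ℂ) (p : Fin N) : invDFT (dft N f) p = f (angle N (p : ℕ)) := by
  obtain ⟨c, hc⟩ := invDFT_surjective fun p : Fin N => f (angle N (p : ℕ))
  have : dft N f = c := by
    funext m
    rw [dft_eq, ← mean_invDFT_mul p.pos c m, hc]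
  rw [this, hc]

theorem sum_sub_of_periodic {N : ℕ} {G : ℤ → ℂ} (hG : ∀ p q : ℤ, (N : ℤ) ∣ p - q → G p = G q)
    (p : Fin N) : ∑ l : Fin N, G ((p : ℕ) - (l : ℕ)) = ∑ l : Fin N, G (l : ℕ) := by
  have : NeZero N := ⟨p.pos.ne'⟩
  rw [← Equiv.sum_comp (Equiv.subLeft p) (fun l : Fin N => G (l : ℕ))]
  exact Finset.sum_congr rfl fun l _ => hG _ _ (natCast_fin_sub_congr p l)

/-- A circulant matrix acts on the transformed variables by multiplication. -/
theorem sum_mul_invDFT {N : ℕ} {f : ℝ → ℂ}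
    (hf : ∀ p q : ℤ, (N : ℤ) ∣ p - q → f (angle N p) = f (angle N q)) (c : Fin N → ℂ)
    (p : Fin N) :
    ∑ l : Fin N, f (angle N ((p : ℕ) - (l : ℕ) : ℤ)) * invDFT c l
      = invDFT (fun m => N * dft N f m * c m) p := by
  have hN := p.pos
  have hN' : (N : ℂ) ≠ 0 := by exact_mod_cast hN.ne'
  simp_rw [invDFT_eq, Finset.mul_sum]
  rw [Finset.sum_comm]
  refine Finset.sum_congr rfl fun m _ => ?_
  have hG := sum_sub_of_periodic (N := N)
    (G := fun q => f (angle N q) * fourierMode (-(m : ℕ)) (angle N q)) (fun a b hab => by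
      rw [hf a b hab, fourierMode_angle_comm, fourierMode_angle_comm N _ b,
        fourierMode_angle_congr hN _ hab]) p
  rw [dft_eq, ← mul_assoc (N : ℂ), mul_one_div_cancel hN', one_mul, ← hG, Finset.sum_mul,
    Finset.sum_mul]
  refine Finset.sum_congr rfl fun l _ => ?_
  rw [angle_sub, fourierMode_sub_arg, neg_neg]
  have : fourierMode (-(m : ℕ)) (angle N (p : ℕ)) * fourierMode (m : ℕ) (angle N (p : ℕ)) = 1 := by
    rw [← fourierMode_add, neg_add_cancel, fourierMode_zero]
  linear_combination (-f (angle N (p : ℕ) - angle N (l : ℕ)) * c m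
    * fourierMode (m : ℕ) (angle N (l : ℕ))) * this

variable (S : Cylinder)

theorem kerE_angle_congr (j : Region) (ρ : ℝ) {N : ℕ} (hN : 0 < N) (p q : ℤ)
    (h : (N : ℤ) ∣ p - q) : S.kerE j ρ (angle N p) = S.kerE j ρ (angle N q) := by
  simp only [kerE, polarDist, cos_angle_congr hN h]

theorem kerM_angle_congr (j : Region) (ρ : ℝ) {N : ℕ} (hN : 0 < N) (p q : ℤ)
    (h : (N : ℤ) ∣ p - q) : S.kerM j ρ (angle N p) = S.kerM j ρ (angle N q) := by
  simp only [kerM, polarDist, cos_angle_congr hN h]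

theorem exists_blockE_eq_circulant {N : ℕ} (hN : 0 < N) (j : Region) :
    ∃ v : Fin N → ℂ, S.blockE N j = Matrix.circulant v := by
  refine ⟨fun p => S.Z j * S.kerE j (S.ρaux j) (angle N (p : ℕ)), ?_⟩
  ext p l
  rw [Matrix.circulant_apply, blockE, Matrix.of_apply]
  rw [S.kerE_angle_congr j _ hN _ _ (natCast_fin_sub_congr p l)]

theorem exists_blockM_eq_circulant {N : ℕ} (hN : 0 < N) (j : Region) :
    ∃ v : Fin N → ℂ, S.blockM N j = Matrix.circulant v := by
  refine ⟨fun p => Complex.I * S.kerM j (S.ρaux j) (angle N (p : ℕ)), ?_⟩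
  ext p l
  rw [Matrix.circulant_apply, blockM, Matrix.of_apply]
  rw [S.kerM_angle_congr j _ hN _ _ (natCast_fin_sub_congr p l)]

theorem block_mulVec_invDFT {N : ℕ} (hN : 0 < N) (j : Region) (a b : Fin N → ℂ) :
    (S.blockE N j).mulVec (invDFT a) + (S.blockM N j).mulVec (invDFT b)
      = invDFT fun m => N * (S.Z j * dft N (S.kerE j (S.ρaux j)) m * a m
          + Complex.I * dft N (S.kerM j (S.ρaux j)) m * b m) := by
  funext p
  simp only [Pi.add_apply, Matrix.mulVec, dotProduct, blockE, blockM, Matrix.of_apply, mul_assoc]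
  rw [← Finset.mul_sum, ← Finset.mul_sum, sum_mul_invDFT (S.kerE_angle_congr j _ hN),
    sum_mul_invDFT (S.kerM_angle_congr j _ hN), invDFT_eq, invDFT_eq, invDFT_eq, Finset.mul_sum,
    Finset.mul_sum, ← Finset.sum_add_distrib]
  exact Finset.sum_congr rfl fun m _ => by ring

theorem sysMatrix_mulVec_invDFT {N : ℕ} (hN : 0 < N) (a b : Fin N → ℂ) :
    (S.sysMatrix N).mulVec (Sum.elim (invDFT a) (invDFT b))
      = Sum.elim
        (invDFT fun m => N * (S.Z .R1 * S.B₁ N m * a m + Complex.I * S.B₂ N m * b m))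
        (invDFT fun m => N * (S.Z .R2 * S.B₃ N m * a m + Complex.I * S.B₄ N m * b m)) := by
  rw [sysMatrix, Matrix.fromBlocks_mulVec]
  simp only [Sum.elim_comp_inl, Sum.elim_comp_inr]
  rw [S.block_mulVec_invDFT hN, S.block_mulVec_invDFT hN]
  rfl

theorem rhs_eq_invDFT (e j : Region) (N : ℕ) [Decidable (j = e)] :
    S.rhs e j N = invDFT fun m => if j = e then j.sgn * S.I * S.Z j * S.D e N m else 0 := by
  funext p
  by_cases h : j = e
  · subst h
    have h1 := invDFT_dft (N := N)
      (fun θ => hankel2 0 (S.k j * polarDist (S.ρaux j) S.ρfil θ)) p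
    rw [invDFT_eq] at h1 ⊢
    simp only [rhs, if_true, D]
    rw [← h1, Finset.mul_sum, ← Finset.sum_neg_distrib]
    exact Finset.sum_congr rfl fun m _ => by ring
  · rw [invDFT_eq]
    simp [rhs, h]

theorem elim_invDFT_eq_iff {N : ℕ} (a b c d : Fin N → ℂ) :
    Sum.elim (invDFT a) (invDFT b) = Sum.elim (invDFT c) (invDFT d)
      ↔ ∀ m, a m = c m ∧ b m = d m := by
  rw [Sum.elim_eq_iff]
  constructor
  · rintro ⟨h1, h2⟩ m
    exact ⟨congrFun (invDFT_injective h1) m, congrFun (invDFT_injective h2) m⟩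
  · intro h
    rw [show a = c from funext fun m => (h m).1, show b = d from funext fun m => (h m).2]
    exact ⟨rfl, rfl⟩

open Classical in
theorem isDiscreteSolution_invDFT_iff (e : Region) {N : ℕ} (hN : 0 < N) (a b : Fin N → ℂ) :
    S.IsDiscreteSolution e (invDFT a) (invDFT b) ↔ ∀ m,
      N * (S.Z .R1 * S.B₁ N m * a m + Complex.I * S.B₂ N m * b m)
          = (if Region.R1 = e then S.I * S.Z .R1 * S.D e N m else 0) ∧
        N * (S.Z .R2 * S.B₃ N m * a m + Complex.I * S.B₄ N m * b m)
          = (if Region.R2 = e then -(S.I * S.Z .R2 * S.D e N m) else 0) := by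
  rw [IsDiscreteSolution, S.sysMatrix_mulVec_invDFT hN, rhs_eq_invDFT, rhs_eq_invDFT,
    elim_invDFT_eq_iff]
  simp only [Region.sgn, one_mul, neg_mul]

/-- In the transformed variables the system splits into the `2 × 2` systems with matrices
`[Z₁ B₁, i B₂; Z₂ B₃, i B₄]`, of determinants `i Δ^{(m)}`. -/
theorem isUnit_det_iff {N : ℕ} (hN : 0 < N) :
    IsUnit (S.sysMatrix N).det ↔ ∀ m : Fin N, S.disc N m ≠ 0 := by
  have hN' : (N : ℂ) ≠ 0 := by exact_mod_cast hN.ne'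
  rw [isUnit_iff_ne_zero, ← not_iff_not, not_not, ← Matrix.exists_mulVec_eq_zero_iff]
  push Not
  have hzero : (0 : Fin N ⊕ Fin N → ℂ) = Sum.elim (invDFT fun _ => 0) (invDFT fun _ => 0) := by
    funext x; rcases x with x | x <;> simp [invDFT]
  constructor
  · rintro ⟨v, hv, hM⟩
    by_contra! hd
    obtain ⟨a, ha⟩ := invDFT_surjective (v ∘ Sum.inl)
    obtain ⟨b, hb⟩ := invDFT_surjective (v ∘ Sum.inr)
    have hv' : v = Sum.elim (invDFT a) (invDFT b) := by rw [ha, hb, Sum.elim_comp_inl_inr]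
    rw [hv', S.sysMatrix_mulVec_invDFT hN, hzero, elim_invDFT_eq_iff] at hM
    refine hv ?_
    rw [hv', hzero, elim_invDFT_eq_iff]
    intro m
    obtain ⟨h1, h2⟩ := hM m
    have h1' := (mul_eq_zero.1 h1).resolve_left hN'
    have h2' := (mul_eq_zero.1 h2).resolve_left hN'
    have hdm := hd m
    constructor
    · refine (mul_eq_zero.1 (?_ : S.disc N m * a m = 0)).resolve_left hdm
      rw [disc]; linear_combination S.B₄ N m * h1' - S.B₂ N m * h2'
    · refine (mul_eq_zero.1 (?_ : Complex.I * S.disc N m * b m = 0)).resolve_left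
        (mul_ne_zero Complex.I_ne_zero hdm)
      rw [disc]; linear_combination S.Z .R1 * S.B₁ N m * h2' - S.Z .R2 * S.B₃ N m * h1'
  · rintro ⟨m, hm⟩
    have hdet : (!![S.Z .R1 * S.B₁ N m, Complex.I * S.B₂ N m;
        S.Z .R2 * S.B₃ N m, Complex.I * S.B₄ N m] : Matrix (Fin 2) (Fin 2) ℂ).det = 0 := by
      rw [Matrix.det_fin_two_of]
      rw [disc] at hm
      linear_combination Complex.I * hm
    obtain ⟨w, hw, hMw⟩ := Matrix.exists_mulVec_eq_zero_iff.2 hdet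
    have q0 := congrFun hMw 0
    have q1 := congrFun hMw 1
    simp [Matrix.mulVec, dotProduct, Fin.sum_univ_two] at q0 q1
    refine ⟨Sum.elim (invDFT fun k => if k = m then w 0 else 0)
      (invDFT fun k => if k = m then w 1 else 0), ?_, ?_⟩
    · intro h0
      rw [hzero, elim_invDFT_eq_iff] at h0
      have := h0 m
      simp only [if_true] at this
      refine hw (funext fun i => ?_)
      fin_cases i
      · exact this.1
      · exact this.2
    · rw [S.sysMatrix_mulVec_invDFT hN, hzero, elim_invDFT_eq_iff]
      intro k
      by_cases hk : k = m
      · subst hk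
        simp only [if_true]
        exact ⟨by rw [q0, mul_zero], by rw [q1, mul_zero]⟩
      · simp [hk]

theorem isDiscreteSolution_iff (e : Region) {N : ℕ} (hN : 0 < N)
    (hd : ∀ m : Fin N, S.disc N m ≠ 0) (I K : Fin N → ℂ) :
    S.IsDiscreteSolution e I K ↔ I = invDFT (S.dftI e N) ∧ K = invDFT (S.dftK e N) := by
  have hN' : (N : ℂ) ≠ 0 := by exact_mod_cast hN.ne'
  obtain ⟨a, rfl⟩ := invDFT_surjective I
  obtain ⟨b, rfl⟩ := invDFT_surjective K
  rw [S.isDiscreteSolution_invDFT_iff e hN, invDFT_injective.eq_iff, invDFT_injective.eq_iff,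
    funext_iff, funext_iff, ← forall_and]
  refine forall_congr' fun m => ?_
  have hdm := hd m
  have hdm' := hdm
  have hI : Complex.I * Complex.I = -1 := Complex.I_mul_I
  rw [disc] at hdm'
  cases e
  · simp only [if_true, reduceCtorEq, if_false, dftI, dftK]
    constructor
    · rintro ⟨h1, h2⟩
      constructor
      · rw [div_mul_div_comm, eq_div_iff (mul_ne_zero hN' hdm), disc]
        linear_combination S.B₄ N m * h1 - S.B₂ N m * h2
      · rw [div_mul_div_comm, eq_div_iff (mul_ne_zero hN' hdm), disc]
        linear_combination (-Complex.I) * (S.Z .R1 * S.B₁ N m * h2 - S.Z .R2 * S.B₃ N m * h1)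
          + (N * b m * (S.Z .R1 * S.B₁ N m * S.B₄ N m - S.Z .R2 * S.B₂ N m * S.B₃ N m)) * hI
    · rintro ⟨h1, h2⟩
      rw [h1, h2]
      constructor
      · have e1 : S.disc N m = S.Z .R1 * S.B₁ N m * S.B₄ N m - S.Z .R2 * S.B₂ N m * S.B₃ N m := rfl
        field_simp
        rw [e1]
        linear_combination (S.I * S.Z .R1 * S.D .R1 N m * S.Z .R2 * S.B₂ N m * S.B₃ N m) * hI
      · field_simp
        linear_combination (S.I * S.Z .R1 * S.D .R1 N m * S.Z .R2 * S.B₃ N m * S.B₄ N m) * hI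
  · simp only [if_true, reduceCtorEq, if_false, dftI, dftK]
    constructor
    · rintro ⟨h1, h2⟩
      constructor
      · rw [div_mul_div_comm, eq_div_iff (mul_ne_zero hN' hdm), disc]
        linear_combination S.B₄ N m * h1 - S.B₂ N m * h2
      · rw [div_mul_div_comm, eq_div_iff (mul_ne_zero hN' hdm), disc]
        linear_combination (-Complex.I) * (S.Z .R1 * S.B₁ N m * h2 - S.Z .R2 * S.B₃ N m * h1)
          + (N * b m * (S.Z .R1 * S.B₁ N m * S.B₄ N m - S.Z .R2 * S.B₂ N m * S.B₃ N m)) * hI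
    · rintro ⟨h1, h2⟩
      rw [h1, h2]
      constructor
      · field_simp
        linear_combination (S.I * S.Z .R2 * S.D .R2 N m * S.Z .R1 * S.B₁ N m * S.B₂ N m) * hI
      · have e1 : S.disc N m = S.Z .R1 * S.B₁ N m * S.B₄ N m - S.Z .R2 * S.B₂ N m * S.B₃ N m := rfl
        field_simp
        rw [e1]
        linear_combination (S.I * S.Z .R2 * S.D .R2 N m * S.Z .R1 * S.B₁ N m * S.B₄ N m) * hI

end Cylinder

/-! ### Geometric weights and the size of aliased coefficients -/

/-- The weight `q^{|n|} / max(1, |n|)^s`. -/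
noncomputable def geomWeight (s : ℕ) (q : ℝ) (n : ℤ) : ℝ :=
  q ^ n.natAbs / max 1 (n.natAbs : ℝ) ^ s

/-- Sum of the weights over the residue class of `n` modulo `N`. -/
noncomputable def aliasWeight (s : ℕ) (q : ℝ) (N : ℕ) (n : ℤ) : ℝ :=
  ∑' t : ℤ, geomWeight s q (n + t * N)

/-- The orders `n` tend to infinity in modulus, subject to `2 |n| ≤ N`. -/
noncomputable def highOrders : Filter (ℕ × ℤ) :=
  comap (fun p => p.2.natAbs) atTop ⊓ 𝓟 {p | 2 * p.2.natAbs ≤ p.1}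

theorem eventually_highOrders {P : ℕ × ℤ → Prop} :
    (∀ᶠ p in highOrders, P p) ↔ ∃ M : ℕ, ∀ (N : ℕ) (n : ℤ), M ≤ n.natAbs → 2 * n.natAbs ≤ N →
      P (N, n) := by
  rw [highOrders, eventually_inf_principal, eventually_comap, eventually_atTop]
  constructor
  · rintro ⟨M, h⟩
    exact ⟨M, fun N n h1 h2 => h _ h1 (N, n) rfl h2⟩
  · rintro ⟨M, h⟩
    exact ⟨M, fun b hb p hp h2 => h p.1 p.2 (hp ▸ hb) h2⟩

section Weights

variable {s : ℕ} {q : ℝ}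

theorem geomWeight_pos (hq : 0 < q) (n : ℤ) : 0 < geomWeight s q n :=
  div_pos (pow_pos hq _) (pow_pos (lt_max_of_lt_left one_pos) _)

theorem geomWeight_le_pow (hq : 0 ≤ q) (n : ℤ) : geomWeight s q n ≤ q ^ n.natAbs :=
  div_le_self (pow_nonneg hq _) (one_le_pow₀ (le_max_left _ _))

theorem summable_pow_natAbs (hq0 : 0 ≤ q) (hq : q < 1) :
    Summable fun n : ℤ => q ^ n.natAbs :=
  (summable_geometric_of_lt_one hq0 hq).comp_int_natAbs

theorem summable_geomWeight (hq0 : 0 < q) (hq : q < 1) : Summable (geomWeight s q) :=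
  Summable.of_nonneg_of_le (fun n => (geomWeight_pos hq0 n).le)
    (fun n => geomWeight_le_pow hq0.le n) (summable_pow_natAbs hq0.le hq)

theorem injective_add_mul {N : ℕ} (hN : 0 < N) (n : ℤ) :
    Function.Injective fun t : ℤ => n + t * N := by
  intro a b h
  have : (N : ℤ) ≠ 0 := by exact_mod_cast hN.ne'
  exact mul_right_cancel₀ this (add_left_cancel h)

theorem aliasSum_eq_tsum {N : ℕ} (hN : 0 < N) (c : ℤ → ℂ) (n : ℤ) :
    aliasSum N c n = ∑' t : ℤ, c (n + t * N) := by
  classical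
  rw [aliasSum, ← (injective_add_mul hN n).tsum_eq
    (f := fun k => if (N : ℤ) ∣ k - n then c k else 0)]
  · refine tsum_congr fun t => ?_
    rw [if_pos ⟨t, by ring⟩]
  · intro k hk
    have : (N : ℤ) ∣ k - n := by
      by_contra h
      exact hk (if_neg h)
    obtain ⟨t, ht⟩ := this
    exact ⟨t, by simp only; linarith⟩

theorem natAbs_le_natAbs_add_mul {N : ℕ} {n : ℤ} (h : 2 * n.natAbs ≤ N) (hN : 0 < N) (t : ℤ) :
    n.natAbs + t.natAbs ≤ (n + t * N).natAbs + 1 ∧ n.natAbs ≤ (n + t * N).natAbs := by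
  rcases eq_or_ne t 0 with rfl | ht
  · simp
  · have h1 : (t * N).natAbs ≤ (n + t * N).natAbs + n.natAbs := by
      have := Int.natAbs_sub_le (n + t * N) n
      rwa [add_sub_cancel_left] at this
    rw [Int.natAbs_mul, Int.natAbs_natCast] at h1
    have ht' : 1 ≤ t.natAbs := Int.natAbs_pos.2 ht
    obtain ⟨u, hu⟩ := Nat.exists_eq_add_of_le ht'
    rw [hu] at h1 ⊢
    have h2 : u ≤ u * N := Nat.le_mul_of_pos_right _ hN
    have h3 : (1 + u) * N = N + u * N := by ring
    omega

theorem geomWeight_add_mul_le (hq0 : 0 < q) (hq : q < 1) {N : ℕ} {n : ℤ} (h : 2 * n.natAbs ≤ N)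
    (hN : 0 < N) (t : ℤ) :
    geomWeight s q (n + t * N) ≤ geomWeight s q n * (q ^ t.natAbs / q) := by
  obtain ⟨h1, h2⟩ := natAbs_le_natAbs_add_mul h hN t
  have e : geomWeight s q n * (q ^ t.natAbs / q)
      = (q ^ (n.natAbs + t.natAbs) / q) / max 1 (n.natAbs : ℝ) ^ s := by
    rw [geomWeight, pow_add]; ring
  rw [e, geomWeight]
  have h3 : q ^ (n + t * N).natAbs ≤ q ^ (n.natAbs + t.natAbs) / q := by
    rw [le_div_iff₀ hq0, ← pow_succ]
    exact pow_le_pow_of_le_one hq0.le hq.le h1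
  have h4 : (n.natAbs : ℝ) ≤ ((n + t * N).natAbs : ℝ) := by exact_mod_cast h2
  gcongr

theorem summable_geomWeight_add_mul (hq0 : 0 < q) (hq : q < 1) {N : ℕ} (hN : 0 < N) (n : ℤ) :
    Summable fun t : ℤ => geomWeight s q (n + t * N) :=
  (summable_geomWeight hq0 hq).comp_injective (injective_add_mul hN n)

theorem geomWeight_le_aliasWeight (hq0 : 0 < q) (hq : q < 1) {N : ℕ} (hN : 0 < N) (n : ℤ) :
    geomWeight s q n ≤ aliasWeight s q N n := by
  have := (summable_geomWeight_add_mul (s := s) hq0 hq hN n).le_tsum 0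
    (fun t _ => (geomWeight_pos hq0 _).le)
  simpa [aliasWeight] using this

theorem aliasWeight_le (hq0 : 0 < q) (hq : q < 1) {N : ℕ} {n : ℤ} (h : 2 * n.natAbs ≤ N)
    (hN : 0 < N) :
    aliasWeight s q N n ≤ geomWeight s q n * ∑' t : ℤ, q ^ t.natAbs / q := by
  rw [← tsum_mul_left]
  exact (summable_geomWeight_add_mul hq0 hq hN n).tsum_le_tsum
    (geomWeight_add_mul_le hq0 hq h hN) (((summable_pow_natAbs hq0.le hq).div_const q).mul_left _)

theorem norm_aliasSum_le (hq0 : 0 < q) (hq : q < 1) {c : ℤ → ℂ} {C : ℝ} {N : ℕ} (hN : 0 < N)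
    (n : ℤ) (hc : ∀ t : ℤ, ‖c (n + t * N)‖ ≤ C * geomWeight s q (n + t * N)) :
    ‖aliasSum N c n‖ ≤ C * aliasWeight s q N n := by
  rw [aliasSum_eq_tsum hN, aliasWeight, ← tsum_mul_left]
  exact tsum_of_norm_bounded ((summable_geomWeight_add_mul hq0 hq hN n).mul_left C).hasSum hc

theorem exists_norm_aliasSum_le (hq0 : 0 < q) (hq : q < 1) {c : ℤ → ℂ}
    (hc : ∃ C : ℝ, ∀ n, ‖c n‖ ≤ C * geomWeight s q n) :
    ∃ C : ℝ, ∀ (N : ℕ) (n : ℤ), 0 < N → 2 * n.natAbs ≤ N →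
      ‖aliasSum N c n‖ ≤ C * geomWeight s q n := by
  obtain ⟨C, hC⟩ := hc
  refine ⟨C * ∑' t : ℤ, q ^ t.natAbs / q, fun N n hN h => ?_⟩
  have hC0 : 0 ≤ C := by
    have h := (norm_nonneg _).trans (hC 0)
    exact nonneg_of_mul_nonneg_left h (geomWeight_pos hq0 0)
  refine (norm_aliasSum_le hq0 hq hN n fun t => hC _).trans ?_
  rw [mul_assoc, mul_comm (∑' t : ℤ, _)]
  exact mul_le_mul_of_nonneg_left (aliasWeight_le hq0 hq h hN) hC0

theorem exists_norm_le_geomWeight (hq0 : 0 < q) {c : ℤ → ℂ} {L : ℂ}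
    (hc : Tendsto (fun n => c n / geomWeight s q n) cofinite (𝓝 L)) :
    ∃ C : ℝ, ∀ n, ‖c n‖ ≤ C * geomWeight s q n := by
  obtain ⟨C, hC⟩ := hc.norm.bddAbove_range_of_cofinite
  refine ⟨C, fun n => ?_⟩
  have h := hC (Set.mem_range_self n)
  have hw := geomWeight_pos (s := s) hq0 n
  rwa [norm_div, Complex.norm_real, Real.norm_of_nonneg hw.le, div_le_iff₀ hw] at h

theorem tendsto_natAbs_cofinite : Tendsto Int.natAbs cofinite atTop := by
  refine tendsto_atTop.2 fun b => ?_
  refine Set.Finite.subset (Set.finite_Icc (-(b : ℤ)) b) fun n hn => ?_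
  simp only [Set.mem_compl_iff, Set.mem_ofPred_eq, not_le] at hn
  rw [Set.mem_Icc]; omega

/-- All members of the residue class of `n` have modulus at least `|n|`, so the leading behaviour of
the coefficients carries over to the aliased sums. -/
theorem tendsto_aliasSum_div (hq0 : 0 < q) (hq : q < 1) {c : ℤ → ℂ} {L : ℂ}
    (hc : Tendsto (fun n => c n / geomWeight s q n) cofinite (𝓝 L)) :
    Tendsto (fun p : ℕ × ℤ => aliasSum p.1 c p.2 / aliasWeight s q p.1 p.2) highOrders (𝓝 L) := by
  have hs : Summable c := by
    obtain ⟨C, hC⟩ := exists_norm_le_geomWeight hq0 hc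
    exact Summable.of_norm_bounded ((summable_geomWeight hq0 hq).mul_left C) hC
  rw [Metric.tendsto_nhds]
  intro ε hε
  have h1 := (Metric.tendsto_nhds.1 hc) (ε / 2) (half_pos hε)
  rw [eventually_cofinite] at h1
  obtain ⟨M, hM⟩ := (h1.image Int.natAbs).bddAbove
  rw [eventually_highOrders]
  refine ⟨M + 1, fun N n hn hnN => ?_⟩
  have hN : 0 < N := by omega
  have hW : 0 < aliasWeight s q N n :=
    (geomWeight_pos hq0 n).trans_le (geomWeight_le_aliasWeight hq0 hq hN n)
  have hWc : (aliasWeight s q N n : ℂ) ≠ 0 := by exact_mod_cast hW.ne'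
  have key : ‖aliasSum N (fun k => c k - L * geomWeight s q k) n‖
      ≤ ε / 2 * aliasWeight s q N n := by
    refine norm_aliasSum_le hq0 hq hN n fun t => ?_
    have hle := (natAbs_le_natAbs_add_mul hnN hN t).2
    set k := n + t * N with hk
    have hw := geomWeight_pos (s := s) hq0 k
    have hwc : (geomWeight s q k : ℂ) ≠ 0 := by exact_mod_cast hw.ne'
    have hlt : dist (c k / geomWeight s q k) L < ε / 2 := by
      by_contra hcon
      have : k.natAbs ≤ M := hM ⟨k, hcon, rfl⟩
      omega
    rw [dist_eq_norm, div_sub' hwc, norm_div, Complex.norm_real, Real.norm_of_nonneg hw.le,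
      div_lt_iff₀ hw, mul_comm _ L] at hlt
    exact hlt.le
  have e : aliasSum N (fun k => c k - L * geomWeight s q k) n
      = aliasSum N c n - L * aliasWeight s q N n := by
    have hs1 : Summable fun t : ℤ => c (n + t * N) := hs.comp_injective (injective_add_mul hN n)
    have hs2 : Summable fun t : ℤ => (geomWeight s q (n + t * N) : ℂ) :=
      Complex.ofRealCLM.summable (summable_geomWeight_add_mul hq0 hq hN n)
    rw [aliasSum_eq_tsum hN, aliasSum_eq_tsum hN, hs1.tsum_sub (hs2.mul_left L), tsum_mul_left,
      aliasWeight, Complex.ofReal_tsum]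
  rw [e] at key
  rw [dist_eq_norm, div_sub' hWc, norm_div, Complex.norm_real, Real.norm_of_nonneg hW.le,
    div_lt_iff₀ hW, mul_comm _ L]
  exact key.trans_lt (by nlinarith)

end Weights

/-! ### Large orders -/

theorem tendsto_div_geomWeight_of_even {s : ℕ} {q : ℝ} {c : ℤ → ℂ} {L : ℂ}
    (heven : ∀ n, c (-n) = c n)
    (h : Tendsto (fun n : ℕ => c (n + 1 : ℕ) / geomWeight s q (n + 1 : ℕ)) atTop (𝓝 L)) :
    Tendsto (fun n => c n / geomWeight s q n) cofinite (𝓝 L) := by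
  have h' : Tendsto (fun n : ℕ => c n / geomWeight s q n) atTop (𝓝 L) :=
    (tendsto_add_atTop_iff_nat 1).1 h
  refine (h'.comp tendsto_natAbs_cofinite).congr fun n => ?_
  obtain ⟨k, rfl | rfl⟩ := n.eq_nat_or_neg
  · simp
  · simp [heven, geomWeight]

theorem max_one_natCast_succ (n : ℕ) : max 1 ((n + 1 : ℕ) : ℝ) = n + 1 := by
  rw [max_eq_right (by push_cast; linarith [Nat.cast_nonneg (α := ℝ) n]), Nat.cast_succ]

section Coefficients

variable {k r R : ℝ}

theorem tendsto_besselJ_mul_hankel2 (hk : 0 < k) (hr : 0 < r) (hR : 0 < R) :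
    Tendsto (fun n : ℤ => (besselJ n (k * r) * hankel2 n (k * R) : ℂ) / geomWeight 1 (r / R) n)
      cofinite (𝓝 (Complex.I * ((1 / Real.pi : ℝ) : ℂ))) := by
  have hx : 0 < k * r := mul_pos hk hr
  have hX : 0 < k * R := mul_pos hk hR
  refine tendsto_div_geomWeight_of_even (c := fun n => (besselJ n (k * r) * hankel2 n (k * R) : ℂ))
    (fun n => ?_) ?_
  · simp only [besselJ_neg, hankel2_neg]
    push_cast
    linear_combination (besselJ n (k * r) * hankel2 n (k * R)) * neg_one_pow_natAbs_mul_self n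
  · have h1 := (Complex.continuous_ofReal.tendsto _).comp
      ((tendsto_besselJNat (k * r) hx).comp (tendsto_add_atTop_nat 1))
    have h := h1.mul (tendsto_hankel2 hX)
    have e : ((1 : ℝ) : ℂ) * (Complex.I / Real.pi) = Complex.I * ((1 / Real.pi : ℝ) : ℂ) := by
      push_cast; ring
    rw [e] at h
    refine h.congr fun n => ?_
    have a1 : (n : ℂ) + 1 ≠ 0 := by exact_mod_cast (Nat.succ_ne_zero n)
    have a2 : (k : ℂ) ≠ 0 := by exact_mod_cast hk.ne'
    have a3 : (r : ℂ) ≠ 0 := by exact_mod_cast hr.ne'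
    have a4 : (R : ℂ) ≠ 0 := by exact_mod_cast hR.ne'
    have a5 : (n.factorial : ℂ) ≠ 0 := by exact_mod_cast n.factorial_ne_zero
    simp only [Function.comp, geomWeight, Int.natAbs_natCast, max_one_natCast_succ, besselJ_natCast,
      Nat.factorial_succ]
    push_cast
    simp only [mul_pow, div_pow]
    field_simp

theorem tendsto_besselJ_mul_hankel2' (hk : 0 < k) (hr : 0 < r) (hR : 0 < R) :
    Tendsto (fun n : ℤ => -(besselJ n (k * r) * hankel2' n (k * R) : ℂ) / geomWeight 0 (r / R) n)
      cofinite (𝓝 (Complex.I * ((1 / (Real.pi * (k * R)) : ℝ) : ℂ))) := by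
  have hx : 0 < k * r := mul_pos hk hr
  have hX : 0 < k * R := mul_pos hk hR
  refine tendsto_div_geomWeight_of_even
    (c := fun n => -(besselJ n (k * r) * hankel2' n (k * R) : ℂ)) (fun n => ?_) ?_
  · simp only [besselJ_neg, hankel2'_neg]
    push_cast
    linear_combination (-besselJ n (k * r) * hankel2' n (k * R)) * neg_one_pow_natAbs_mul_self n
  · have h1 := (Complex.continuous_ofReal.tendsto _).comp
      ((tendsto_besselJNat (k * r) hx).comp (tendsto_add_atTop_nat 1))
    have a2 : (k : ℂ) ≠ 0 := by exact_mod_cast hk.ne'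
    have a3 : (r : ℂ) ≠ 0 := by exact_mod_cast hr.ne'
    have a4 : (R : ℂ) ≠ 0 := by exact_mod_cast hR.ne'
    have h := (h1.mul (tendsto_hankel2' hX)).const_mul (-(2 / (k * R)) : ℂ)
    have e : (-(2 / (k * R)) : ℂ) * (((1 : ℝ) : ℂ) * (-(Complex.I / (2 * Real.pi))))
        = Complex.I * ((1 / (Real.pi * (k * R)) : ℝ) : ℂ) := by
      have : (Real.pi : ℂ) ≠ 0 := by exact_mod_cast Real.pi_ne_zero
      push_cast; field_simp
    rw [e] at h
    refine h.congr fun n => ?_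
    have a1 : (n : ℂ) + 1 ≠ 0 := by exact_mod_cast (Nat.succ_ne_zero n)
    have a5 : (n.factorial : ℂ) ≠ 0 := by exact_mod_cast n.factorial_ne_zero
    simp only [Function.comp, geomWeight, Int.natAbs_natCast, besselJ_natCast,
      Nat.factorial_succ, pow_zero, div_one]
    push_cast
    simp only [mul_pow, div_pow]
    field_simp
    ring

theorem tendsto_besselJ'_mul_hankel2 (hk : 0 < k) (hr : 0 < r) (hR : 0 < R) :
    Tendsto (fun n : ℤ => -(besselJ' n (k * r) * hankel2 n (k * R) : ℂ) / geomWeight 0 (r / R) n)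
      cofinite (𝓝 (Complex.I * ((-(1 / (Real.pi * (k * r))) : ℝ) : ℂ))) := by
  have hx : 0 < k * r := mul_pos hk hr
  have hX : 0 < k * R := mul_pos hk hR
  refine tendsto_div_geomWeight_of_even
    (c := fun n => -(besselJ' n (k * r) * hankel2 n (k * R) : ℂ)) (fun n => ?_) ?_
  · simp only [besselJ'_neg, hankel2_neg]
    push_cast
    linear_combination (-besselJ' n (k * r) * hankel2 n (k * R)) * neg_one_pow_natAbs_mul_self n
  · have h1 := (Complex.continuous_ofReal.tendsto _).comp (tendsto_besselJ' hx)
    have a2 : (k : ℂ) ≠ 0 := by exact_mod_cast hk.ne'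
    have a3 : (r : ℂ) ≠ 0 := by exact_mod_cast hr.ne'
    have a4 : (R : ℂ) ≠ 0 := by exact_mod_cast hR.ne'
    have h := (h1.mul (tendsto_hankel2 hX)).const_mul (-(2 / (k * r)) : ℂ)
    have e : (-(2 / (k * r)) : ℂ) * (((1 / 2 : ℝ) : ℂ) * (Complex.I / Real.pi))
        = Complex.I * ((-(1 / (Real.pi * (k * r))) : ℝ) : ℂ) := by
      have : (Real.pi : ℂ) ≠ 0 := by exact_mod_cast Real.pi_ne_zero
      push_cast; field_simp
    rw [e] at h
    refine h.congr fun n => ?_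
    have a5 : (n.factorial : ℂ) ≠ 0 := by exact_mod_cast n.factorial_ne_zero
    simp only [Function.comp, geomWeight, Int.natAbs_natCast, pow_zero, div_one]
    push_cast
    simp only [mul_pow, div_pow]
    field_simp
    ring

theorem exists_norm_besselJ_mul_hankel2_le {x y X : ℝ} (hx : 0 ≤ x) (hxy : x ≤ y) (hX : 0 < X) :
    ∃ C : ℝ, ∀ n : ℤ, ‖(besselJ n x * hankel2 n X : ℂ)‖ ≤ C * geomWeight 1 (y / X) n := by
  obtain ⟨C, hC0, hC⟩ := norm_hankel2_le hX
  refine ⟨Real.exp ((x / 2) ^ 2) * C, fun n => ?_⟩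
  have hy : 0 ≤ y := hx.trans hxy
  have hf : (0 : ℝ) < n.natAbs.factorial := by positivity
  have hm : (0 : ℝ) < max 1 (n.natAbs : ℝ) := lt_max_of_lt_left one_pos
  rw [norm_mul, Complex.norm_real, Real.norm_eq_abs]
  calc |besselJ n x| * ‖hankel2 n X‖
      ≤ (Real.exp ((x / 2) ^ 2) * (|x / 2| ^ n.natAbs / n.natAbs.factorial))
        * (C * ((n.natAbs.factorial : ℝ) / max 1 (n.natAbs : ℝ) / (X / 2) ^ n.natAbs)) :=
        mul_le_mul (abs_besselJ_le n x) (hC n) (norm_nonneg _) (by positivity)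
    _ ≤ (Real.exp ((x / 2) ^ 2) * ((y / 2) ^ n.natAbs / n.natAbs.factorial))
        * (C * ((n.natAbs.factorial : ℝ) / max 1 (n.natAbs : ℝ) / (X / 2) ^ n.natAbs)) := by
        rw [abs_of_nonneg (by positivity)]
        gcongr
    _ = _ := by
        simp only [geomWeight, pow_one, div_pow]
        field_simp

end Coefficients

/-! ### The transformed discrete system for large `N` -/

theorem hankel2_re (n : ℤ) (x : ℝ) : (hankel2 n x).re = besselJ n x := by
  simp [hankel2]

theorem hankel2'_re (n : ℤ) {x : ℝ} (hx : 0 < x) : (hankel2' n x).re = besselJ' n x := by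
  have e : (hankel2 (n - 1) x - hankel2 (n + 1) x) / 2
      = ((1 / 2 : ℝ) : ℂ) * (hankel2 (n - 1) x - hankel2 (n + 1) x) := by push_cast; ring
  rw [hankel2'_eq n hx, besselJ'_eq, e, Complex.re_ofReal_mul, Complex.sub_re, hankel2_re,
    hankel2_re]
  ring

/-- A quotient of aliased sums is at most `C (z/x)^{|n|}` if the numerator contains the weights with
ratios `z` and `y`, and the denominator is bounded below by the weights with ratios `x` and `y`. The
condition on the exponents makes the powers of `|n|` cancel. -/
theorem exists_norm_quotient_le {x y z : ℝ} (hx : 0 < x) (hy0 : 0 < y) (hy : y < 1)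
    (hz0 : 0 < z) (hz : z < 1) (s s' s'' : ℕ) {d b : ℤ → ℂ} {E : ℕ → ℤ → ℂ}
    (hd : ∃ C : ℝ, ∀ n, ‖d n‖ ≤ C * geomWeight (s + s') z n)
    (hb : ∃ C : ℝ, ∀ n, ‖b n‖ ≤ C * geomWeight s'' y n)
    (hE : ∃ κ > 0, ∀ᶠ N : ℕ in atTop, ∀ n : ℤ, 2 * n.natAbs ≤ N →
      κ * (geomWeight s x n * geomWeight s' y n) ≤ ‖E N n‖) :
    ∃ C : ℝ, ∀ᶠ N : ℕ in atTop, ∀ n : ℤ, 2 * n.natAbs ≤ N →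
      ‖aliasSum N d n * aliasSum N b n / E N n‖ ≤ C * (z / x) ^ n.natAbs := by
  obtain ⟨C₁, h1⟩ := exists_norm_aliasSum_le hz0 hz hd
  obtain ⟨C₂, h2⟩ := exists_norm_aliasSum_le hy0 hy hb
  obtain ⟨κ, hκ, h3⟩ := hE
  refine ⟨C₁ * C₂ / κ, ?_⟩
  filter_upwards [h3, eventually_gt_atTop 0] with N h3 hN n hn
  have g1 := geomWeight_pos (s := s) hx n
  have g2 := geomWeight_pos (s := s') hy0 n
  have g3 := geomWeight_pos (s := s + s') hz0 n
  have g4 := geomWeight_pos (s := s'') hy0 n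
  have C1 : 0 ≤ C₁ := nonneg_of_mul_nonneg_left ((norm_nonneg _).trans (h1 N n hN hn)) g3
  have C2 : 0 ≤ C₂ := nonneg_of_mul_nonneg_left ((norm_nonneg _).trans (h2 N n hN hn)) g4
  have hpos : 0 < κ * (geomWeight s x n * geomWeight s' y n) := by positivity
  have hm : (0 : ℝ) < max 1 (n.natAbs : ℝ) := lt_max_of_lt_left one_pos
  rw [norm_div, norm_mul, div_le_iff₀ (hpos.trans_le (h3 n hn))]
  calc ‖aliasSum N d n‖ * ‖aliasSum N b n‖
      ≤ (C₁ * geomWeight (s + s') z n) * (C₂ * geomWeight s'' y n) :=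
        mul_le_mul (h1 N n hN hn) (h2 N n hN hn) (norm_nonneg _) (by positivity)
    _ ≤ (C₁ * geomWeight (s + s') z n) * (C₂ * y ^ n.natAbs) := by
        gcongr
        exact geomWeight_le_pow hy0.le n
    _ = C₁ * C₂ / κ * (z / x) ^ n.natAbs
          * (κ * (geomWeight s x n * geomWeight s' y n)) := by
        simp only [geomWeight, pow_add, div_pow]
        field_simp
    _ ≤ _ := by
        have := h3 n hn
        gcongr

namespace Cylinder

variable (S : Cylinder)

/-- If `Δ_n = 0`, its real part and the Wronskian at `k₁ρcyl` give `J_n(k₂ρcyl) = 0`, whence also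
`J_n'(k₂ρcyl) = 0`; the Wronskian at `k₂ρcyl` excludes a common zero. -/
theorem den_ne_zero (n : ℤ) : S.den n ≠ 0 := by
  intro h
  have h1 : 0 < S.k .R1 * S.ρcyl := mul_pos (S.k_pos _) S.ρcyl_pos
  have h2 : 0 < S.k .R2 * S.ρcyl := mul_pos (S.k_pos _) S.ρcyl_pos
  have w1 := besselJ_hankel2_wronskian n h1
  have w2 := besselJ_hankel2_wronskian n h2
  have hW : ∀ x : ℝ, 0 < x → -Complex.I * (2 / (Real.pi * x) : ℂ) ≠ 0 := by
    intro x hx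
    refine mul_ne_zero (neg_ne_zero.2 Complex.I_ne_zero) (div_ne_zero two_ne_zero ?_)
    exact_mod_cast mul_ne_zero Real.pi_ne_zero hx.ne'
  -- the real part of the denominator relates the two logarithmic derivatives of `J_n`
  have hre : S.Z .R1 * besselJ' n (S.k .R2 * S.ρcyl) * besselJ n (S.k .R1 * S.ρcyl)
      - S.Z .R2 * besselJ n (S.k .R2 * S.ρcyl) * besselJ' n (S.k .R1 * S.ρcyl) = 0 := by
    have := congrArg Complex.re h
    have e : S.den n = ((S.Z .R1 * besselJ' n (S.k .R2 * S.ρcyl) : ℝ) : ℂ)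
          * hankel2 n (S.k .R1 * S.ρcyl)
        - ((S.Z .R2 * besselJ n (S.k .R2 * S.ρcyl) : ℝ) : ℂ) * hankel2' n (S.k .R1 * S.ρcyl) := by
      rw [den]; push_cast; ring
    rwa [e, Complex.sub_re, Complex.re_ofReal_mul, Complex.re_ofReal_mul, hankel2_re,
      hankel2'_re n h1] at this
  have hre' : (S.Z .R1 * besselJ' n (S.k .R2 * S.ρcyl) * besselJ n (S.k .R1 * S.ρcyl)
      - S.Z .R2 * besselJ n (S.k .R2 * S.ρcyl) * besselJ' n (S.k .R1 * S.ρcyl) : ℂ) = 0 := by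
    exact_mod_cast hre
  have hZ1 : (S.Z .R1 : ℂ) ≠ 0 := by exact_mod_cast (S.Z_pos _).ne'
  have hZ2 : (S.Z .R2 : ℂ) ≠ 0 := by exact_mod_cast (S.Z_pos _).ne'
  rw [den] at h
  have hJ : (besselJ n (S.k .R2 * S.ρcyl) : ℂ) = 0 := by
    have : S.Z .R2 * besselJ n (S.k .R2 * S.ρcyl)
        * (-Complex.I * (2 / (Real.pi * (S.k .R1 * S.ρcyl : ℝ)) : ℂ)) = 0 := by
      rw [← w1]
      linear_combination hankel2 n (S.k .R1 * S.ρcyl) * hre'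
        - (besselJ n (S.k .R1 * S.ρcyl) : ℂ) * h
    exact (mul_eq_zero.1 ((mul_eq_zero.1 this).resolve_right (hW _ h1))).resolve_left hZ2
  have hJ' : (besselJ' n (S.k .R2 * S.ρcyl) : ℂ) = 0 := by
    rw [hJ, mul_zero, zero_mul, sub_zero] at h
    exact (mul_eq_zero.1 h).resolve_left (mul_ne_zero hZ1 (hankel2_ne_zero n h1))
  rw [hJ, hJ', zero_mul, zero_mul, sub_zero] at w2
  exact hW _ h2 w2.symm

theorem coefE_aux₁ (n : ℤ) : coefE (S.k .R1) S.ρcyl (S.ρaux .R1) n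
    = besselJ n (S.k .R1 * S.ρaux .R1) * hankel2 n (S.k .R1 * S.ρcyl) :=
  if_pos S.ρaux₁_lt

theorem coefM_aux₁ (n : ℤ) : coefM (S.k .R1) S.ρcyl (S.ρaux .R1) n
    = -(besselJ n (S.k .R1 * S.ρaux .R1) * hankel2' n (S.k .R1 * S.ρcyl)) :=
  if_pos S.ρaux₁_lt

theorem coefE_aux₂ (n : ℤ) : coefE (S.k .R2) S.ρcyl (S.ρaux .R2) n
    = besselJ n (S.k .R2 * S.ρcyl) * hankel2 n (S.k .R2 * S.ρaux .R2) :=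
  if_neg S.lt_ρaux₂.not_gt

theorem coefM_aux₂ (n : ℤ) : coefM (S.k .R2) S.ρcyl (S.ρaux .R2) n
    = -(besselJ' n (S.k .R2 * S.ρcyl) * hankel2 n (S.k .R2 * S.ρaux .R2)) :=
  if_neg S.lt_ρaux₂.not_gt

theorem ρaux₂_pos : 0 < S.ρaux .R2 := S.ρcyl_pos.trans S.lt_ρaux₂

theorem ρaux_pos (j : Region) : 0 < S.ρaux j := by
  cases j
  · exact S.ρaux₁_pos
  · exact S.ρaux₂_pos

theorem ρaux_ne_ρcyl (j : Region) : S.ρaux j ≠ S.ρcyl := by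
  cases j
  · exact S.ρaux₁_lt.ne
  · exact S.lt_ρaux₂.ne'

theorem tendsto_coefE_aux₁ : Tendsto (fun n : ℤ => coefE (S.k .R1) S.ρcyl (S.ρaux .R1) n
      / geomWeight 1 (S.ρaux .R1 / S.ρcyl) n) cofinite
    (𝓝 (Complex.I * ((1 / Real.pi : ℝ) : ℂ))) := by
  simp only [coefE_aux₁]
  exact tendsto_besselJ_mul_hankel2 (S.k_pos _) S.ρaux₁_pos S.ρcyl_pos

theorem tendsto_coefM_aux₁ : Tendsto (fun n : ℤ => coefM (S.k .R1) S.ρcyl (S.ρaux .R1) n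
      / geomWeight 0 (S.ρaux .R1 / S.ρcyl) n) cofinite
    (𝓝 (Complex.I * ((1 / (Real.pi * (S.k .R1 * S.ρcyl)) : ℝ) : ℂ))) := by
  simp only [coefM_aux₁]
  exact tendsto_besselJ_mul_hankel2' (S.k_pos _) S.ρaux₁_pos S.ρcyl_pos

theorem tendsto_coefE_aux₂ : Tendsto (fun n : ℤ => coefE (S.k .R2) S.ρcyl (S.ρaux .R2) n
      / geomWeight 1 (S.ρcyl / S.ρaux .R2) n) cofinite
    (𝓝 (Complex.I * ((1 / Real.pi : ℝ) : ℂ))) := by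
  simp only [coefE_aux₂]
  exact tendsto_besselJ_mul_hankel2 (S.k_pos _) S.ρcyl_pos S.ρaux₂_pos

theorem tendsto_coefM_aux₂ : Tendsto (fun n : ℤ => coefM (S.k .R2) S.ρcyl (S.ρaux .R2) n
      / geomWeight 0 (S.ρcyl / S.ρaux .R2) n) cofinite
    (𝓝 (Complex.I * ((-(1 / (Real.pi * (S.k .R2 * S.ρcyl))) : ℝ) : ℂ))) := by
  simp only [coefM_aux₂]
  exact tendsto_besselJ'_mul_hankel2 (S.k_pos _) S.ρcyl_pos S.ρaux₂_pos

/-- The determinant `Δ^{(n)}` of the transformed system, for all integers `n`. -/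
noncomputable def discSum (N : ℕ) (n : ℤ) : ℂ :=
  S.Z .R1 * aliasSum N (coefE (S.k .R1) S.ρcyl (S.ρaux .R1)) n
      * aliasSum N (coefM (S.k .R2) S.ρcyl (S.ρaux .R2)) n
    - S.Z .R2 * aliasSum N (coefM (S.k .R1) S.ρcyl (S.ρaux .R1)) n
      * aliasSum N (coefE (S.k .R2) S.ρcyl (S.ρaux .R2)) n

theorem B₁_eq {N : ℕ} (m : Fin N) :
    S.B₁ N m = aliasSum N (coefE (S.k .R1) S.ρcyl (S.ρaux .R1)) (m : ℕ) :=
  dft_eq_aliasSum (summable_coefE (S.k_pos _) S.ρcyl_pos.le (S.ρaux_pos _).le (S.ρaux_ne_ρcyl _))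
    (S.hasSum_kerE _ (S.ρaux_pos _).le (S.ρaux_ne_ρcyl _)) m.pos m

theorem B₂_eq {N : ℕ} (m : Fin N) :
    S.B₂ N m = aliasSum N (coefM (S.k .R1) S.ρcyl (S.ρaux .R1)) (m : ℕ) :=
  dft_eq_aliasSum (S.summable_coefM _ (S.ρaux_pos _).le (S.ρaux_ne_ρcyl _))
    (S.hasSum_kerM _ (S.ρaux_pos _).le (S.ρaux_ne_ρcyl _)) m.pos m

theorem B₃_eq {N : ℕ} (m : Fin N) :
    S.B₃ N m = aliasSum N (coefE (S.k .R2) S.ρcyl (S.ρaux .R2)) (m : ℕ) :=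
  dft_eq_aliasSum (summable_coefE (S.k_pos _) S.ρcyl_pos.le (S.ρaux_pos _).le (S.ρaux_ne_ρcyl _))
    (S.hasSum_kerE _ (S.ρaux_pos _).le (S.ρaux_ne_ρcyl _)) m.pos m

theorem B₄_eq {N : ℕ} (m : Fin N) :
    S.B₄ N m = aliasSum N (coefM (S.k .R2) S.ρcyl (S.ρaux .R2)) (m : ℕ) :=
  dft_eq_aliasSum (S.summable_coefM _ (S.ρaux_pos _).le (S.ρaux_ne_ρcyl _))
    (S.hasSum_kerM _ (S.ρaux_pos _).le (S.ρaux_ne_ρcyl _)) m.pos m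

theorem disc_eq {N : ℕ} (m : Fin N) : S.disc N m = S.discSum N (m : ℕ) := by
  rw [disc, discSum, B₁_eq, B₂_eq, B₃_eq, B₄_eq]

theorem discSum_add_period (N : ℕ) (n : ℤ) : S.discSum N (n + N) = S.discSum N n := by
  simp only [discSum, aliasSum_add_period]

/-- Without aliasing the determinant of the `n`-th system is a multiple of the denominator
`Δ_n` of the exact solution. -/
theorem tendsto_discSum (n : ℤ) :
    Tendsto (fun N => S.discSum N n) atTop (𝓝 (-(besselJ n (S.k .R1 * S.ρaux .R1)
      * hankel2 n (S.k .R2 * S.ρaux .R2) * S.den n))) := by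
  have hE : ∀ j, Summable (coefE (S.k j) S.ρcyl (S.ρaux j)) := fun j =>
    summable_coefE (S.k_pos _) S.ρcyl_pos.le (S.ρaux_pos _).le (S.ρaux_ne_ρcyl _)
  have hM : ∀ j, Summable (coefM (S.k j) S.ρcyl (S.ρaux j)) := fun j =>
    S.summable_coefM _ (S.ρaux_pos _).le (S.ρaux_ne_ρcyl _)
  have h := (((tendsto_aliasSum (hE .R1) n).const_mul (S.Z .R1 : ℂ)).mul
    (tendsto_aliasSum (hM .R2) n)).sub (((tendsto_aliasSum (hM .R1) n).const_mul
      (S.Z .R2 : ℂ)).mul (tendsto_aliasSum (hE .R2) n))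
  rw [coefE_aux₁, coefM_aux₁, coefE_aux₂, coefM_aux₂] at h
  refine (congrArg (fun z => Tendsto (fun N => S.discSum N n) atTop (𝓝 z)) ?_).mpr h
  rw [den]; ring

variable {S}

theorem discSum_limit_ne_zero (hres : ∀ n : ℤ, besselJ n (S.k .R1 * S.ρaux .R1) ≠ 0) (n : ℤ) :
    -(besselJ n (S.k .R1 * S.ρaux .R1) * hankel2 n (S.k .R2 * S.ρaux .R2) * S.den n) ≠ 0 :=
  neg_ne_zero.2 (mul_ne_zero (mul_ne_zero (by exact_mod_cast hres n)
    (hankel2_ne_zero n (mul_pos (S.k_pos _) S.ρaux₂_pos))) (S.den_ne_zero n))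

/-- The determinants of the transformed systems are bounded below, uniformly in `N`, by the size of
their unaliased parts. At high orders the two products in the determinant have real parts of equal
sign, so they do not cancel; at each of the remaining orders the determinant has a nonzero limit. -/
theorem exists_le_norm_discSum (hres : ∀ n : ℤ, besselJ n (S.k .R1 * S.ρaux .R1) ≠ 0) :
    ∃ κ > 0, ∀ᶠ N : ℕ in atTop, ∀ n : ℤ, 2 * n.natAbs ≤ N →
      κ * (geomWeight 1 (S.ρaux .R1 / S.ρcyl) n * geomWeight 0 (S.ρcyl / S.ρaux .R2) n)
        ≤ ‖S.discSum N n‖ := by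
  set x := S.ρaux .R1 / S.ρcyl with hx
  set y := S.ρcyl / S.ρaux .R2 with hy
  have hx0 : 0 < x := div_pos S.ρaux₁_pos S.ρcyl_pos
  have hx1 : x < 1 := (div_lt_one S.ρcyl_pos).2 S.ρaux₁_lt
  have hy0 : 0 < y := div_pos S.ρcyl_pos S.ρaux₂_pos
  have hy1 : y < 1 := (div_lt_one S.ρaux₂_pos).2 S.lt_ρaux₂
  have hk1 := S.k_pos .R1
  have hk2 := S.k_pos .R2
  have hZ1 := S.Z_pos .R1
  have hZ2 := S.Z_pos .R2
  have hc := S.ρcyl_pos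
  have hpi := Real.pi_pos
  -- the four families of coefficients have purely imaginary leading constants
  have T1 := tendsto_aliasSum_div hx0 hx1 S.tendsto_coefE_aux₁
  have T2 := tendsto_aliasSum_div hx0 hx1 S.tendsto_coefM_aux₁
  have T3 := tendsto_aliasSum_div hy0 hy1 S.tendsto_coefE_aux₂
  have T4 := tendsto_aliasSum_div hy0 hy1 S.tendsto_coefM_aux₂
  have reI : ∀ a b : ℝ, (Complex.I * (a : ℂ) * (Complex.I * (b : ℂ))).re = -(a * b) := by
    intro a b; simp
  have R14 := (Complex.continuous_re.tendsto _).comp (T1.mul T4)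
  have R23 := (Complex.continuous_re.tendsto _).comp (T2.mul T3)
  rw [reI] at R14 R23
  set γ : ℝ := -(1 / Real.pi * -(1 / (Real.pi * (S.k .R2 * S.ρcyl)))) with hγ
  have hγ0 : 0 < γ := by rw [hγ, mul_neg, neg_neg]; positivity
  have E14 := R14.eventually_const_lt (half_lt_self hγ0)
  have E23 := R23.eventually_lt_const (u := 0) (by rw [neg_lt_zero]; positivity)
  obtain ⟨M, hM⟩ := eventually_highOrders.1 (E14.and E23)
  -- each of the finitely many orders below `M` has a nonzero limit
  have hlow : ∃ κ > 0, ∀ n ∈ {n : ℤ | n.natAbs < M},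
      κ < ‖-(besselJ n (S.k .R1 * S.ρaux .R1) * hankel2 n (S.k .R2 * S.ρaux .R2)
        * S.den n : ℂ)‖ := by
    have hfin : {n : ℤ | n.natAbs < M}.Finite :=
      (Set.finite_Icc (-(M : ℤ)) M).subset fun n hn => by
        have : n.natAbs < M := hn
        rw [Set.mem_Icc]; omega
    have h1 := (eventually_all_finite (l := 𝓝[>] (0 : ℝ)) hfin (p := fun n κ =>
      κ < ‖-(besselJ n (S.k .R1 * S.ρaux .R1) * hankel2 n (S.k .R2 * S.ρaux .R2)
        * S.den n : ℂ)‖)).2 fun n _ =>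
      (eventually_lt_nhds (norm_pos_iff.2 (discSum_limit_ne_zero hres n))).filter_mono
        nhdsWithin_le_nhds
    obtain ⟨κ, h2, h3⟩ := (h1.and self_mem_nhdsWithin).exists
    exact ⟨κ, h3, h2⟩
  obtain ⟨κ, hκ, hlow⟩ := hlow
  have hlow' : ∀ᶠ N : ℕ in atTop, ∀ n ∈ {n : ℤ | n.natAbs < M}, κ < ‖S.discSum N n‖ := by
    have hfin : {n : ℤ | n.natAbs < M}.Finite :=
      (Set.finite_Icc (-(M : ℤ)) M).subset fun n hn => by
        have : n.natAbs < M := hn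
        rw [Set.mem_Icc]; omega
    exact (eventually_all_finite hfin).2 fun n hn =>
      (S.tendsto_discSum n).norm.eventually_const_lt (hlow n hn)
  refine ⟨min κ (S.Z .R1 * (γ / 2)), lt_min hκ (by positivity), ?_⟩
  filter_upwards [hlow', eventually_gt_atTop 0] with N hN hN0 n hn
  have g1 := geomWeight_pos (s := 1) hx0 n
  have g4 := geomWeight_pos (s := 0) hy0 n
  by_cases hnM : n.natAbs < M
  · refine le_trans ?_ (hN n hnM).le
    have b1 : geomWeight 1 x n ≤ 1 :=
      (geomWeight_le_pow hx0.le n).trans (pow_le_one₀ hx0.le hx1.le)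
    have b4 : geomWeight 0 y n ≤ 1 :=
      (geomWeight_le_pow hy0.le n).trans (pow_le_one₀ hy0.le hy1.le)
    calc min κ (S.Z .R1 * (γ / 2)) * (geomWeight 1 x n * geomWeight 0 y n)
        ≤ κ * (1 * 1) := by
          gcongr
          exact min_le_left _ _
      _ = κ := by ring
  · obtain ⟨h14, h23⟩ := hM N n (not_lt.1 hnM) hn
    simp only [Function.comp] at h14 h23
    have W : ∀ {s : ℕ} {q : ℝ}, 0 < q → q < 1 → geomWeight s q n ≤ aliasWeight s q N n :=
      fun hq0 hq => geomWeight_le_aliasWeight hq0 hq hN0 n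
    have W1 := W (s := 1) hx0 hx1
    have W4 := W (s := 0) hy0 hy1
    have p1 := g1.trans_le W1
    have p4 := g4.trans_le W4
    have p2 := (geomWeight_pos (s := 0) hx0 n).trans_le (W (s := 0) hx0 hx1)
    have p3 := (geomWeight_pos (s := 1) hy0 n).trans_le (W (s := 1) hy0 hy1)
    set w1 := aliasWeight 1 x N n
    set w2 := aliasWeight 0 x N n
    set w3 := aliasWeight 1 y N n
    set w4 := aliasWeight 0 y N n
    have q1 : (w1 : ℂ) ≠ 0 := by exact_mod_cast p1.ne'
    have q2 : (w2 : ℂ) ≠ 0 := by exact_mod_cast p2.ne'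
    have q3 : (w3 : ℂ) ≠ 0 := by exact_mod_cast p3.ne'
    have q4 : (w4 : ℂ) ≠ 0 := by exact_mod_cast p4.ne'
    have e : S.discSum N n
        = ((S.Z .R1 * (w1 * w4) : ℝ) : ℂ)
            * (aliasSum N (coefE (S.k .R1) S.ρcyl (S.ρaux .R1)) n / w1
              * (aliasSum N (coefM (S.k .R2) S.ρcyl (S.ρaux .R2)) n / w4))
          - ((S.Z .R2 * (w2 * w3) : ℝ) : ℂ)
            * (aliasSum N (coefM (S.k .R1) S.ρcyl (S.ρaux .R1)) n / w2
              * (aliasSum N (coefE (S.k .R2) S.ρcyl (S.ρaux .R2)) n / w3)) := by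
      rw [discSum]; push_cast; field_simp
    refine le_trans ?_ (Complex.re_le_norm _)
    rw [e, Complex.sub_re, Complex.re_ofReal_mul, Complex.re_ofReal_mul]
    have f1 : S.Z .R1 * (w1 * w4) * (γ / 2) ≤ S.Z .R1 * (w1 * w4)
        * (aliasSum N (coefE (S.k .R1) S.ρcyl (S.ρaux .R1)) n / w1
              * (aliasSum N (coefM (S.k .R2) S.ρcyl (S.ρaux .R2)) n / w4)).re :=
      mul_le_mul_of_nonneg_left h14.le (by positivity)
    have f2 : S.Z .R2 * (w2 * w3) * (aliasSum N (coefM (S.k .R1) S.ρcyl (S.ρaux .R1)) n / w2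
              * (aliasSum N (coefE (S.k .R2) S.ρcyl (S.ρaux .R2)) n / w3)).re ≤ 0 :=
      mul_nonpos_of_nonneg_of_nonpos (by positivity) h23.le
    have f3 : min κ (S.Z .R1 * (γ / 2)) * (geomWeight 1 x n * geomWeight 0 y n)
        ≤ S.Z .R1 * (γ / 2) * (w1 * w4) := by
      gcongr
      exact min_le_right _ _
    linarith

theorem eventually_disc_ne_zero (hres : ∀ n : ℤ, besselJ n (S.k .R1 * S.ρaux .R1) ≠ 0) :
    ∀ᶠ N : ℕ in atTop, ∀ m : Fin N, S.disc N m ≠ 0 := by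
  obtain ⟨κ, hκ, h⟩ := exists_le_norm_discSum hres
  have hx0 : 0 < S.ρaux .R1 / S.ρcyl := div_pos S.ρaux₁_pos S.ρcyl_pos
  have hy0 : 0 < S.ρcyl / S.ρaux .R2 := div_pos S.ρcyl_pos S.ρaux₂_pos
  filter_upwards [h] with N hN m
  have key : ∀ n : ℤ, 2 * n.natAbs ≤ N → S.discSum N n ≠ 0 := fun n hn =>
    norm_pos_iff.1 (lt_of_lt_of_le (mul_pos hκ (mul_pos (geomWeight_pos hx0 n)
      (geomWeight_pos hy0 n))) (hN n hn))
  rw [disc_eq]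
  -- the representative of the residue class of least modulus
  by_cases hm : 2 * (m : ℕ) ≤ N
  · exact key _ (by simpa using hm)
  · have := key (((m : ℕ) : ℤ) - N) (by have := m.2; omega)
    rwa [← discSum_add_period, sub_add_cancel] at this

end Cylinder

/-! ### Limits of the normalized discrete currents -/

namespace Cylinder

variable {S : Cylinder}

theorem D_eq {e : Region} (hfil : 0 ≤ S.ρfil) (hne : S.ρfil ≠ S.ρaux e) {N : ℕ} (m : Fin N) :
    S.D e N m = -aliasSum N (coefE (S.k e) (S.ρaux e) S.ρfil) (m : ℕ) := by
  rw [D, dft_eq_aliasSum (summable_coefE (S.k_pos e) (S.ρaux_pos e).le hfil hne)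
    (hasSum_hankel2_polarDist (S.k_pos e) (S.ρaux_pos e).le hfil hne) m.pos m]

theorem ρfil_nonneg {e : Region} (h : S.InRegion e S.ρfil) : 0 ≤ S.ρfil := by
  cases e
  · exact (S.ρcyl_pos.trans h).le
  · exact h.1

theorem ρfil_ne_ρaux {e : Region} (h : S.InRegion e S.ρfil) : S.ρfil ≠ S.ρaux e := by
  cases e
  · exact (S.ρaux₁_lt.trans h).ne'
  · exact (h.2.trans S.lt_ρaux₂).ne

theorem ρ_ne_ρcyl {j : Region} {ρ : ℝ} (h : S.InRegion j ρ) : ρ ≠ S.ρcyl := by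
  cases j
  · exact (show S.ρcyl < ρ from h).ne'
  · exact h.2.ne

theorem nonneg_of_inRegion {j : Region} {ρ : ℝ} (h : S.InRegion j ρ) : 0 ≤ ρ := by
  cases j
  · exact (S.ρcyl_pos.trans h).le
  · exact h.1

theorem coefE_fil₁ (h : S.ρcyl < S.ρfil) (n : ℤ) : coefE (S.k .R1) (S.ρaux .R1) S.ρfil n
    = besselJ n (S.k .R1 * S.ρaux .R1) * hankel2 n (S.k .R1 * S.ρfil) :=
  if_neg (S.ρaux₁_lt.trans h).not_gt

theorem coefE_fil₂ (h : S.ρfil < S.ρcyl) (n : ℤ) : coefE (S.k .R2) (S.ρaux .R2) S.ρfil n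
    = besselJ n (S.k .R2 * S.ρfil) * hankel2 n (S.k .R2 * S.ρaux .R2) :=
  if_pos (h.trans S.lt_ρaux₂)

/-- For external excitation the transformed currents decay like `(ρcyl / ρfil)^{|n|}`. -/
theorem exists_norm_quotient_le₁ (hres : ∀ n : ℤ, besselJ n (S.k .R1 * S.ρaux .R1) ≠ 0)
    (hfil : S.ρcyl < S.ρfil) {s : ℕ} {b : ℤ → ℂ}
    (hb : ∃ C : ℝ, ∀ n, ‖b n‖ ≤ C * geomWeight s (S.ρcyl / S.ρaux .R2) n) :
    ∃ u : ℤ → ℝ, Summable u ∧ ∀ᶠ N : ℕ in atTop, ∀ n : ℤ, 2 * n.natAbs ≤ N →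
      ‖aliasSum N (coefE (S.k .R1) (S.ρaux .R1) S.ρfil) n * aliasSum N b n / S.discSum N n‖
        ≤ u n := by
  have hk := S.k_pos .R1
  have h0 := S.ρaux₁_pos
  have hc := S.ρcyl_pos
  have hf := hc.trans hfil
  have hd : ∃ C : ℝ, ∀ n, ‖coefE (S.k .R1) (S.ρaux .R1) S.ρfil n‖
      ≤ C * geomWeight (1 + 0) (S.k .R1 * S.ρaux .R1 / (S.k .R1 * S.ρfil)) n := by
    simp only [coefE_fil₁ hfil]
    exact exists_norm_besselJ_mul_hankel2_le (mul_pos hk h0).le le_rfl (mul_pos hk hf)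
  rw [mul_div_mul_left _ _ hk.ne'] at hd
  obtain ⟨C, hC⟩ := exists_norm_quotient_le (div_pos h0 hc) (div_pos hc S.ρaux₂_pos)
    ((div_lt_one S.ρaux₂_pos).2 S.lt_ρaux₂) (div_pos h0 hf)
    ((div_lt_one hf).2 (S.ρaux₁_lt.trans hfil)) 1 0 s hd hb (exists_le_norm_discSum hres)
  refine ⟨_, (summable_pow_natAbs ?_ ?_).mul_left C, hC⟩
  · positivity
  · rw [div_div_div_cancel_left' _ _ h0.ne', div_lt_one hf]
    exact hfil

/-- For internal excitation the transformed currents decay like `(r / ρcyl)^{|n|}` for every radius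
`r` between `ρfil` and `ρcyl`. -/
theorem exists_norm_quotient_le₂ (hres : ∀ n : ℤ, besselJ n (S.k .R1 * S.ρaux .R1) ≠ 0)
    (hfil0 : 0 ≤ S.ρfil) (hfil : S.ρfil < S.ρcyl) {s : ℕ} {b : ℤ → ℂ}
    (hb : ∃ C : ℝ, ∀ n, ‖b n‖ ≤ C * geomWeight s (S.ρaux .R1 / S.ρcyl) n) :
    ∃ u : ℤ → ℝ, Summable u ∧ ∀ᶠ N : ℕ in atTop, ∀ n : ℤ, 2 * n.natAbs ≤ N →
      ‖aliasSum N (coefE (S.k .R2) (S.ρaux .R2) S.ρfil) n * aliasSum N b n / S.discSum N n‖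
        ≤ u n := by
  have hk := S.k_pos .R2
  have h0 := S.ρaux₁_pos
  have hc := S.ρcyl_pos
  have h2 := S.ρaux₂_pos
  -- the filament may lie on the axis, hence the comparison with a positive radius
  obtain ⟨r, hr1, hr2⟩ := exists_between hfil
  have hr0 : 0 < r := hfil0.trans_lt hr1
  have hd : ∃ C : ℝ, ∀ n, ‖coefE (S.k .R2) (S.ρaux .R2) S.ρfil n‖
      ≤ C * geomWeight (1 + 0) (S.k .R2 * r / (S.k .R2 * S.ρaux .R2)) n := by
    simp only [coefE_fil₂ hfil]
    exact exists_norm_besselJ_mul_hankel2_le (mul_nonneg hk.le hfil0)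
      (mul_le_mul_of_nonneg_left hr1.le hk.le) (mul_pos hk h2)
  rw [mul_div_mul_left _ _ hk.ne'] at hd
  have hE : ∃ κ > 0, ∀ᶠ N : ℕ in atTop, ∀ n : ℤ, 2 * n.natAbs ≤ N →
      κ * (geomWeight 1 (S.ρcyl / S.ρaux .R2) n * geomWeight 0 (S.ρaux .R1 / S.ρcyl) n)
        ≤ ‖S.discSum N n‖ := by
    obtain ⟨κ, hκ, h⟩ := exists_le_norm_discSum hres
    refine ⟨κ, hκ, h.mono fun N hN n hn => le_trans (le_of_eq ?_) (hN n hn)⟩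
    simp only [geomWeight]; ring
  obtain ⟨C, hC⟩ := exists_norm_quotient_le (div_pos hc h2) (div_pos h0 hc)
    ((div_lt_one hc).2 S.ρaux₁_lt) (div_pos hr0 h2)
    ((div_lt_one h2).2 (hr2.trans S.lt_ρaux₂)) 1 0 s hd hb hE
  refine ⟨_, (summable_pow_natAbs ?_ ?_).mul_left C, hC⟩
  · positivity
  · rw [div_div_div_cancel_right₀ h2.ne', div_lt_one hc]
    exact hr2

/-- Discrete currents whose transforms are quotients of aliased sums by the determinant converge
uniformly to the Fourier series with the unaliased quotients as coefficients. -/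
theorem tendsto_invDFT_uniform (hres : ∀ n : ℤ, besselJ n (S.k .R1 * S.ρaux .R1) ≠ 0)
    {d b : ℤ → ℂ} (hd : Summable d) (hb : Summable b) (α : ℂ) {u : ℤ → ℝ} (hu : Summable u)
    (hbound : ∀ᶠ N : ℕ in atTop, ∀ n : ℤ, 2 * n.natAbs ≤ N →
      ‖aliasSum N d n * aliasSum N b n / S.discSum N n‖ ≤ u n)
    {L : ℤ → ℂ} (hL : ∀ n, α * (d n * b n / -(besselJ n (S.k .R1 * S.ρaux .R1)
      * hankel2 n (S.k .R2 * S.ρaux .R2) * S.den n)) = L n)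
    {g : (N : ℕ) → Fin N → ℂ} (hg : ∀ N (m : Fin N), (N : ℂ) * g N m / (2 * Real.pi * S.ρcyl)
      = α * (aliasSum N d (m : ℕ) * aliasSum N b (m : ℕ) / S.discSum N (m : ℕ))) :
    Summable L ∧ ∀ δ : ℝ, 0 < δ → ∀ᶠ N : ℕ in atTop, ∀ l : Fin N,
      ‖(N : ℂ) * invDFT (g N) l / (2 * Real.pi * S.ρcyl)
        - ∑' n, L n * fourierMode n (angle N (l : ℕ))‖ < δ := by
  have h := tendsto_sum_fourierMode_uniform
    (F := fun N n => α * (aliasSum N d n * aliasSum N b n / S.discSum N n)) (L := L)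
    (b := fun n => ‖α‖ * u n)
    (fun N n => by simp only [aliasSum_add_period, discSum_add_period])
    (fun n => by
      rw [← hL]
      exact (((tendsto_aliasSum hd n).mul (tendsto_aliasSum hb n)).div (S.tendsto_discSum n)
        (discSum_limit_ne_zero hres n)).const_mul α)
    (hu.mul_left _)
    (hbound.mono fun N hN n hn => by
      rw [norm_mul]
      exact mul_le_mul_of_nonneg_left (hN n hn) (norm_nonneg _))
  refine ⟨Summable.of_norm_bounded (hu.mul_left ‖α‖) h.1, fun δ hδ => ?_⟩
  filter_upwards [h.2 δ hδ] with N hN l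
  have e : (N : ℂ) * invDFT (g N) l / (2 * Real.pi * S.ρcyl)
      = ∑ m : Fin N, α * (aliasSum N d (m : ℕ) * aliasSum N b (m : ℕ) / S.discSum N (m : ℕ))
        * fourierMode (m : ℕ) (angle N (l : ℕ)) := by
    rw [invDFT_eq, Finset.mul_sum, Finset.sum_div]
    refine Finset.sum_congr rfl fun m _ => ?_
    rw [← hg]; ring
  rw [e]
  exact hN l

/-- The normalized discrete currents converge uniformly at the sample points to the continuous
densities, whose coefficients are absolutely summable as limits of dominated quotients. -/
theorem current_limits {e : Region} (hfil : S.InRegion e S.ρfil)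
    (hres : ∀ n : ℤ, besselJ n (S.k .R1 * S.ρaux .R1) ≠ 0) :
    (Summable (S.JCoeff e) ∧ ∀ δ : ℝ, 0 < δ → ∀ᶠ N : ℕ in atTop, ∀ l : Fin N,
      ‖(N : ℂ) * invDFT (S.dftI e N) l / (2 * Real.pi * S.ρcyl) - S.Jz e (angle N (l : ℕ))‖ < δ) ∧
    (Summable (S.MCoeff e) ∧ ∀ δ : ℝ, 0 < δ → ∀ᶠ N : ℕ in atTop, ∀ l : Fin N,
      ‖(N : ℂ) * invDFT (S.dftK e N) l / (2 * Real.pi * S.ρcyl)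
        - S.Mφ e (angle N (l : ℕ))‖ < δ) := by
  have hsE : ∀ j, Summable (coefE (S.k j) S.ρcyl (S.ρaux j)) := fun j =>
    summable_coefE (S.k_pos _) S.ρcyl_pos.le (S.ρaux_pos _).le (S.ρaux_ne_ρcyl _)
  have hsM : ∀ j, Summable (coefM (S.k j) S.ρcyl (S.ρaux j)) := fun j =>
    S.summable_coefM _ (S.ρaux_pos _).le (S.ρaux_ne_ρcyl _)
  have hsD := summable_coefE (S.k_pos e) (S.ρaux_pos e).le (ρfil_nonneg hfil) (ρfil_ne_ρaux hfil)
  have hD := fun {N : ℕ} (m : Fin N) => D_eq (ρfil_nonneg hfil) (ρfil_ne_ρaux hfil) m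
  have hx0 : 0 < S.ρaux .R1 / S.ρcyl := div_pos S.ρaux₁_pos S.ρcyl_pos
  have hy0 : 0 < S.ρcyl / S.ρaux .R2 := div_pos S.ρcyl_pos S.ρaux₂_pos
  have hN0 : ∀ {N : ℕ} (_ : Fin N), (N : ℂ) ≠ 0 := fun m => by exact_mod_cast m.pos.ne'
  have hJ : ∀ n : ℤ, (besselJ n (S.k .R1 * S.ρaux .R1) : ℂ) ≠ 0 := fun n => by
    exact_mod_cast hres n
  have hH : ∀ n : ℤ, hankel2 n (S.k .R2 * S.ρaux .R2) ≠ 0 := fun n =>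
    hankel2_ne_zero n (mul_pos (S.k_pos _) S.ρaux₂_pos)
  have hden := S.den_ne_zero
  have hpi : (Real.pi : ℂ) ≠ 0 := by exact_mod_cast Real.pi_ne_zero
  have hc : (S.ρcyl : ℂ) ≠ 0 := by exact_mod_cast S.ρcyl_pos.ne'
  cases e
  · have hfil' : S.ρcyl < S.ρfil := hfil
    constructor
    · obtain ⟨u, hu, hub⟩ := exists_norm_quotient_le₁ hres hfil'
        (exists_norm_le_geomWeight hy0 S.tendsto_coefM_aux₂)
      refine tendsto_invDFT_uniform hres hsD (hsM .R2) (-S.I * S.Z .R1 / (2 * Real.pi * S.ρcyl))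
        hu hub (fun n => ?_) (fun N m => ?_)
      · have := hJ n; have := hH n; have := hden n
        rw [coefE_fil₁ hfil', coefM_aux₂, JCoeff]
        field_simp
      · have := hN0 m
        rw [dftI, hD, B₄_eq, disc_eq]
        field_simp
    · obtain ⟨u, hu, hub⟩ := exists_norm_quotient_le₁ hres hfil'
        (exists_norm_le_geomWeight hy0 S.tendsto_coefE_aux₂)
      refine tendsto_invDFT_uniform hres hsD (hsE .R2)
        (-S.I * Complex.I * S.Z .R1 * S.Z .R2 / (2 * Real.pi * S.ρcyl))
        hu hub (fun n => ?_) (fun N m => ?_)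
      · have := hJ n; have := hH n; have := hden n
        rw [coefE_fil₁ hfil', coefE_aux₂, MCoeff]
        field_simp
      · have := hN0 m
        rw [dftK, hD, B₃_eq, disc_eq]
        field_simp
  · obtain ⟨hfil0, hfil'⟩ := hfil
    constructor
    · obtain ⟨u, hu, hub⟩ := exists_norm_quotient_le₂ hres hfil0 hfil'
        (exists_norm_le_geomWeight hx0 S.tendsto_coefM_aux₁)
      refine tendsto_invDFT_uniform hres hsD (hsM .R1) (-S.I * S.Z .R2 / (2 * Real.pi * S.ρcyl))
        hu hub (fun n => ?_) (fun N m => ?_)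
      · have := hJ n; have := hH n; have := hden n
        rw [coefE_fil₂ hfil', coefM_aux₁, JCoeff]
        field_simp
      · have := hN0 m
        rw [dftI, hD, B₂_eq, disc_eq]
        field_simp
    · obtain ⟨u, hu, hub⟩ := exists_norm_quotient_le₂ hres hfil0 hfil'
        (exists_norm_le_geomWeight hx0 S.tendsto_coefE_aux₁)
      refine tendsto_invDFT_uniform hres hsD (hsE .R1)
        (-S.I * Complex.I * S.Z .R1 * S.Z .R2 / (2 * Real.pi * S.ρcyl))
        hu hub (fun n => ?_) (fun N m => ?_)
      · have := hJ n; have := hH n; have := hden n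
        rw [coefE_fil₂ hfil', coefE_aux₁, MCoeff]
        field_simp
      · have := hN0 m
        rw [dftK, hD, B₁_eq, disc_eq]
        field_simp

end Cylinder

/-! ### Fields of the surface currents -/

theorem hasSum_tsum_fourierMode {c : ℤ → ℂ} (hc : Summable c) (θ : ℝ) :
    HasSum (fun n => c n * fourierMode n θ) (∑' n, c n * fourierMode n θ) :=
  Summable.hasSum (Summable.of_norm
    (hc.norm.congr fun n => by rw [norm_mul, norm_fourierMode, mul_one]))

theorem continuous_tsum_fourierMode {c : ℤ → ℂ} (hc : Summable c) :
    Continuous fun θ => ∑' n, c n * fourierMode n θ :=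
  continuous_tsum (fun n => continuous_const.mul (continuous_fourierMode n)) hc.norm
    fun n θ => by rw [norm_mul, norm_fourierMode, mul_one]

namespace Cylinder

variable {S : Cylinder}

/-- The `n`-th Fourier coefficient of the field radiated by `J_z^s` and `M_φ^s` in the equivalent
problem of region `j`. -/
noncomputable def radCoeff (S : Cylinder) (e j : Region) (ρ : ℝ) (n : ℤ) : ℂ :=
  j.sgn * (Real.pi * S.ρcyl * S.k j / 2)
    * (-(S.Z j * S.JCoeff e n * coefE (S.k j) S.ρcyl ρ n)
      - Complex.I * S.MCoeff e n * coefM (S.k j) S.ρcyl ρ n)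

theorem hasSum_contField {e j : Region} (hJ : Summable (S.JCoeff e)) (hM : Summable (S.MCoeff e))
    {ρ : ℝ} (hρ : 0 ≤ ρ) (hne : ρ ≠ S.ρcyl) (φ : ℝ) :
    HasSum (fun n => S.radCoeff e j ρ n * fourierMode n φ)
      (S.contField e j (S.Jz e) (S.Mφ e) ρ φ - S.incField e j ρ φ) := by
  have hsE := summable_coefE (S.k_pos j) S.ρcyl_pos.le hρ hne
  have hsM := S.summable_coefM j hρ hne
  have sJ : Summable fun n => S.JCoeff e n * coefE (S.k j) S.ρcyl ρ (-n) * fourierMode n φ := by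
    obtain ⟨C, hC⟩ := hsE.norm.tendsto_cofinite_zero.bddAbove_range_of_cofinite
    refine Summable.of_norm_bounded (hJ.norm.mul_right C) fun n => ?_
    rw [norm_mul, norm_mul, norm_fourierMode, mul_one, coefE_neg]
    exact mul_le_mul_of_nonneg_left (hC (Set.mem_range_self n)) (norm_nonneg _)
  have sM : Summable fun n => S.MCoeff e n * coefM (S.k j) S.ρcyl ρ (-n) * fourierMode n φ := by
    obtain ⟨C, hC⟩ := hsM.norm.tendsto_cofinite_zero.bddAbove_range_of_cofinite
    refine Summable.of_norm_bounded (hM.norm.mul_right C) fun n => ?_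
    rw [norm_mul, norm_mul, norm_fourierMode, mul_one, coefM_neg]
    exact mul_le_mul_of_nonneg_left (hC (Set.mem_range_self n)) (norm_nonneg _)
  have h := ((sJ.hasSum.mul_left (-((S.k j * S.Z j * S.ρcyl / 4 : ℝ) : ℂ) * (2 * Real.pi))).add
    (sM.hasSum.mul_left (((S.k j * S.ρcyl : ℝ) : ℂ) / (4 * Complex.I) * (2 * Real.pi)))).mul_left
      j.sgn
  rw [mul_assoc _ (2 * Real.pi : ℂ), mul_assoc _ (2 * Real.pi : ℂ),
    ← integral_convolution hJ hsE (hasSum_tsum_fourierMode hJ) (S.hasSum_kerE j hρ hne),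
    ← integral_convolution hM hsM (hasSum_tsum_fourierMode hM) (S.hasSum_kerM j hρ hne)] at h
  rw [contField, add_sub_cancel_left]
  refine h.congr_fun fun n => ?_
  rw [radCoeff, coefE_neg, coefM_neg, mul_comm 4 Complex.I, ← div_div, Complex.div_I]
  push_cast
  ring

/-- The radiated field for external excitation, with the imaginary units of the coefficients
eliminated. -/
theorem radCoeff_R1 (j : Region) (ρ : ℝ) (n : ℤ) : S.radCoeff .R1 j ρ n
    = j.sgn * (S.k j * S.I * S.Z .R1 / 4) * hankel2 n (S.k .R1 * S.ρfil) / S.den n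
      * (S.Z j * besselJ' n (S.k .R2 * S.ρcyl) * coefE (S.k j) S.ρcyl ρ n
        + S.Z .R2 * besselJ n (S.k .R2 * S.ρcyl) * coefM (S.k j) S.ρcyl ρ n) := by
  have hpi : (Real.pi : ℂ) ≠ 0 := by exact_mod_cast Real.pi_ne_zero
  have hc : (S.ρcyl : ℂ) ≠ 0 := by exact_mod_cast S.ρcyl_pos.ne'
  have hq : Real.pi * S.ρcyl * (S.I / (2 * Real.pi * S.ρcyl)) = S.I / 2 := by field_simp
  rw [radCoeff, JCoeff, MCoeff, neg_div]
  set q := S.I / (2 * Real.pi * S.ρcyl)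
  linear_combination (j.sgn * S.k j / 2 * S.Z .R1 * hankel2 n (S.k .R1 * S.ρfil) / S.den n
      * (S.Z j * besselJ' n (S.k .R2 * S.ρcyl) * coefE (S.k j) S.ρcyl ρ n
        + S.Z .R2 * besselJ n (S.k .R2 * S.ρcyl) * coefM (S.k j) S.ρcyl ρ n)) * hq
    - (j.sgn * (Real.pi * S.ρcyl * S.k j / 2) * q * S.Z .R1 * S.Z .R2
      * hankel2 n (S.k .R1 * S.ρfil) * besselJ n (S.k .R2 * S.ρcyl) / S.den n
      * coefM (S.k j) S.ρcyl ρ n) * Complex.I_mul_I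

/-- The radiated field for internal excitation, with the imaginary units of the coefficients
eliminated. -/
theorem radCoeff_R2 (j : Region) (ρ : ℝ) (n : ℤ) : S.radCoeff .R2 j ρ n
    = j.sgn * (S.k j * S.I * S.Z .R2 / 4) * besselJ n (S.k .R2 * S.ρfil) / S.den n
      * (S.Z j * hankel2' n (S.k .R1 * S.ρcyl) * coefE (S.k j) S.ρcyl ρ n
        + S.Z .R1 * hankel2 n (S.k .R1 * S.ρcyl) * coefM (S.k j) S.ρcyl ρ n) := by
  have hpi : (Real.pi : ℂ) ≠ 0 := by exact_mod_cast Real.pi_ne_zero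
  have hc : (S.ρcyl : ℂ) ≠ 0 := by exact_mod_cast S.ρcyl_pos.ne'
  have hq : Real.pi * S.ρcyl * (S.I / (2 * Real.pi * S.ρcyl)) = S.I / 2 := by field_simp
  rw [radCoeff, JCoeff, MCoeff, neg_div]
  set q := S.I / (2 * Real.pi * S.ρcyl)
  linear_combination (j.sgn * S.k j / 2 * S.Z .R2 * besselJ n (S.k .R2 * S.ρfil) / S.den n
      * (S.Z j * hankel2' n (S.k .R1 * S.ρcyl) * coefE (S.k j) S.ρcyl ρ n
        + S.Z .R1 * hankel2 n (S.k .R1 * S.ρcyl) * coefM (S.k j) S.ρcyl ρ n)) * hq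
    - (j.sgn * (Real.pi * S.ρcyl * S.k j / 2) * q * S.Z .R1 * S.Z .R2
      * besselJ n (S.k .R2 * S.ρfil) * hankel2 n (S.k .R1 * S.ρcyl) / S.den n
      * coefM (S.k j) S.ρcyl ρ n) * Complex.I_mul_I

theorem k_mul_wronskian (j : Region) (n : ℤ) :
    S.k j * (besselJ n (S.k j * S.ρcyl) * hankel2' n (S.k j * S.ρcyl)
      - besselJ' n (S.k j * S.ρcyl) * hankel2 n (S.k j * S.ρcyl))
      = -Complex.I * (2 / (Real.pi * S.ρcyl)) := by
  have hpi : (Real.pi : ℂ) ≠ 0 := by exact_mod_cast Real.pi_ne_zero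
  have hc : (S.ρcyl : ℂ) ≠ 0 := by exact_mod_cast S.ρcyl_pos.ne'
  have hk : (S.k j : ℂ) ≠ 0 := by exact_mod_cast (S.k_pos j).ne'
  rw [besselJ_hankel2_wronskian n (mul_pos (S.k_pos j) S.ρcyl_pos)]
  push_cast
  field_simp

/-- The radiated field is the exact one, order by order. In the region without the filament this
is the Wronskian on the cylinder. -/
theorem radCoeff_eq_exactTerm {e j : Region} {ρ : ℝ} (h : S.InRegion j ρ) (φ : ℝ) (n : ℤ) :
    S.radCoeff e j ρ n * fourierMode n φ = S.exactTerm e j ρ φ n := by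
  cases j
  · have hE : coefE (S.k .R1) S.ρcyl ρ n
        = besselJ n (S.k .R1 * S.ρcyl) * hankel2 n (S.k .R1 * ρ) := if_neg (not_lt.2 (le_of_lt h))
    have hM : coefM (S.k .R1) S.ρcyl ρ n
        = -(besselJ' n (S.k .R1 * S.ρcyl) * hankel2 n (S.k .R1 * ρ)) :=
      if_neg (not_lt.2 (le_of_lt h))
    cases e
    · rw [radCoeff_R1, hE, hM, exactTerm, Region.sgn, fourierMode]
      push_cast
      ring
    · rw [radCoeff_R2, hE, hM, exactTerm, Region.sgn, fourierMode]
      linear_combination (S.I * S.Z .R1 * S.Z .R2 / 4 * besselJ n (S.k .R2 * S.ρfil)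
        * hankel2 n (S.k .R1 * ρ) / S.den n * Complex.exp (Complex.I * n * φ))
          * k_mul_wronskian (S := S) .R1 n
  · have hE : coefE (S.k .R2) S.ρcyl ρ n
        = besselJ n (S.k .R2 * ρ) * hankel2 n (S.k .R2 * S.ρcyl) := if_pos h.2
    have hM : coefM (S.k .R2) S.ρcyl ρ n
        = -(besselJ n (S.k .R2 * ρ) * hankel2' n (S.k .R2 * S.ρcyl)) := if_pos h.2
    cases e
    · rw [radCoeff_R1, hE, hM, exactTerm, Region.sgn, fourierMode]
      linear_combination (S.I * S.Z .R1 * S.Z .R2 / 4 * hankel2 n (S.k .R1 * S.ρfil)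
        * besselJ n (S.k .R2 * ρ) / S.den n * Complex.exp (Complex.I * n * φ))
          * k_mul_wronskian (S := S) .R2 n
    · rw [radCoeff_R2, hE, hM, exactTerm, Region.sgn, fourierMode]
      push_cast
      ring

open Classical in
/-- On the auxiliary circles the radiated field cancels the incident one, order by order. -/
theorem radCoeff_aux {e : Region} (hfil : S.InRegion e S.ρfil) (j : Region) (n : ℤ) :
    S.radCoeff e j (S.ρaux j) n = if j = e then
      ((S.k j * S.Z j / 4 : ℝ) : ℂ) * S.I * coefE (S.k j) (S.ρaux j) S.ρfil n else 0 := by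
  have hden : (S.den n)⁻¹ * (S.Z .R1 * hankel2 n (S.k .R1 * S.ρcyl)
      * besselJ' n (S.k .R2 * S.ρcyl)
      - S.Z .R2 * besselJ n (S.k .R2 * S.ρcyl) * hankel2' n (S.k .R1 * S.ρcyl)) = 1 :=
    inv_mul_cancel₀ (S.den_ne_zero n)
  cases e <;> cases j
  · rw [radCoeff_R1, coefE_aux₁, coefM_aux₁, if_pos rfl, coefE_fil₁ hfil, Region.sgn]
    push_cast
    linear_combination (S.k .R1 * S.Z .R1 / 4 * S.I * besselJ n (S.k .R1 * S.ρaux .R1)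
      * hankel2 n (S.k .R1 * S.ρfil)) * hden
  · rw [radCoeff_R1, coefE_aux₂, coefM_aux₂, if_neg (by simp)]
    ring
  · rw [radCoeff_R2, coefE_aux₁, coefM_aux₁, if_neg (by simp)]
    ring
  · rw [radCoeff_R2, coefE_aux₂, coefM_aux₂, if_pos rfl, coefE_fil₂ hfil.2, Region.sgn]
    push_cast
    linear_combination (S.k .R2 * S.Z .R2 / 4 * S.I * besselJ n (S.k .R2 * S.ρfil)
      * hankel2 n (S.k .R2 * S.ρaux .R2)) * hden

theorem contField_aux {e : Region} (hfil : S.InRegion e S.ρfil) (hJ : Summable (S.JCoeff e))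
    (hM : Summable (S.MCoeff e)) (j : Region) (φ : ℝ) :
    S.contField e j (S.Jz e) (S.Mφ e) (S.ρaux j) φ = 0 := by
  classical
  have h := hasSum_contField (j := j) hJ hM (S.ρaux_pos j).le (S.ρaux_ne_ρcyl j) φ
  simp only [radCoeff_aux hfil] at h
  by_cases hj : j = e
  · subst hj
    have h2 := (hasSum_hankel2_polarDist (S.k_pos j) (S.ρaux_pos j).le (ρfil_nonneg hfil)
      (ρfil_ne_ρaux hfil) φ).mul_left (((S.k j * S.Z j / 4 : ℝ) : ℂ) * S.I)
    simp only [if_true, mul_assoc] at h h2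
    have h3 := h.unique h2
    rw [incField, if_pos rfl, filField] at h3
    linear_combination h3
  · simp only [if_neg hj, zero_mul] at h
    have h3 := h.unique hasSum_zero
    rw [incField, if_neg hj, sub_zero] at h3
    exact h3

theorem hasSum_exactTerm {e j : Region} (hJ : Summable (S.JCoeff e)) (hM : Summable (S.MCoeff e))
    {ρ : ℝ} (h : S.InRegion j ρ) (φ : ℝ) :
    HasSum (S.exactTerm e j ρ φ)
      (S.contField e j (S.Jz e) (S.Mφ e) ρ φ - S.incField e j ρ φ) :=
  (hasSum_contField hJ hM (nonneg_of_inRegion h) (ρ_ne_ρcyl h) φ).congr_fun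
    (fun n => (radCoeff_eq_exactTerm h φ n).symm)

theorem contField_eq_exactField {e j : Region} (hJ : Summable (S.JCoeff e))
    (hM : Summable (S.MCoeff e)) {ρ : ℝ} (h : S.InRegion j ρ) (φ : ℝ) :
    S.contField e j (S.Jz e) (S.Mφ e) ρ φ = S.exactField e j ρ φ := by
  rw [exactField, (hasSum_exactTerm hJ hM h φ).tsum_eq]; ring

/-- Sums over discrete currents converge to the radiation integral over their limit density. -/
theorem tendsto_sum_mul_kernel {f g : ℝ → ℂ} {a c : ℤ → ℂ} (ha : Summable a) (hc : Summable c)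
    (hf : ∀ θ, HasSum (fun n => a n * fourierMode n θ) (f θ))
    (hg : ∀ θ, HasSum (fun n => c n * fourierMode n θ) (g θ)) {r : ℝ} (hr : 0 < r)
    {u : (N : ℕ) → Fin N → ℂ} (hu : ∀ δ : ℝ, 0 < δ → ∀ᶠ N : ℕ in atTop, ∀ l : Fin N,
      ‖(N : ℂ) * u N l / (2 * Real.pi * r) - f (angle N (l : ℕ))‖ < δ) (φ : ℝ) :
    Tendsto (fun N : ℕ => ∑ l : Fin N, u N l * g (angle N (l : ℕ) - φ)) atTop
      (𝓝 (r * ∫ θ in (-Real.pi)..Real.pi, f θ * g (θ - φ))) := by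
  have h1 := (tendsto_mean_convolution ha hc hf hg φ).const_mul (2 * Real.pi * r : ℂ)
  have e1 : (r : ℂ) * ∫ θ in (-Real.pi)..Real.pi, f θ * g (θ - φ)
      = 2 * Real.pi * r * ∑' n : ℤ, a n * c (-n) * fourierMode n φ := by
    rw [integral_convolution ha hc hf hg]; ring
  rw [e1]
  have hpi := Real.pi_pos
  set G := ∑' n, ‖c n‖ with hG
  have hG0 : 0 ≤ G := tsum_nonneg fun n => norm_nonneg _
  refine (tendsto_iff_of_dist ?_).1 h1
  rw [Metric.tendsto_nhds]
  intro ε hε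
  have hδ : 0 < ε / (2 * Real.pi * r * (G + 1)) := by positivity
  filter_upwards [hu _ hδ, eventually_gt_atTop 0] with N hN hN0
  have hN' : (N : ℂ) ≠ 0 := by exact_mod_cast hN0.ne'
  have hNr : (0 : ℝ) < N := by exact_mod_cast hN0
  have hpi' : (Real.pi : ℂ) ≠ 0 := by exact_mod_cast Real.pi_ne_zero
  have hr' : (r : ℂ) ≠ 0 := by exact_mod_cast hr.ne'
  have e2 : 2 * Real.pi * r * (1 / (N : ℂ) * ∑ l : Fin N,
        f (angle N (l : ℕ)) * g (angle N (l : ℕ) - φ))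
      - ∑ l : Fin N, u N l * g (angle N (l : ℕ) - φ)
      = -(2 * Real.pi * r / N) * ∑ l : Fin N, ((N : ℂ) * u N l / (2 * Real.pi * r)
        - f (angle N (l : ℕ))) * g (angle N (l : ℕ) - φ) := by
    rw [Finset.mul_sum, Finset.mul_sum, Finset.mul_sum, ← Finset.sum_sub_distrib]
    refine Finset.sum_congr rfl fun l _ => ?_
    field_simp
    ring
  have e3 : ‖∑ l : Fin N, ((N : ℂ) * u N l / (2 * Real.pi * r)
        - f (angle N (l : ℕ))) * g (angle N (l : ℕ) - φ)‖
      ≤ N * (ε / (2 * Real.pi * r * (G + 1)) * G) := by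
    refine (norm_sum_le _ _).trans ?_
    refine (Finset.sum_le_card_nsmul _ _ (ε / (2 * Real.pi * r * (G + 1)) * G) fun l _ => ?_).trans
      (le_of_eq (by simp))
    rw [norm_mul]
    exact mul_le_mul (hN l).le (norm_le_tsum_of_hasSum hc hg _) (norm_nonneg _) hδ.le
  have e4 : ‖(-(2 * Real.pi * r / N) : ℂ)‖ = 2 * Real.pi * r / N := by
    rw [norm_neg,
      show (2 * Real.pi * r / N : ℂ) = ((2 * Real.pi * r / N : ℝ) : ℂ) by push_cast; rfl,
      Complex.norm_real, Real.norm_of_nonneg (by positivity)]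
  rw [dist_zero_right, Real.norm_of_nonneg dist_nonneg, dist_eq_norm, e2, norm_mul, e4]
  calc 2 * Real.pi * r / N * _
      ≤ 2 * Real.pi * r / N * (N * (ε / (2 * Real.pi * r * (G + 1)) * G)) := by gcongr
    _ = ε * (G / (G + 1)) := by field_simp
    _ < ε * 1 := by
        gcongr
        rw [div_lt_one (by positivity)]; linarith
    _ = ε := mul_one ε

end Cylinder

/-! ### Resonant radii -/

theorem besselJ_eq_zero_iff_natAbs (n : ℤ) (x : ℝ) :
    besselJ n x = 0 ↔ besselJNat n.natAbs x = 0 := by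
  rw [besselJ]
  split_ifs
  · rfl
  · simp

/-- A Bessel function has finitely many positive zeros on a bounded interval: after division by the
power of `x` in front, it is analytic and does not vanish at the origin. -/
theorem finite_besselJNat_zeros (n : ℕ) (X : ℝ) :
    {x : ℝ | 0 < x ∧ x ≤ X ∧ besselJNat n x = 0}.Finite := by
  set f : ℝ → ℝ := fun x => powerSum (coeffJ n) ((x / 2) ^ 2) with hf
  have hfa : ∀ x, AnalyticAt ℝ f x := by
    intro x
    have hp : AnalyticAt ℝ (fun x : ℝ => (x / 2) ^ 2) x := by fun_prop
    exact AnalyticAt.fun_comp (f := fun x : ℝ => (x / 2) ^ 2)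
      ((factorialDecay_coeffJ n).analyticAt ((x / 2) ^ 2)) hp
  have hf0 : f 0 ≠ 0 := by
    simp only [hf, zero_div, ne_eq, OfNat.ofNat_ne_zero, not_false_eq_true, zero_pow, powerSum_zero]
    simp [coeffJ, Nat.factorial_ne_zero]
  by_contra hinf
  obtain ⟨x, -, hx⟩ := (Set.not_finite.1 hinf : Set.Infinite _).exists_accPt_of_subset_isCompact
    (isCompact_Icc (a := 0) (b := X)) fun x hx => ⟨hx.1.le, hx.2.1⟩
  have hfreq : ∃ᶠ y in 𝓝[≠] x, f y = 0 := by
    refine (accPt_iff_frequently_nhdsNE.1 hx).mono fun y hy => ?_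
    have := hy.2.2
    rw [besselJNat_eq] at this
    exact (mul_eq_zero.1 this).resolve_left (pow_ne_zero _ (by have := hy.1; positivity))
  have h0 := AnalyticOnNhd.eqOn_zero_of_preconnected_of_frequently_eq_zero
    (fun y _ => hfa y) isPreconnected_univ (Set.mem_univ x) hfreq
  exact hf0 (h0 (Set.mem_univ 0))

/-- Only finitely many orders have zeros in a bounded interval, since `J_n` is close to
`(x/2)^n / n!` for large `n`. -/
theorem finite_resonant_radii {k a : ℝ} (hk : 0 < k) :
    {ρ : ℝ | 0 < ρ ∧ ρ < a ∧ ∃ n : ℤ, besselJ n (k * ρ) = 0}.Finite := by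
  set X := k * a with hX
  obtain ⟨M, hM⟩ := exists_nat_gt ((X / 2) ^ 2 * Real.exp ((X / 2) ^ 2))
  have hfin : (⋃ n ∈ Finset.range M, {x : ℝ | 0 < x ∧ x ≤ X ∧ besselJNat n x = 0}).Finite :=
    Set.Finite.biUnion (Finset.finite_toSet _) fun n _ => finite_besselJNat_zeros n X
  refine (hfin.preimage ((mul_right_injective₀ hk.ne').injOn (s := _))).subset ?_
  rintro ρ ⟨h0, h1, n, hn⟩
  have hx : 0 < k * ρ := mul_pos hk h0
  have hxX : k * ρ ≤ X := mul_le_mul_of_nonneg_left h1.le hk.le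
  rw [besselJ_eq_zero_iff_natAbs] at hn
  simp only [Set.mem_preimage, Set.mem_iUnion, Finset.mem_range]
  refine ⟨n.natAbs, ?_, hx, hxX, hn⟩
  by_contra hcon
  refine besselJNat_ne_zero_of_lt hx ?_ hn
  have h2 : (k * ρ / 2) ^ 2 ≤ (X / 2) ^ 2 := by gcongr
  calc (k * ρ / 2) ^ 2 * Real.exp ((k * ρ / 2) ^ 2)
      ≤ (X / 2) ^ 2 * Real.exp ((X / 2) ^ 2) := by gcongr
    _ < (M : ℝ) := hM
    _ ≤ (n.natAbs : ℝ) := by exact_mod_cast not_lt.1 hcon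
    _ < (n.natAbs : ℝ) + 1 := lt_add_one _

/-! ### The discretized method -/

/-- Values at sample points that converge to `φ`, of samples close to a continuous function. -/
theorem tendsto_of_uniform_samples {f : ℝ → ℂ} (hf : Continuous f) {u : (N : ℕ) → Fin N → ℂ} {r : ℂ}
    (hu : ∀ δ : ℝ, 0 < δ → ∀ᶠ N : ℕ in atTop, ∀ l : Fin N,
      ‖(N : ℂ) * u N l / r - f (Cylinder.angle N (l : ℕ))‖ < δ)
    {φ : ℝ} {l : (N : ℕ) → Fin (N + 1)}
    (hl : Tendsto (fun N : ℕ => Cylinder.angle (N + 1) (l N : ℕ)) atTop (𝓝 φ)) :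
    Tendsto (fun N : ℕ => ((N + 1 : ℕ) : ℂ) * u (N + 1) (l N) / r) atTop (𝓝 (f φ)) := by
  refine (tendsto_iff_of_dist ?_).1 ((hf.tendsto φ).comp hl)
  rw [Metric.tendsto_nhds]
  intro δ hδ
  filter_upwards [(tendsto_add_atTop_nat 1).eventually (hu δ hδ)] with N hN
  rw [dist_zero_right, Real.norm_of_nonneg dist_nonneg, dist_comm, dist_eq_norm]
  exact hN (l N)

theorem mainTheorem1 (S : Cylinder) (e : Region)
    (hfil : S.InRegion e S.ρfil)
    (hres : ∀ n : ℤ, besselJ n (S.k .R1 * S.ρaux .R1) ≠ 0) :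
    -- only finitely many radii of the inner auxiliary circle are excluded by `hres`
    {ρ : ℝ | 0 < ρ ∧ ρ < S.ρcyl ∧ ∃ n : ℤ, besselJ n (S.k .R1 * ρ) = 0}.Finite ∧
    -- the system is block-circulant, and is solved in closed form by the DFT
    (∀ N : ℕ, 0 < N →
      (∀ j : Region, (∃ v : Fin N → ℂ, S.blockE N j = Matrix.circulant v) ∧
        (∃ v : Fin N → ℂ, S.blockM N j = Matrix.circulant v)) ∧
      (IsUnit (S.sysMatrix N).det ↔ ∀ m : Fin N, S.disc N m ≠ 0) ∧
      ((∀ m : Fin N, S.disc N m ≠ 0) → ∀ I K : Fin N → ℂ,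
        S.IsDiscreteSolution e I K ↔
          I = Cylinder.invDFT (S.dftI e N) ∧ K = Cylinder.invDFT (S.dftK e N))) ∧
    -- it is uniquely solvable for all large `N`
    (∀ᶠ N : ℕ in atTop, ∀ m : Fin N, S.disc N m ≠ 0) ∧
    -- the continuous densities are well defined and solve the continuous equations
    (∀ n : ℤ, S.den n ≠ 0) ∧
    (∀ φ : ℝ, Summable fun n : ℤ => S.JCoeff e n * Complex.exp (Complex.I * n * φ)) ∧
    (∀ φ : ℝ, Summable fun n : ℤ => S.MCoeff e n * Complex.exp (Complex.I * n * φ)) ∧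
    Continuous (S.Jz e) ∧ Continuous (S.Mφ e) ∧
    (∀ (j : Region) (φ : ℝ), S.contField e j (S.Jz e) (S.Mφ e) (S.ρaux j) φ = 0) ∧
    -- the densities generate the exact fields
    (∀ (j : Region) (ρ φ : ℝ), S.InRegion j ρ → 0 < Cylinder.polarDist ρ S.ρfil φ →
      Summable (S.exactTerm e j ρ φ) ∧
      S.contField e j (S.Jz e) (S.Mφ e) ρ φ = S.exactField e j ρ φ) ∧
    -- large-`N` limits of the normalized discrete currents and of their fields
    (∀ I K : (N : ℕ) → Fin N → ℂ,
      (∀ᶠ N : ℕ in atTop, S.IsDiscreteSolution e (I N) (K N)) →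
      (∀ δ : ℝ, 0 < δ → ∀ᶠ N : ℕ in atTop, ∀ l : Fin N,
        ‖(N : ℂ) * I N l / (2 * Real.pi * S.ρcyl) - S.Jz e (Cylinder.angle N (l : ℕ))‖ < δ ∧
        ‖(N : ℂ) * K N l / (2 * Real.pi * S.ρcyl) - S.Mφ e (Cylinder.angle N (l : ℕ))‖ < δ) ∧
      (∀ (φ : ℝ) (l : (N : ℕ) → Fin (N + 1)),
        Tendsto (fun N : ℕ => Cylinder.angle (N + 1) (l N : ℕ)) atTop (𝓝 φ) →
        Tendsto (fun N : ℕ => ((N + 1 : ℕ) : ℂ) * I (N + 1) (l N) / (2 * Real.pi * S.ρcyl))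
          atTop (𝓝 (S.Jz e φ)) ∧
        Tendsto (fun N : ℕ => ((N + 1 : ℕ) : ℂ) * K (N + 1) (l N) / (2 * Real.pi * S.ρcyl))
          atTop (𝓝 (S.Mφ e φ))) ∧
      (∀ (j : Region) (ρ φ : ℝ), S.InRegion j ρ → 0 < Cylinder.polarDist ρ S.ρfil φ →
        Tendsto (fun N : ℕ => S.discField e j (I N) (K N) ρ φ) atTop
          (𝓝 (S.exactField e j ρ φ)))) := by
  obtain ⟨⟨hJ, limJ⟩, hM, limM⟩ := Cylinder.current_limits hfil hres
  have hdisc := Cylinder.eventually_disc_ne_zero hres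
  have hJc : Continuous (S.Jz e) := continuous_tsum_fourierMode hJ
  have hMc : Continuous (S.Mφ e) := continuous_tsum_fourierMode hM
  refine ⟨finite_resonant_radii (S.k_pos .R1), fun N hN => ⟨fun j =>
      ⟨S.exists_blockE_eq_circulant hN j, S.exists_blockM_eq_circulant hN j⟩,
      S.isUnit_det_iff hN, S.isDiscreteSolution_iff e hN⟩, hdisc, S.den_ne_zero,
    fun φ => (hasSum_tsum_fourierMode hJ φ).summable,
    fun φ => (hasSum_tsum_fourierMode hM φ).summable, hJc, hMc,
    Cylinder.contField_aux hfil hJ hM,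
    fun j ρ φ hρ _ => ⟨(Cylinder.hasSum_exactTerm hJ hM hρ φ).summable,
      Cylinder.contField_eq_exactField hJ hM hρ φ⟩, fun I K hIK => ?_⟩
  have hsol : ∀ᶠ N : ℕ in atTop, I N = Cylinder.invDFT (S.dftI e N) ∧
      K N = Cylinder.invDFT (S.dftK e N) := by
    filter_upwards [hIK, hdisc, eventually_gt_atTop 0] with N h1 h2 hN
    exact (S.isDiscreteSolution_iff e hN h2 _ _).1 h1
  have limI : ∀ δ : ℝ, 0 < δ → ∀ᶠ N : ℕ in atTop, ∀ l : Fin N,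
      ‖(N : ℂ) * I N l / (2 * Real.pi * S.ρcyl) - S.Jz e (Cylinder.angle N (l : ℕ))‖ < δ := by
    intro δ hδ
    filter_upwards [hsol, limJ δ hδ] with N h1 h2
    rwa [h1.1]
  have limK : ∀ δ : ℝ, 0 < δ → ∀ᶠ N : ℕ in atTop, ∀ l : Fin N,
      ‖(N : ℂ) * K N l / (2 * Real.pi * S.ρcyl) - S.Mφ e (Cylinder.angle N (l : ℕ))‖ < δ := by
    intro δ hδ
    filter_upwards [hsol, limM δ hδ] with N h1 h2
    rwa [h1.2]
  refine ⟨fun δ hδ => (limI δ hδ).and (limK δ hδ) |>.mono fun N h l => ⟨h.1 l, h.2 l⟩,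
    fun φ l hl => ⟨tendsto_of_uniform_samples hJc limI hl,
      tendsto_of_uniform_samples hMc limK hl⟩, fun j ρ φ hρ _ => ?_⟩
  have hJs : ∀ θ, HasSum (fun n => S.JCoeff e n * fourierMode n θ) (S.Jz e θ) :=
    hasSum_tsum_fourierMode hJ
  have hMs : ∀ θ, HasSum (fun n => S.MCoeff e n * fourierMode n θ) (S.Mφ e θ) :=
    hasSum_tsum_fourierMode hM
  have hρ0 := Cylinder.nonneg_of_inRegion hρ
  have hne := Cylinder.ρ_ne_ρcyl hρ
  have t1 := Cylinder.tendsto_sum_mul_kernel hJ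
    (summable_coefE (S.k_pos j) S.ρcyl_pos.le hρ0 hne) hJs
    (S.hasSum_kerE j hρ0 hne) S.ρcyl_pos limI φ
  have t2 := Cylinder.tendsto_sum_mul_kernel hM (S.summable_coefM j hρ0 hne)
    hMs (S.hasSum_kerM j hρ0 hne) S.ρcyl_pos limK φ
  have t := (((t1.const_mul (-((S.k j * S.Z j / 4 : ℝ) : ℂ))).add
    (t2.const_mul (((S.k j : ℝ) : ℂ) / (4 * Complex.I)))).const_mul j.sgn).const_add
      (S.incField e j ρ φ)
  rw [← Cylinder.contField_eq_exactField hJ hM hρ φ]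
  refine (congrArg (fun z => Tendsto (fun N => S.discField e j (I N) (K N) ρ φ) atTop
    (𝓝 z)) ?_).mpr t
  rw [Cylinder.contField]
  push_cast
  ring
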